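/- **Theorem (Error estimate: finite particle ensemble Kalman filter).** Let $d_u,d_y,J\ge 0$ be integers, let $\Sigma\in\mathbb R^{d_u\times d_u}$ and $\Gamma\in\mathbb R^{d_y\times d_y}$ be symmetric positive definite, and let $|\cdot|$ be the Euclidean norm, $|x|_S^2=x^{\mathsf T}S^{-1}x$. *True filter.* Given $\Psi:\mathbb R^{d_u}\to\mathbb R^{d_u}$, $h:\mathbb R^{d_u}\to\mathbb R^{d_y}$, data $y_1^\dagger,\dots,y_J^\dagger\in\mathbb R^{d_y}$ and a probability measure $\mu_0$ on $\mathbb R^{d_u}$, define $\mu_{j+1}=\mathsf B_j\mathsf Q\mathsf P\mu_j$ for $0\le j<J$, where, in terms of Lebesgue densities, $$\mathsf P\mu(u)=\frac{1}{\sqrt{(2\pi)^{d_u}\det\Sigma}}\int e^{-\frac12|u-\Psi(v)|_\Sigma^2}\,\mu(dv),\qquad \mathsf Q\rho(u,y)=\frac{1}{\sqrt{(2\pi)^{d_y}\det\Gamma}}\,e^{-\frac12|y-h(u)|_\Gamma^2}\rho(u),\qquad \mathsf B_j\pi(u)=\frac{\pi(u,y_{j+1}^\dagger)}{\int \pi(U,y_{j+1}^\dagger)\,dU}.$$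 *Ensemble Kalman filter.* For $N\ge1$ let $u_0^{(i)}\sim\mu_0$, $\xi_j^{(i)}\sim\mathcal N(0,\Sigma)$, $\eta_{j+1}^{(i)}\sim\mathcal N(0,\Gamma)$ ($1\le i\le N$, $0\le j<J$) be mutually independent random vectors and set $$\widehat u^{(i)}_{j+1}=\Psi(u^{(i)}_j)+\xi^{(i)}_j,\qquad \widehat y^{(i)}_{j+1}=h(\widehat u^{(i)}_{j+1})+\eta^{(i)}_{j+1},\qquad u^{(i)}_{j+1}=\widehat u^{(i)}_{j+1}+\mathcal C^{uh}(\widehat\pi_{j+1})\bigl(\mathcal C^{hh}(\widehat\pi_{j+1})+\Gamma\bigr)^{-1}\bigl(y^\dagger_{j+1}-\widehat y^{(i)}_{j+1}\bigr),$$ where $\widehat\pi_{j+1}=\frac1N\sum_{i=1}^N\delta_{(\widehat u^{(i)}_{j+1},\widehat y^{(i)}_{j+1})}$ and, for $(u,y)\sim\pi$, $\mathcal C^{uh}(\pi)$ is the covariance of $u$ and $h(u)$ and $\mathcal C^{hh}(\pi)$ is the covariance of $h(u)$. Let $\mu_J^{\mathrm{EK},N}=\frac1N\sum_{i=1}^N\delta_{u_J^{(i)}}$.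 *Claim.* Put $q=2\max\{3+d_u,\,4+d_y,\,2\cdot4^J\}$. For all positive constants $\kappa_y,\kappa_\Psi,\kappa_h,\ell_h,\ell_\Psi,L_\phi$ and every $m\in\mathbb R$ there is a constant $C>0$, depending only on $m,L_\phi,\kappa_y,\kappa_\Psi,\kappa_h,\ell_h,\ell_\Psi,\Sigma,\Gamma,J$ (and on $d_u,d_y$), such that the following holds. Suppose that - $|y_j^\dagger|\le\kappa_y$ for $1\le j\le J$; - $h$ is affine (in particular, $h$ may be linear), $|h(u)|\le\kappa_h(1+|u|)$ for all $u$, and $h$ is Lipschitz with constant $\ell_h$; - $\Psi_0:\mathbb R^{d_u}\to\mathbb R^{d_u}$ is affine and $|\Psi_0(u)|\le\kappa_\Psi(1+|u|)$ for all $u$; - $\mu_0$ is a Gaussian measure on $\mathbb R^{d_u}$ with $\int|u|^q\,\mu_0(du)\le m$; - $\varepsilon\in[0,1]$, $\sup_u|\Psi(u)-\Psi_0(u)|\le\varepsilon$, and $\Psi$ is Lipschitz with constant $\ell_\Psi$; - $\phi:\mathbb R^{d_u}\to\mathbb R$ satisfies $|\phi(u)-\phi(v)|\le L_\phi|u-v|(1+|u|+|v|)$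 for all $u,v$. Then for every $N\ge1$, $\phi$ is $\mu_J$-integrable, $\mu_J^{\mathrm{EK},N}[\phi]-\mu_J[\phi]$ is square integrable, and $$\Bigl(\mathbb E\,\bigl|\mu_J^{\mathrm{EK},N}[\phi]-\mu_J[\phi]\bigr|^2\Bigr)^{1/2}\le C\Bigl(\frac1{\sqrt N}+\varepsilon\Bigr),$$ where $\mu[\phi]=\int\phi\,d\mu$. -/

import Mathlib

open MeasureTheory ProbabilityTheory

noncomputable section

namespace EnKF

/-- The Euclidean space of dimension `n`. -/
abbrev Vec (n : ℕ) : Type := EuclideanSpace ℝ (Fin n)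

variable {du dy N : ℕ}

/-! ### The true filter -/

/-- The squared weighted norm `|x|_S ^ 2 = |S ^ (-1/2) x| ^ 2 = xᵀ S⁻¹ x`, for `S` positive
definite. -/
def weightedSq {n : ℕ} (S : Matrix (Fin n) (Fin n) ℝ) (x : Vec n) : ℝ :=
  dotProduct x.ofLp (S⁻¹.mulVec x.ofLp)

/-- The Lebesgue density of the centered Gaussian with positive definite covariance `S`. -/
def gaussianDensity {n : ℕ} (S : Matrix (Fin n) (Fin n) ℝ) (z : Vec n) : ℝ :=
  1 / √((2 * Real.pi) ^ n * S.det) * Real.exp (-(1 / 2) * weightedSq S z)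

/-- The prediction operator: the Lebesgue density of the law of `Ψ v + ξ`, where `v ∼ μ` and
`ξ ∼ N(0, S)` are independent. -/
def predictOp (Ψ : Vec du → Vec du) (S : Matrix (Fin du) (Fin du) ℝ) (μ : Measure (Vec du)) :
    Vec du → ℝ :=
  fun u => ∫ v, gaussianDensity S (u - Ψ v) ∂μ

/-- The lifting operator to state-observation space, on Lebesgue densities: from the density of `U`
to that of `(U, h U + η)`, where `η ∼ N(0, Γ)` is independent of `U`. -/
def liftOp (h : Vec du → Vec dy) (Γ : Matrix (Fin dy) (Fin dy) ℝ) (ρ : Vec du → ℝ) :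
    Vec du × Vec dy → ℝ :=
  fun p => gaussianDensity Γ (p.2 - h p.1) * ρ p.1

/-- Conditioning a density on state-observation space on the datum `y`. -/
def condOp (y : Vec dy) (ρ : Vec du × Vec dy → ℝ) : Vec du → ℝ :=
  fun u => ρ (u, y) / ∫ U, ρ (U, y)

/-- The filtering distributions: `μ_0` is given and `μ_{j+1}` is obtained from `μ_j` by
prediction, lifting and conditioning on the datum `y_{j+1}`. -/
def trueFilter (Ψ : Vec du → Vec du) (h : Vec du → Vec dy) (S : Matrix (Fin du) (Fin du) ℝ)
    (Γ : Matrix (Fin dy) (Fin dy) ℝ) (y : ℕ → Vec dy) (μ₀ : Measure (Vec du)) :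
    ℕ → Measure (Vec du)
  | 0 => μ₀
  | j + 1 => volume.withDensity fun u => ENNReal.ofReal
      (condOp (y (j + 1)) (liftOp h Γ (predictOp Ψ S (trueFilter Ψ h S Γ y μ₀ j))) u)

/-! ### The ensemble Kalman filter -/

/-- The empirical measure `(1 / N) ∑ i, δ_{x i}`. -/
def empirical {E : Type*} [MeasurableSpace E] (x : Fin N → E) : Measure E :=
  (N : ENNReal)⁻¹ • ∑ i, Measure.dirac (x i)

/-- The covariance matrix of `u` and `h u`, for `(u, y) ∼ π`. -/
def covUH (h : Vec du → Vec dy) (π : Measure (Vec du × Vec dy)) : Matrix (Fin du) (Fin dy) ℝ :=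
  Matrix.of fun a b => covariance (fun p => p.1 a) (fun p => h p.1 b) π

/-- The covariance matrix of `h u`, for `(u, y) ∼ π`. -/
def covHH (h : Vec du → Vec dy) (π : Measure (Vec du × Vec dy)) : Matrix (Fin dy) (Fin dy) ℝ :=
  Matrix.of fun a b => covariance (fun p => h p.1 a) (fun p => h p.1 b) π

/-- The Kalman gain. -/
def gain (h : Vec du → Vec dy) (Γ : Matrix (Fin dy) (Fin dy) ℝ)
    (π : Measure (Vec du × Vec dy)) : Matrix (Fin du) (Fin dy) ℝ :=
  covUH h π * (covHH h π + Γ)⁻¹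

/-- The predicted particles `û i = Ψ (x i) + ξ i`. -/
def predicted (Ψ : Vec du → Vec du) (x ξ : Fin N → Vec du) : Fin N → Vec du :=
  fun i => Ψ (x i) + ξ i

/-- The simulated observations `ŷ i = h (û i) + η i`. -/
def simulated (h : Vec du → Vec dy) (uhat : Fin N → Vec du) (η : Fin N → Vec dy) :
    Fin N → Vec dy :=
  fun i => h (uhat i) + η i

/-- The analysis step `û i + K (y - ŷ i)`, where `K` is the Kalman gain of the empirical measure
of the pairs `(û i, ŷ i)`. -/
def analysis (h : Vec du → Vec dy) (Γ : Matrix (Fin dy) (Fin dy) ℝ) (y : Vec dy)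
    (uhat : Fin N → Vec du) (yhat : Fin N → Vec dy) : Fin N → Vec du :=
  fun i => uhat i + WithLp.toLp 2
    ((gain h Γ (empirical fun k => (uhat k, yhat k))).mulVec (y - yhat i).ofLp)

/-- The particles of the ensemble Kalman filter, for given initial particles `u₀ i` and given
values `ξ j i` and `η j i` of the noises. The step from time `j` to time `j + 1` uses `ξ j`,
`η (j + 1)` and the datum `y (j + 1)`. -/
def particles (Ψ : Vec du → Vec du) (h : Vec du → Vec dy) (Γ : Matrix (Fin dy) (Fin dy) ℝ)
    (y : ℕ → Vec dy) (u₀ : Fin N → Vec du) (ξ : ℕ → Fin N → Vec du) (η : ℕ → Fin N → Vec dy) :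
    ℕ → Fin N → Vec du
  | 0 => u₀
  | j + 1 =>
      analysis h Γ (y (j + 1)) (predicted Ψ (particles Ψ h Γ y u₀ ξ η j) (ξ j))
        (simulated h (predicted Ψ (particles Ψ h Γ y u₀ ξ η j) (ξ j)) (η (j + 1)))

/-- The empirical measure of the particles at time `j`. -/
def ensembleMeasure (Ψ : Vec du → Vec du) (h : Vec du → Vec dy) (Γ : Matrix (Fin dy) (Fin dy) ℝ)
    (y : ℕ → Vec dy) (u₀ : Fin N → Vec du) (ξ : ℕ → Fin N → Vec du) (η : ℕ → Fin N → Vec dy)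
    (j : ℕ) : Measure (Vec du) :=
  empirical (particles Ψ h Γ y u₀ ξ η j)

/-- The random inputs of the `N`-particle filter up to time `J`: the initial particles have law
`μ₀`, the noises `ξ j i` for `0 ≤ j < J` have law `N(0, S)`, the noises `η j i` for `1 ≤ j ≤ J`
have law `N(0, Γ)`, and all of these random vectors are mutually independent. -/
structure IsInput {Ω : Type*} [MeasurableSpace Ω] (P : Measure Ω) (μ₀ : Measure (Vec du))
    (S : Matrix (Fin du) (Fin du) ℝ) (Γ : Matrix (Fin dy) (Fin dy) ℝ) (J : ℕ)
    (u₀ : Fin N → Ω → Vec du) (ξ : ℕ → Fin N → Ω → Vec du) (η : ℕ → Fin N → Ω → Vec dy) :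
    Prop where
  measurable_init : ∀ i, Measurable (u₀ i)
  measurable_state : ∀ j < J, ∀ i, Measurable (ξ j i)
  measurable_obs : ∀ j < J, ∀ i, Measurable (η (j + 1) i)
  law_init : ∀ i, P.map (u₀ i) = μ₀
  law_state : ∀ j < J, ∀ i, P.map (ξ j i) = multivariateGaussian 0 S
  law_obs : ∀ j < J, ∀ i, P.map (η (j + 1) i) = multivariateGaussian 0 Γ
  indep : iIndep (Sum.elim (fun i : Fin N => MeasurableSpace.comap (u₀ i) inferInstance)
    (Sum.elim
      (fun k : Fin J × Fin N => MeasurableSpace.comap (ξ k.1 k.2) inferInstance)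
      (fun k : Fin J × Fin N => MeasurableSpace.comap (η (k.1 + 1) k.2) inferInstance))) P

end EnKF

end

namespace EnKF

/-! ### Matrices and the Kalman gain -/

section MatrixBounds

open scoped Matrix.Norms.L2Operator

/-! The observation map and the reference dynamics `Ψ₀` are affine and the initial law is Gaussian,
so the filter of the reference model stays Gaussian. Its conditioning step is realized exactly by
the analysis step with the gain of the predicted law (`map_gainStep_eq`): the residual of the linear
regression of the state on the noisy observation is uncorrelated with the observation, hence
independent of it. Therefore particles that use `Ψ₀`, the deterministic gains `filterGain` and the
inputs of the ensemble have exactly the law of the reference filter (`IsInput.meanField_law`), and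
they are independent of each other. These mean-field particles stand between the ensemble and the
true filter, and the error splits into three parts.

Ensemble against mean-field particles. Both are driven by the same inputs, so the noises cancel in
the difference and the comparison is pathwise. The inverse of `C + Γ` is bounded uniformly over
positive semidefinite `C` (`opNorm_inv_posSemidef_add_le`), so the empirical gain grows at most
quadratically in the root mean square of the ensemble, and all quantities are polynomial in `M`, the
root mean square of the input sizes. A discrete Gronwall argument
(`exists_rms_particles_sub_meanField_le`) bounds the distance by `A * (ε + R) * M ^ p`, where `R *
M` controls the errors of the empirical covariances of the mean-field particles. Independence gives
`R` a fourth moment of order `N⁻²` (`exists_covariance_error`). Moments of `M` of every order are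
available, because all moments of a Gaussian law are controlled by its second one
(`exists_integral_norm_pow_le`). As `R` and `M` are dependent, a weighted Young inequality
(`sq_add_error_le`) separates them.

Mean-field average against reference filter. This is an average of independent variables with the
correct mean, so its mean square error is of order `N⁻¹` (`IsInput.integral_avg_sub_pow_le`).

Reference filter against true filter. A filter is a normalized expectation over paths of the signal,
weighted with the likelihood of the data (`IsInput.lintegral_trueFilter`). When the paths of `Ψ` and
`Ψ₀` share their noises, paths and weights differ by `ε` times a power of the input size, and
Jensen's inequality (`le_integral_exp_neg`) keeps the normalizing constants away from zero. Hence
the two filters differ by a multiple of `ε` on test functions of quadratic growth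
(`exists_trueFilter_sub_le`). -/

lemma norm_toLp_mulVec_le {n k : ℕ} (A : Matrix (Fin n) (Fin k) ℝ) (x : Vec k) :
    ‖(WithLp.toLp 2 (A.mulVec x.ofLp) : Vec n)‖ ≤ ‖A‖ * ‖x‖ :=
  Matrix.l2_opNorm_mulVec A x

lemma opNorm_le_of_mulVec {n k : ℕ} (A : Matrix (Fin n) (Fin k) ℝ) {c : ℝ} (hc : 0 ≤ c)
    (hA : ∀ x : Vec k, ‖(WithLp.toLp 2 (A.mulVec x.ofLp) : Vec n)‖ ≤ c * ‖x‖) : ‖A‖ ≤ c := by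
  rw [Matrix.l2_opNorm_def]
  exact ContinuousLinearMap.opNorm_le_bound _ hc hA

lemma abs_coord_le_norm {n : ℕ} (x : Vec n) (a : Fin n) : |x a| ≤ ‖x‖ := by
  simpa using PiLp.norm_apply_le x a

lemma norm_le_sum_abs_coord {n : ℕ} (x : Vec n) : ‖x‖ ≤ ∑ a, |x a| := by
  rw [EuclideanSpace.norm_eq, Real.sqrt_le_left (Finset.sum_nonneg fun a _ => abs_nonneg (x a))]
  simpa using Finset.sum_sq_le_sq_sum_of_nonneg (s := Finset.univ) (f := fun a => |x a|)
    (fun a _ => abs_nonneg _)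

lemma opNorm_le_sum_abs {n k : ℕ} (A : Matrix (Fin n) (Fin k) ℝ) :
    ‖A‖ ≤ ∑ a, ∑ b, |A a b| := by
  refine opNorm_le_of_mulVec A (by positivity) fun x => ?_
  refine (norm_le_sum_abs_coord _).trans ?_
  rw [Finset.sum_mul]
  refine Finset.sum_le_sum fun a _ => ?_
  simp only [Matrix.mulVec, dotProduct]
  refine (Finset.abs_sum_le_sum_abs _ _).trans ?_
  rw [Finset.sum_mul]
  refine Finset.sum_le_sum fun b _ => ?_
  rw [abs_mul]
  exact mul_le_mul_of_nonneg_left (abs_coord_le_norm x b) (abs_nonneg _)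

/-- Reduces every estimate of a covariance matrix to scalar covariances, at the price of a
dimensional factor. -/
lemma opNorm_le_of_forall_abs_le {n k : ℕ} (A : Matrix (Fin n) (Fin k) ℝ) {c : ℝ}
    (hA : ∀ a b, |A a b| ≤ c) : ‖A‖ ≤ n * k * c := by
  refine (opNorm_le_sum_abs A).trans ?_
  refine (Finset.sum_le_sum fun a _ => Finset.sum_le_sum fun b _ => hA a b).trans ?_
  simp [mul_assoc]

lemma abs_dotProduct_le {n : ℕ} (x y : Vec n) : |dotProduct x.ofLp y.ofLp| ≤ ‖x‖ * ‖y‖ := by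
  have := abs_real_inner_le_norm y x
  rw [EuclideanSpace.inner_eq_star_dotProduct] at this
  simpa [mul_comm] using this

lemma dotProduct_self_eq {n : ℕ} (x : Vec n) : dotProduct x.ofLp x.ofLp = ‖x‖ ^ 2 := by
  rw [EuclideanSpace.norm_sq_eq]
  simp [dotProduct, sq]

/-- The quadratic form attains a positive minimum on the compact unit sphere, and homogeneity
extends the bound. In dimension zero the sphere is empty and any constant serves. -/
lemma exists_pos_mul_sq_le {n : ℕ} {G : Matrix (Fin n) (Fin n) ℝ} (hG : G.PosDef) :
    ∃ c : ℝ, 0 < c ∧ ∀ x : Vec n, c * ‖x‖ ^ 2 ≤ dotProduct x.ofLp (G.mulVec x.ofLp) := by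
  have hcont : Continuous fun x : Vec n => dotProduct x.ofLp (G.mulVec x.ofLp) := by
    simp only [dotProduct, Matrix.mulVec]
    fun_prop
  rcases (Metric.sphere (0 : Vec n) 1).eq_empty_or_nonempty with he | hne
  · refine ⟨1, one_pos, fun x => ?_⟩
    have hx : x = 0 := by
      by_contra hx
      have : (‖x‖⁻¹ • x) ∈ Metric.sphere (0 : Vec n) 1 := by
        simp [norm_smul, inv_mul_cancel₀ (norm_ne_zero_iff.2 hx)]
      simp [he] at this
    simp [hx]
  · obtain ⟨z, hz, hmin⟩ := (isCompact_sphere (0 : Vec n) 1).exists_isMinOn hne hcont.continuousOn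
    have hz0 : z.ofLp ≠ 0 := by
      intro h0
      have : z = 0 := by ext a; simp [h0]
      simp [this] at hz
    have hpos : 0 < dotProduct z.ofLp (G.mulVec z.ofLp) := by
      simpa using hG.dotProduct_mulVec_pos hz0
    refine ⟨_, hpos, fun x => ?_⟩
    rcases eq_or_ne x 0 with rfl | hx
    · simp
    have hn : 0 < ‖x‖ := norm_pos_iff.2 hx
    have hmem : (‖x‖⁻¹ • x) ∈ Metric.sphere (0 : Vec n) 1 := by
      simp [norm_smul, inv_mul_cancel₀ hn.ne']
    have := hmin hmem
    simp only [Set.mem_ofPred_eq, WithLp.ofLp_smul, Matrix.mulVec_smul, dotProduct_smul,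
      smul_dotProduct, smul_eq_mul] at this
    calc _ ≤ (‖x‖⁻¹ * (‖x‖⁻¹ * dotProduct x.ofLp (G.mulVec x.ofLp))) * ‖x‖ ^ 2 :=
          mul_le_mul_of_nonneg_right this (by positivity)
      _ = _ := by field_simp

/-- A lower bound on the quadratic form of an invertible matrix bounds the norm of its inverse. -/
lemma opNorm_inv_le {n : ℕ} {A : Matrix (Fin n) (Fin n) ℝ} (hdet : IsUnit A.det) {c : ℝ}
    (hc : 0 < c) (hA : ∀ x : Vec n, c * ‖x‖ ^ 2 ≤ dotProduct x.ofLp (A.mulVec x.ofLp)) :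
    ‖A⁻¹‖ ≤ c⁻¹ := by
  refine opNorm_le_of_mulVec _ (by positivity) fun w => ?_
  set x : Vec n := WithLp.toLp 2 (A⁻¹.mulVec w.ofLp) with hx
  have h1 : A.mulVec x.ofLp = w.ofLp := by
    simp [hx, Matrix.mulVec_mulVec, Matrix.mul_nonsing_inv A hdet]
  have h2 := hA x
  rw [h1] at h2
  have h3 := (le_abs_self _).trans (abs_dotProduct_le x w)
  rcases eq_or_lt_of_le (norm_nonneg x) with h0 | h0
  · rw [← h0]; positivity
  have h4 : c * ‖x‖ ≤ ‖w‖ := by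
    refine le_of_mul_le_mul_left ?_ h0
    calc ‖x‖ * (c * ‖x‖) = c * ‖x‖ ^ 2 := by ring
      _ ≤ ‖x‖ * ‖w‖ := h2.trans h3
  rw [inv_mul_eq_div, le_div_iff₀ hc]
  linarith

lemma isUnit_det_posSemidef_add {n : ℕ} {C G : Matrix (Fin n) (Fin n) ℝ} (hC : C.PosSemidef)
    (hG : G.PosDef) : IsUnit (C + G).det :=
  (Matrix.isUnit_iff_isUnit_det _).1 (Matrix.PosDef.posSemidef_add hC hG).isUnit

/-- A positive semidefinite summand only raises the quadratic form, so the bound does not depend on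
`C`. This makes it applicable to the random covariance of any ensemble, however degenerate. -/
lemma opNorm_inv_posSemidef_add_le {n : ℕ} {C G : Matrix (Fin n) (Fin n) ℝ} (hC : C.PosSemidef)
    (hG : G.PosDef) {c : ℝ} (hc : 0 < c)
    (hcG : ∀ x : Vec n, c * ‖x‖ ^ 2 ≤ dotProduct x.ofLp (G.mulVec x.ofLp)) :
    ‖(C + G)⁻¹‖ ≤ c⁻¹ := by
  refine opNorm_inv_le (isUnit_det_posSemidef_add hC hG) hc fun x => ?_
  rw [Matrix.add_mulVec, dotProduct_add]
  have := hC.dotProduct_mulVec_nonneg x.ofLp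
  simp only [star_trivial] at this
  linarith [hcG x]

/-- Resolvent identity. The form is asymmetric on purpose: of the two gains only the primed one
appears on the right, so with the deterministic gain in that place no a priori bound on the random
gain is needed. -/
lemma opNorm_mul_inv_sub_le {n k : ℕ} {C C' : Matrix (Fin n) (Fin k) ℝ}
    {A A' : Matrix (Fin k) (Fin k) ℝ} (hA : IsUnit A.det) (hA' : IsUnit A'.det) :
    ‖C * A⁻¹ - C' * A'⁻¹‖ ≤ (‖C - C'‖ + ‖C' * A'⁻¹‖ * ‖A - A'‖) * ‖A⁻¹‖ := by
  have h : C * A⁻¹ - C' * A'⁻¹ = ((C - C') - C' * A'⁻¹ * (A - A')) * A⁻¹ := by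
    rw [Matrix.mul_sub, Matrix.mul_assoc C', Matrix.mul_assoc C', Matrix.nonsing_inv_mul A' hA',
      Matrix.mul_one, Matrix.sub_mul, Matrix.sub_mul, Matrix.sub_mul, ← Matrix.mul_assoc C' A'⁻¹ A,
      Matrix.mul_assoc (C' * A'⁻¹) A, Matrix.mul_nonsing_inv A hA, Matrix.mul_one]
    abel
  rw [h]
  refine (Matrix.l2_opNorm_mul _ _).trans (mul_le_mul_of_nonneg_right ?_ (norm_nonneg _))
  exact (norm_sub_le _ _).trans (add_le_add le_rfl (Matrix.l2_opNorm_mul _ _))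

end MatrixBounds

/-! ### Positivity of the covariance of the observations -/

section Covariance

variable {du dy : ℕ}

/-- The quadratic form at `x` is the variance of the linear combination of the observed coordinates
with coefficients `x`. -/
lemma covHH_posSemidef {h : Vec du → Vec dy} {π : Measure (Vec du × Vec dy)} [IsFiniteMeasure π]
    (hh : ∀ b, MemLp (fun p : Vec du × Vec dy => h p.1 b) 2 π) : (covHH h π).PosSemidef := by
  refine Matrix.PosSemidef.of_dotProduct_mulVec_nonneg ?_ fun x => ?_
  · ext a b
    simp [covHH, covariance_comm]
  · have hx : ∀ b, MemLp (fun p : Vec du × Vec dy => x b * h p.1 b) 2 π :=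
      fun b => (hh b).const_mul _
    have key := covariance_fun_sum_fun_sum hx hx
    have hae : AEMeasurable (fun p : Vec du × Vec dy => ∑ b, x b * h p.1 b) π :=
      Finset.aemeasurable_fun_sum _ fun b _ => (hx b).1.aemeasurable
    rw [covariance_self hae] at key
    have h0 := variance_nonneg (fun p : Vec du × Vec dy => ∑ b, x b * h p.1 b) π
    rw [key] at h0
    simp only [covariance_const_mul_left, covariance_const_mul_right] at h0
    simp only [star_trivial, dotProduct, Matrix.mulVec, covHH, Matrix.of_apply]
    convert! h0 using 2 with a _
    rw [Finset.mul_sum]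
    exact Finset.sum_congr rfl fun b _ => by ring

end Covariance

end EnKF

namespace EnKF

/-! ### Empirical averages -/

section Averages

variable {N : ℕ}

/-- The average of `N` real numbers. -/
noncomputable def avg (f : Fin N → ℝ) : ℝ := (N : ℝ)⁻¹ * ∑ i, f i

/-- The root mean square of the norms of `N` vectors. -/
noncomputable def rms {E : Type*} [NormedAddCommGroup E] (x : Fin N → E) : ℝ :=
  √(avg fun i => ‖x i‖ ^ 2)

/-- The covariance of two tuples of real numbers. -/
noncomputable def tupleCov (f g : Fin N → ℝ) : ℝ := avg (fun i => f i * g i) - avg f * avg g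

lemma avg_add (f g : Fin N → ℝ) : avg (fun i => f i + g i) = avg f + avg g := by
  simp [avg, Finset.sum_add_distrib, mul_add]

lemma avg_sub (f g : Fin N → ℝ) : avg (fun i => f i - g i) = avg f - avg g := by
  simp [avg, Finset.sum_sub_distrib, mul_sub]

lemma avg_const_mul (c : ℝ) (f : Fin N → ℝ) : avg (fun i => c * f i) = c * avg f := by
  simp only [avg, ← Finset.mul_sum]; ring

lemma avg_const [NeZero N] (c : ℝ) : avg (fun _ : Fin N => c) = c := by
  have : (N : ℝ) ≠ 0 := Nat.cast_ne_zero.2 (NeZero.ne N)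
  simp [avg, this]

lemma avg_mono {f g : Fin N → ℝ} (h : ∀ i, f i ≤ g i) : avg f ≤ avg g :=
  mul_le_mul_of_nonneg_left (Finset.sum_le_sum fun i _ => h i) (by positivity)

lemma avg_nonneg {f : Fin N → ℝ} (h : ∀ i, 0 ≤ f i) : 0 ≤ avg f :=
  mul_nonneg (by positivity) (Finset.sum_nonneg fun i _ => h i)

lemma abs_avg_le_avg_abs (f : Fin N → ℝ) : |avg f| ≤ avg fun i => |f i| := by
  rw [avg, abs_mul, abs_of_nonneg (by positivity : (0 : ℝ) ≤ (N : ℝ)⁻¹)]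
  exact mul_le_mul_of_nonneg_left (Finset.abs_sum_le_sum_abs _ _) (by positivity)

lemma avg_pow_le [NeZero N] {f : Fin N → ℝ} (h : ∀ i, 0 ≤ f i) (p : ℕ) :
    avg f ^ p ≤ avg fun i => f i ^ p := by
  have hN : (N : ℝ) ≠ 0 := Nat.cast_ne_zero.2 (NeZero.ne N)
  have := Real.pow_arith_mean_le_arith_mean_pow Finset.univ (fun _ : Fin N => (N : ℝ)⁻¹) f
    (fun _ _ => by positivity) (by simp [hN]) (fun i _ => h i) p
  simpa only [avg, Finset.mul_sum] using this

lemma rms_sq {E : Type*} [NormedAddCommGroup E] (x : Fin N → E) :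
    rms x ^ 2 = avg fun i => ‖x i‖ ^ 2 :=
  Real.sq_sqrt (avg_nonneg fun i => by positivity)

lemma rms_nonneg {E : Type*} [NormedAddCommGroup E] (x : Fin N → E) : 0 ≤ rms x :=
  Real.sqrt_nonneg _

lemma rms_mono {E F : Type*} [NormedAddCommGroup E] [NormedAddCommGroup F] {x : Fin N → E}
    {z : Fin N → F} (h : ∀ i, ‖x i‖ ≤ ‖z i‖) : rms x ≤ rms z :=
  Real.sqrt_le_sqrt (avg_mono fun i => pow_le_pow_left₀ (norm_nonneg _) (h i) 2)

lemma rms_const [NeZero N] {E : Type*} [NormedAddCommGroup E] (c : E) :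
    rms (fun _ : Fin N => c) = ‖c‖ := by
  rw [rms, avg_const, Real.sqrt_sq (norm_nonneg _)]

lemma rms_const_mul (c : ℝ) (f : Fin N → ℝ) : rms (fun i => c * f i) = |c| * rms f := by
  simp only [rms, norm_mul, mul_pow, avg_const_mul]
  rw [Real.sqrt_mul (by positivity), Real.sqrt_sq (norm_nonneg _), Real.norm_eq_abs]

/-- The root mean square is a rescaled `ℓ²` norm, which supplies the triangle inequality and the
Cauchy–Schwarz inequality below. -/
lemma rms_eq_norm_toLp {E : Type*} [NormedAddCommGroup E] (x : Fin N → E) :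
    rms x = √((N : ℝ)⁻¹) * ‖WithLp.toLp 2 x‖ := by
  rw [rms, avg, Real.sqrt_mul (by positivity), PiLp.norm_eq_of_L2]

lemma rms_add_le {E : Type*} [NormedAddCommGroup E] (x z : Fin N → E) :
    rms (fun i => x i + z i) ≤ rms x + rms z := by
  simp only [rms_eq_norm_toLp, ← mul_add]
  refine mul_le_mul_of_nonneg_left ?_ (Real.sqrt_nonneg _)
  exact norm_add_le (WithLp.toLp 2 x) (WithLp.toLp 2 z)

lemma rms_le_add {E F G : Type*} [NormedAddCommGroup E] [NormedAddCommGroup F]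
    [NormedAddCommGroup G] {x : Fin N → E} {z : Fin N → F} {w : Fin N → G}
    (h : ∀ i, ‖x i‖ ≤ ‖z i‖ + ‖w i‖) : rms x ≤ rms z + rms w := by
  calc rms x ≤ rms fun i => ‖z i‖ + ‖w i‖ :=
        rms_mono fun i => (h i).trans (le_abs_self _)
    _ ≤ rms (fun i => ‖z i‖) + rms fun i => ‖w i‖ := rms_add_le _ _
    _ = _ := by simp [rms]

lemma rms_le_const_add_mul [NeZero N] {E F : Type*} [NormedAddCommGroup E] [NormedAddCommGroup F]
    {x : Fin N → E} {z : Fin N → F} {a b : ℝ} (ha : 0 ≤ a) (hb : 0 ≤ b)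
    (h : ∀ i, ‖x i‖ ≤ a + b * ‖z i‖) : rms x ≤ a + b * rms z := by
  calc rms x ≤ rms (fun _ : Fin N => a) + rms fun i => b * ‖z i‖ :=
        rms_le_add fun i => (h i).trans (add_le_add (le_abs_self _) (le_abs_self _))
    _ = a + b * rms z := by
        rw [rms_const, rms_const_mul, Real.norm_of_nonneg ha, abs_of_nonneg hb]
        simp [rms]

lemma rms_le_mul {E F : Type*} [NormedAddCommGroup E] [NormedAddCommGroup F]
    {x : Fin N → E} {z : Fin N → F} {b : ℝ} (hb : 0 ≤ b)
    (h : ∀ i, ‖x i‖ ≤ b * ‖z i‖) : rms x ≤ b * rms z := by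
  calc rms x ≤ rms fun i => b * ‖z i‖ := rms_mono fun i => (h i).trans (le_abs_self _)
    _ = b * rms z := by
        rw [rms_const_mul, abs_of_nonneg hb]
        simp [rms]

lemma abs_avg_mul_le (f g : Fin N → ℝ) : |avg fun i => f i * g i| ≤ rms f * rms g := by
  rw [rms_eq_norm_toLp, rms_eq_norm_toLp, avg, abs_mul, abs_of_nonneg (by positivity)]
  have h := abs_real_inner_le_norm (WithLp.toLp 2 g : EuclideanSpace ℝ (Fin N)) (WithLp.toLp 2 f)
  rw [EuclideanSpace.inner_eq_star_dotProduct] at h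
  simp only [dotProduct, star_trivial] at h
  calc _ ≤ (N : ℝ)⁻¹ * (‖(WithLp.toLp 2 g : EuclideanSpace ℝ (Fin N))‖ *
        ‖(WithLp.toLp 2 f : EuclideanSpace ℝ (Fin N))‖) :=
        mul_le_mul_of_nonneg_left h (by positivity)
    _ = (√((N : ℝ)⁻¹) * √((N : ℝ)⁻¹)) * (‖(WithLp.toLp 2 g : EuclideanSpace ℝ (Fin N))‖ *
        ‖(WithLp.toLp 2 f : EuclideanSpace ℝ (Fin N))‖) := by
        rw [Real.mul_self_sqrt (by positivity)]
    _ = _ := by ring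

lemma abs_avg_le_rms [NeZero N] (f : Fin N → ℝ) : |avg f| ≤ rms f := by
  have := abs_avg_mul_le f (fun _ : Fin N => (1 : ℝ))
  simpa [rms_const] using this

lemma abs_tupleCov_le [NeZero N] (f g : Fin N → ℝ) : |tupleCov f g| ≤ 2 * (rms f * rms g) := by
  rw [tupleCov, two_mul]
  refine (abs_sub _ _).trans (add_le_add (abs_avg_mul_le f g) ?_)
  rw [abs_mul]
  exact mul_le_mul (abs_avg_le_rms f) (abs_avg_le_rms g) (abs_nonneg _) (rms_nonneg _)

/-- Bilinearity of the covariance: change one argument at a time. -/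
lemma abs_tupleCov_sub_le [NeZero N] (f g f' g' : Fin N → ℝ) :
    |tupleCov f g - tupleCov f' g'| ≤
      2 * (rms (fun i => f i - f' i) * rms g) + 2 * (rms f' * rms fun i => g i - g' i) := by
  have h : tupleCov f g - tupleCov f' g' =
      tupleCov (fun i => f i - f' i) g + tupleCov f' (fun i => g i - g' i) := by
    simp only [tupleCov, sub_mul, mul_sub, avg_sub]
    ring
  rw [h]
  exact (abs_add_le _ _).trans (add_le_add (abs_tupleCov_le _ _) (abs_tupleCov_le _ _))

/-- Centering both tuples expresses the error of the covariance through two fluctuations. -/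
lemma tupleCov_sub_eq [NeZero N] (f g : Fin N → ℝ) (a b c : ℝ) :
    tupleCov f g - c = (avg (fun i => (f i - a) * (g i - b)) - c) -
      avg (fun i => f i - a) * avg (fun i => g i - b) := by
  have h1 : avg (fun i => (f i - a) * (g i - b)) =
      avg (fun i => f i * g i) - b * avg f - a * avg g + a * b := by
    have : (fun i => (f i - a) * (g i - b)) =
        fun i => (((f i * g i) - b * f i) - a * g i) + a * b := by ext i; ring
    rw [this, avg_add, avg_sub, avg_sub, avg_const_mul, avg_const_mul, avg_const]
  rw [h1, avg_sub, avg_sub, avg_const, avg_const, tupleCov]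
  ring

end Averages

/-! ### Integration against empirical measures -/

section Empirical

variable {N : ℕ} {E : Type*} [MeasurableSpace E]

instance isProbabilityMeasure_empirical [NeZero N] (x : Fin N → E) :
    IsProbabilityMeasure (empirical x) := by
  refine ⟨?_⟩
  have h0 : (N : ENNReal) ≠ 0 := Nat.cast_ne_zero.2 (NeZero.ne N)
  simp [empirical, ENNReal.inv_mul_cancel h0 (ENNReal.natCast_ne_top N)]

variable [MeasurableSingletonClass E]

/-- Measurability of `f` is not needed: singletons are measurable, so any function is almost
everywhere constant for a Dirac mass. -/
lemma integrable_empirical [NeZero N] (x : Fin N → E) (f : E → ℝ) :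
    Integrable f (empirical x) := by
  have h0 : (N : ENNReal) ≠ 0 := Nat.cast_ne_zero.2 (NeZero.ne N)
  refine Integrable.smul_measure ?_ (ENNReal.inv_ne_top.2 h0)
  rw [integrable_finsetSum_measure]
  exact fun i _ => integrable_dirac (by simp [enorm_eq_nnnorm])

lemma integral_empirical (x : Fin N → E) (f : E → ℝ) :
    ∫ u, f u ∂(empirical x) = avg fun i => f (x i) := by
  rw [empirical, integral_smul_measure, integral_finsetSum_measure]
  · simp [avg]
  · exact fun i _ => integrable_dirac (by simp [enorm_eq_nnnorm])

lemma covariance_empirical [NeZero N] (x : Fin N → E) (f g : E → ℝ) :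
    covariance f g (empirical x) = tupleCov (fun i => f (x i)) (fun i => g (x i)) := by
  rw [covariance]
  simp only [integral_empirical]
  have := tupleCov_sub_eq (fun i => f (x i)) (fun i => g (x i)) (avg fun i => f (x i))
    (avg fun i => g (x i)) 0
  rw [sub_zero, sub_zero, avg_sub, avg_const, sub_self, zero_mul, sub_zero] at this
  exact this.symm

lemma memLp_two_empirical [NeZero N] (x : Fin N → E) {f : E → ℝ} (hf : Measurable f) :
    MemLp f 2 (empirical x) :=
  (memLp_two_iff_integrable_sq hf.aestronglyMeasurable).2 (integrable_empirical x _)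

end Empirical

end EnKF

namespace EnKF

/-! ### Pathwise comparison with the mean-field particles -/

section Pathwise

open scoped Matrix.Norms.L2Operator

variable {du dy N : ℕ}

/-- The quantitative hypotheses on the model: `Ψ₀` is the reference dynamics and `ε` the distance
of `Ψ` from it. -/
structure ModelBounds (κy κΨ κh ℓh ℓΨ : ℝ) (J : ℕ) (y : ℕ → Vec dy) (h : Vec du → Vec dy)
    (Ψ₀ Ψ : Vec du → Vec du) (ε : ℝ) : Prop where
  obs : ∀ j < J, ‖y (j + 1)‖ ≤ κy
  obs_growth : ∀ u, ‖h u‖ ≤ κh * (1 + ‖u‖)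
  obs_lip : ∀ u v, ‖h u - h v‖ ≤ ℓh * ‖u - v‖
  ref_growth : ∀ u, ‖Ψ₀ u‖ ≤ κΨ * (1 + ‖u‖)
  ref_lip : ∀ u v, ‖Ψ₀ u - Ψ₀ v‖ ≤ 3 * κΨ * ‖u - v‖
  dyn_lip : ∀ u v, ‖Ψ u - Ψ v‖ ≤ ℓΨ * ‖u - v‖
  close : ∀ u, ‖Ψ u - Ψ₀ u‖ ≤ ε
  eps_nonneg : 0 ≤ ε
  eps_le_one : ε ≤ 1
  κy_nonneg : 0 ≤ κy
  κΨ_nonneg : 0 ≤ κΨ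
  κh_nonneg : 0 ≤ κh
  ℓh_nonneg : 0 ≤ ℓh
  ℓΨ_nonneg : 0 ≤ ℓΨ

/-- The analysis step of a single particle, with a given gain. -/
def gainStep (h : Vec du → Vec dy) (K : Matrix (Fin du) (Fin dy) ℝ) (y : Vec dy) (u : Vec du)
    (z : Vec dy) : Vec du :=
  u + WithLp.toLp 2 (K.mulVec (y - (h u + z)).ofLp)

/-- A mean-field particle: the dynamics is `Ψ₀` and the gains `K j` are given. -/
def meanField (Ψ₀ : Vec du → Vec du) (h : Vec du → Vec dy) (K : ℕ → Matrix (Fin du) (Fin dy) ℝ)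
    (y : ℕ → Vec dy) (u₀ : Vec du) (ξ : ℕ → Vec du) (η : ℕ → Vec dy) : ℕ → Vec du
  | 0 => u₀
  | j + 1 => gainStep h (K j) (y (j + 1)) (Ψ₀ (meanField Ψ₀ h K y u₀ ξ η j) + ξ j) (η (j + 1))

/-- The size of the inputs of one particle. -/
noncomputable def inputSize (J : ℕ) (u₀ : Vec du) (ξ : ℕ → Vec du) (η : ℕ → Vec dy) : ℝ :=
  1 + ‖u₀‖ + ∑ k ∈ Finset.range J, (‖ξ k‖ + ‖η (k + 1)‖)

lemma inputSize_sum_nonneg (J : ℕ) (ξ : ℕ → Vec du) (η : ℕ → Vec dy) :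
    0 ≤ ∑ k ∈ Finset.range J, (‖ξ k‖ + ‖η (k + 1)‖) :=
  Finset.sum_nonneg fun _ _ => by positivity

lemma one_le_inputSize (J : ℕ) (u₀ : Vec du) (ξ : ℕ → Vec du) (η : ℕ → Vec dy) :
    1 ≤ inputSize J u₀ ξ η := by
  have := inputSize_sum_nonneg J ξ η
  have := norm_nonneg u₀
  unfold inputSize
  linarith

lemma norm_init_le_inputSize (J : ℕ) (u₀ : Vec du) (ξ : ℕ → Vec du) (η : ℕ → Vec dy) :
    ‖u₀‖ ≤ inputSize J u₀ ξ η := by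
  have := inputSize_sum_nonneg J ξ η
  unfold inputSize
  linarith

lemma norm_noises_le_inputSize {J : ℕ} (u₀ : Vec du) (ξ : ℕ → Vec du) (η : ℕ → Vec dy) {j : ℕ}
    (hj : j < J) : ‖ξ j‖ + ‖η (j + 1)‖ ≤ inputSize J u₀ ξ η := by
  have := Finset.single_le_sum (f := fun k => ‖ξ k‖ + ‖η (k + 1)‖) (fun _ _ => by positivity)
    (Finset.mem_range.2 hj)
  have := norm_nonneg u₀
  unfold inputSize
  linarith

lemma norm_state_le_inputSize {J : ℕ} (u₀ : Vec du) (ξ : ℕ → Vec du) (η : ℕ → Vec dy) {j : ℕ}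
    (hj : j < J) : ‖ξ j‖ ≤ inputSize J u₀ ξ η :=
  (le_add_of_nonneg_right (norm_nonneg _)).trans (norm_noises_le_inputSize u₀ ξ η hj)

lemma norm_obs_le_inputSize {J : ℕ} (u₀ : Vec du) (ξ : ℕ → Vec du) (η : ℕ → Vec dy) {j : ℕ}
    (hj : j < J) : ‖η (j + 1)‖ ≤ inputSize J u₀ ξ η :=
  (le_add_of_nonneg_left (norm_nonneg _)).trans (norm_noises_le_inputSize u₀ ξ η hj)

variable {κy κΨ κh ℓh ℓΨ ε : ℝ} {J : ℕ} {y : ℕ → Vec dy} {h : Vec du → Vec dy}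
  {Ψ₀ Ψ : Vec du → Vec du}

/-- The growth of `Ψ` is inherited from `Ψ₀` and `ε ≤ 1`; its Lipschitz constant plays no role. -/
lemma ModelBounds.norm_dyn_le (H : ModelBounds κy κΨ κh ℓh ℓΨ J y h Ψ₀ Ψ ε) (u : Vec du) :
    ‖Ψ u‖ ≤ 1 + κΨ * (1 + ‖u‖) := by
  calc ‖Ψ u‖ = ‖(Ψ u - Ψ₀ u) + Ψ₀ u‖ := by rw [sub_add_cancel]
    _ ≤ ε + κΨ * (1 + ‖u‖) := (norm_add_le _ _).trans (add_le_add (H.close u) (H.ref_growth u))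
    _ ≤ _ := by linarith [H.eps_le_one]

/-- The model obtained by replacing the dynamics with the reference dynamics. -/
lemma ModelBounds.reference (H : ModelBounds κy κΨ κh ℓh ℓΨ J y h Ψ₀ Ψ ε) :
    ModelBounds κy κΨ κh ℓh (3 * κΨ) J y h Ψ₀ Ψ₀ 0 where
  obs := H.obs
  obs_growth := H.obs_growth
  obs_lip := H.obs_lip
  ref_growth := H.ref_growth
  ref_lip := H.ref_lip
  dyn_lip := H.ref_lip
  close u := by simp
  eps_nonneg := le_rfl
  eps_le_one := zero_le_one
  κy_nonneg := H.κy_nonneg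
  κΨ_nonneg := H.κΨ_nonneg
  κh_nonneg := H.κh_nonneg
  ℓh_nonneg := H.ℓh_nonneg
  ℓΨ_nonneg := mul_nonneg (by norm_num) H.κΨ_nonneg

lemma norm_innovation_le {y₁ : Vec dy} (hy : ‖y₁‖ ≤ κy) (hh : ∀ u, ‖h u‖ ≤ κh * (1 + ‖u‖))
    (u : Vec du) (z : Vec dy) :
    ‖y₁ - (h u + z)‖ ≤ κy + κh * (1 + ‖u‖) + ‖z‖ := by
  have h1 := norm_sub_le y₁ (h u + z)
  have h2 := norm_add_le (h u) z
  linarith [hh u]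

lemma norm_gainStep_le {y₁ : Vec dy} (hy : ‖y₁‖ ≤ κy) (hh : ∀ u, ‖h u‖ ≤ κh * (1 + ‖u‖))
    (K : Matrix (Fin du) (Fin dy) ℝ) (u : Vec du) (z : Vec dy) :
    ‖gainStep h K y₁ u z‖ ≤ ‖u‖ + ‖K‖ * (κy + κh * (1 + ‖u‖) + ‖z‖) := by
  refine (norm_add_le _ _).trans (add_le_add le_rfl ((norm_toLp_mulVec_le K _).trans ?_))
  exact mul_le_mul_of_nonneg_left (norm_innovation_le hy hh u z) (norm_nonneg _)

/-- Both steps use the same noise, which cancels. What remains is the known gain `K'` acting on a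
Lipschitz difference and `K - K'` acting on the innovation of the first particle. -/
lemma gainStep_sub_le {y₁ : Vec dy} (hy : ‖y₁‖ ≤ κy) (hh : ∀ u, ‖h u‖ ≤ κh * (1 + ‖u‖))
    (hl : ∀ u v, ‖h u - h v‖ ≤ ℓh * ‖u - v‖)
    (K K' : Matrix (Fin du) (Fin dy) ℝ) (u v : Vec du) (z : Vec dy) :
    ‖gainStep h K y₁ u z - gainStep h K' y₁ v z‖ ≤
      (1 + ‖K'‖ * ℓh) * ‖u - v‖ + ‖K - K'‖ * (κy + κh * (1 + ‖u‖) + ‖z‖) := by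
  have hdec : gainStep h K y₁ u z - gainStep h K' y₁ v z =
      (u - v) + WithLp.toLp 2 ((K - K').mulVec (y₁ - (h u + z)).ofLp)
        - WithLp.toLp 2 (K'.mulVec (h u - h v).ofLp) := by
    ext a
    simp only [gainStep, Matrix.sub_mulVec, Matrix.mulVec_sub, Matrix.mulVec_add, WithLp.ofLp_sub,
      WithLp.ofLp_add, PiLp.add_apply, PiLp.sub_apply, Pi.sub_apply, Pi.add_apply]
    ring
  rw [hdec]
  have h1 := norm_sub_le ((u - v) + WithLp.toLp 2 ((K - K').mulVec (y₁ - (h u + z)).ofLp))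
    (WithLp.toLp 2 (K'.mulVec (h u - h v).ofLp))
  have h2 := norm_add_le (u - v) (WithLp.toLp 2 ((K - K').mulVec (y₁ - (h u + z)).ofLp))
  have h3 := (norm_toLp_mulVec_le (K - K') (y₁ - (h u + z))).trans
    (mul_le_mul_of_nonneg_left (norm_innovation_le hy hh u z) (norm_nonneg _))
  have h4 := (norm_toLp_mulVec_le K' (h u - h v)).trans
    (mul_le_mul_of_nonneg_left (hl u v) (norm_nonneg _))
  linarith

/-- The predicted mean-field particle. -/
def meanFieldPred (Ψ₀ : Vec du → Vec du) (h : Vec du → Vec dy)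
    (K : ℕ → Matrix (Fin du) (Fin dy) ℝ) (y : ℕ → Vec dy) (u₀ : Vec du) (ξ : ℕ → Vec du)
    (η : ℕ → Vec dy) (j : ℕ) : Vec du :=
  Ψ₀ (meanField Ψ₀ h K y u₀ ξ η j) + ξ j

/-- The bound `1 ≤ W` absorbs the additive constants, so that growth estimates stay homogeneous in
the input size and iterate by composing constants. -/
lemma norm_pred_le (H : ModelBounds κy κΨ κh ℓh ℓΨ J y h Ψ₀ Ψ ε) {A W : ℝ} (hW : 1 ≤ W)
    {v ξ₁ : Vec du} (hv : ‖v‖ ≤ A * W) (hξ : ‖ξ₁‖ ≤ W) :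
    ‖Ψ v + ξ₁‖ ≤ (2 + κΨ * (1 + A)) * W := by
  have h1 := norm_add_le (Ψ v) ξ₁
  have h2 := H.norm_dyn_le v
  have h3 : κΨ * (1 + ‖v‖) ≤ κΨ * (W + A * W) :=
    mul_le_mul_of_nonneg_left (by linarith) H.κΨ_nonneg
  nlinarith

lemma norm_gainStep_le_mul (H : ModelBounds κy κΨ κh ℓh ℓΨ J y h Ψ₀ Ψ ε) {j : ℕ} (hj : j < J)
    {B κK W : ℝ} (hW : 1 ≤ W) {K : Matrix (Fin du) (Fin dy) ℝ} (hK : ‖K‖ ≤ κK)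
    {u : Vec du} {z : Vec dy} (hu : ‖u‖ ≤ B * W) (hz : ‖z‖ ≤ W) :
    ‖gainStep h K (y (j + 1)) u z‖ ≤ (B + κK * (κy + κh * (1 + B) + 1)) * W := by
  have h1 := norm_gainStep_le (H.obs j hj) H.obs_growth K u z
  have h2 : κh * (1 + ‖u‖) ≤ κh * (W + B * W) :=
    mul_le_mul_of_nonneg_left (by linarith) H.κh_nonneg
  have h3 : κy ≤ κy * W := le_mul_of_one_le_right H.κy_nonneg hW
  have h4 : ‖K‖ * (κy + κh * (1 + ‖u‖) + ‖z‖) ≤ κK * ((κy + κh * (1 + B) + 1) * W) := by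
    refine mul_le_mul hK (by linarith) ?_ ((norm_nonneg _).trans hK)
    have := mul_nonneg H.κh_nonneg (by positivity : (0 : ℝ) ≤ 1 + ‖u‖)
    linarith [H.κy_nonneg, norm_nonneg z]
  linarith

lemma rms_dyn_le [NeZero N] (H : ModelBounds κy κΨ κh ℓh ℓΨ J y h Ψ₀ Ψ ε) {A Q : ℝ} (hQ : 1 ≤ Q)
    {x ξ₁ : Fin N → Vec du} (hx : rms x ≤ A * Q) (hξ : rms ξ₁ ≤ Q) :
    rms (predicted Ψ x ξ₁) ≤ (2 + κΨ * (1 + A)) * Q := by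
  have h1 : rms (predicted Ψ x ξ₁) ≤ rms (fun i => Ψ (x i)) + rms ξ₁ := rms_add_le _ _
  have h2 : rms (fun i => Ψ (x i)) ≤ (1 + κΨ) + κΨ * rms x :=
    rms_le_const_add_mul (by linarith [H.κΨ_nonneg]) H.κΨ_nonneg
      fun i => (H.norm_dyn_le (x i)).trans (le_of_eq (by ring))
  have h3 : κΨ * rms x ≤ κΨ * (A * Q) := mul_le_mul_of_nonneg_left hx H.κΨ_nonneg
  nlinarith [H.κΨ_nonneg]

lemma rms_obs_le [NeZero N] (H : ModelBounds κy κΨ κh ℓh ℓΨ J y h Ψ₀ Ψ ε) (x : Fin N → Vec du) :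
    rms (fun i => h (x i)) ≤ κh * (1 + rms x) := by
  have := rms_le_const_add_mul H.κh_nonneg H.κh_nonneg (x := fun i => h (x i)) (z := x)
    fun i => (H.obs_growth (x i)).trans (le_of_eq (by ring))
  linarith

lemma rms_coord_le {n : ℕ} (x : Fin N → Vec n) (a : Fin n) : rms (fun i => x i a) ≤ rms x :=
  rms_mono fun i => abs_coord_le_norm (x i) a

lemma covUH_empirical [NeZero N] (x : Fin N → Vec du) (w : Fin N → Vec dy) (a : Fin du)
    (b : Fin dy) :
    covUH h (empirical fun k => (x k, w k)) a b =
      tupleCov (fun i => x i a) (fun i => h (x i) b) :=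
  covariance_empirical (fun k => (x k, w k)) (fun p => p.1 a) (fun p => h p.1 b)

lemma covHH_empirical [NeZero N] (x : Fin N → Vec du) (w : Fin N → Vec dy) (a b : Fin dy) :
    covHH h (empirical fun k => (x k, w k)) a b =
      tupleCov (fun i => h (x i) a) (fun i => h (x i) b) :=
  covariance_empirical (fun k => (x k, w k)) (fun p => h p.1 a) (fun p => h p.1 b)

lemma continuous_of_norm_sub_le {n k : ℕ} {f : Vec n → Vec k} {c : ℝ}
    (hf : ∀ u v, ‖f u - f v‖ ≤ c * ‖u - v‖) : Continuous f := by
  refine (LipschitzWith.of_dist_le_mul (K := c.toNNReal) fun u v => ?_).continuous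
  rw [dist_eq_norm, dist_eq_norm]
  exact (hf u v).trans (mul_le_mul_of_nonneg_right (Real.le_coe_toNNReal c) (norm_nonneg _))

lemma ModelBounds.continuous_obs (H : ModelBounds κy κΨ κh ℓh ℓΨ J y h Ψ₀ Ψ ε) : Continuous h :=
  continuous_of_norm_sub_le H.obs_lip

lemma ModelBounds.continuous_dyn (H : ModelBounds κy κΨ κh ℓh ℓΨ J y h Ψ₀ Ψ ε) : Continuous Ψ :=
  continuous_of_norm_sub_le H.dyn_lip

lemma covHH_empirical_posSemidef [NeZero N] (hh : Continuous h) (x : Fin N → Vec du)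
    (w : Fin N → Vec dy) : (covHH h (empirical fun k => (x k, w k))).PosSemidef :=
  covHH_posSemidef fun b => memLp_two_empirical _ (by fun_prop)

lemma norm_covUH_empirical_le [NeZero N] (H : ModelBounds κy κΨ κh ℓh ℓΨ J y h Ψ₀ Ψ ε)
    (x : Fin N → Vec du) (w : Fin N → Vec dy) :
    ‖covUH h (empirical fun k => (x k, w k))‖ ≤ du * dy * (2 * (rms x * (κh * (1 + rms x)))) := by
  refine opNorm_le_of_forall_abs_le _ fun a b => ?_
  rw [covUH_empirical]
  refine (abs_tupleCov_le _ _).trans (mul_le_mul_of_nonneg_left ?_ (by norm_num))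
  exact mul_le_mul (rms_coord_le x a)
    ((rms_coord_le (fun i => h (x i)) b).trans (rms_obs_le H x)) (rms_nonneg _) (rms_nonneg _)

lemma rms_obs_sub_le (H : ModelBounds κy κΨ κh ℓh ℓΨ J y h Ψ₀ Ψ ε) (x z : Fin N → Vec du)
    (b : Fin dy) :
    rms (fun i => h (x i) b - h (z i) b) ≤ ℓh * rms (fun i => x i - z i) :=
  (rms_coord_le (fun i => h (x i) - h (z i)) b).trans
    (rms_le_mul H.ℓh_nonneg fun _ => H.obs_lip _ _)

/-- Empirical covariances are locally Lipschitz in the ensemble for the root mean square distance.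
The second components `w` and `w'` are arbitrary because the covariance only reads the states. -/
lemma norm_covUH_empirical_sub_le [NeZero N] (H : ModelBounds κy κΨ κh ℓh ℓΨ J y h Ψ₀ Ψ ε)
    (x z : Fin N → Vec du) (w w' : Fin N → Vec dy) :
    ‖covUH h (empirical fun k => (x k, w k)) - covUH h (empirical fun k => (z k, w' k))‖ ≤
      du * dy * ((2 * κh * (1 + rms x) + 2 * ℓh * rms z) * rms fun i => x i - z i) := by
  refine opNorm_le_of_forall_abs_le _ fun a b => ?_
  rw [Matrix.sub_apply, covUH_empirical, covUH_empirical]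
  refine (abs_tupleCov_sub_le _ _ _ _).trans ?_
  have h1 : rms (fun i => x i a - z i a) * rms (fun i => h (x i) b) ≤
      rms (fun i => x i - z i) * (κh * (1 + rms x)) :=
    mul_le_mul (rms_coord_le (fun i => x i - z i) a)
      ((rms_coord_le (fun i => h (x i)) b).trans (rms_obs_le H x)) (rms_nonneg _) (rms_nonneg _)
  have h2 : rms (fun i => z i a) * rms (fun i => h (x i) b - h (z i) b) ≤
      rms z * (ℓh * rms fun i => x i - z i) :=
    mul_le_mul (rms_coord_le z a) (rms_obs_sub_le H x z b) (rms_nonneg _) (rms_nonneg _)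
  linarith

lemma norm_covHH_empirical_sub_le [NeZero N] (H : ModelBounds κy κΨ κh ℓh ℓΨ J y h Ψ₀ Ψ ε)
    (x z : Fin N → Vec du) (w w' : Fin N → Vec dy) :
    ‖covHH h (empirical fun k => (x k, w k)) - covHH h (empirical fun k => (z k, w' k))‖ ≤
      dy * dy * ((2 * ℓh * (κh * (1 + rms x)) + 2 * ℓh * (κh * (1 + rms z))) *
        rms fun i => x i - z i) := by
  refine opNorm_le_of_forall_abs_le _ fun a b => ?_
  rw [Matrix.sub_apply, covHH_empirical, covHH_empirical]
  refine (abs_tupleCov_sub_le _ _ _ _).trans ?_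
  have h1 : rms (fun i => h (x i) a - h (z i) a) * rms (fun i => h (x i) b) ≤
      (ℓh * rms fun i => x i - z i) * (κh * (1 + rms x)) :=
    mul_le_mul (rms_obs_sub_le H x z a)
      ((rms_coord_le (fun i => h (x i)) b).trans (rms_obs_le H x)) (rms_nonneg _)
      (mul_nonneg H.ℓh_nonneg (rms_nonneg _))
  have h2 : rms (fun i => h (z i) a) * rms (fun i => h (x i) b - h (z i) b) ≤
      (κh * (1 + rms z)) * (ℓh * rms fun i => x i - z i) :=
    mul_le_mul ((rms_coord_le (fun i => h (z i)) a).trans (rms_obs_le H z))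
      (rms_obs_sub_le H x z b) (rms_nonneg _)
      (mul_nonneg H.κh_nonneg (by linarith [rms_nonneg z]))
  linarith

/-- Growth of the root mean square of the ensemble in one analysis step. -/
lemma rms_analysis_le [NeZero N] (H : ModelBounds κy κΨ κh ℓh ℓΨ J y h Ψ₀ Ψ ε) {j : ℕ}
    (hj : j < J) {Γ : Matrix (Fin dy) (Fin dy) ℝ} (hΓ : Γ.PosDef) {c : ℝ} (hc : 0 < c)
    (hcΓ : ∀ x : Vec dy, c * ‖x‖ ^ 2 ≤ dotProduct x.ofLp (Γ.mulVec x.ofLp))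
    {B Q : ℝ} (hB : 0 ≤ B) (hQ : 1 ≤ Q) {x : Fin N → Vec du} {η₁ : Fin N → Vec dy}
    (hx : rms x ≤ B * Q) (hη : rms η₁ ≤ Q) :
    rms (analysis h Γ (y (j + 1)) x (simulated h x η₁)) ≤
      (B + du * dy * (2 * (B * (κh * (1 + B)))) * c⁻¹ * (κy + κh * (1 + B) + 1)) * Q ^ 3 := by
  set K := gain h Γ (empirical fun k => (x k, simulated h x η₁ k)) with hKdef
  have hr := rms_nonneg x
  have hκh := H.κh_nonneg
  have hκy := H.κy_nonneg
  -- The covariance is quadratic in `Q` and the inverse factor is at most `c⁻¹` for every ensemble.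
  -- Multiplied by an innovation of order `Q`, this produces the cube.
  have hK : ‖K‖ ≤ du * dy * (2 * (B * (κh * (1 + B)))) * c⁻¹ * Q ^ 2 := by
    have h1 : ‖K‖ ≤ ‖covUH h (empirical fun k => (x k, simulated h x η₁ k))‖ *
        ‖(covHH h (empirical fun k => (x k, simulated h x η₁ k)) + Γ)⁻¹‖ := Matrix.l2_opNorm_mul _ _
    have h2 := norm_covUH_empirical_le H x (simulated h x η₁)
    have h3 := opNorm_inv_posSemidef_add_le
      (covHH_empirical_posSemidef H.continuous_obs x (simulated h x η₁)) hΓ hc hcΓ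
    have h4 : rms x * (κh * (1 + rms x)) ≤ (B * Q) * (κh * ((1 + B) * Q)) := by
      refine mul_le_mul hx (mul_le_mul_of_nonneg_left (by linarith) hκh) (by positivity)
        (by positivity)
    calc ‖K‖ ≤ (du * dy * (2 * ((B * Q) * (κh * ((1 + B) * Q))))) * c⁻¹ := by
          refine h1.trans (mul_le_mul (h2.trans ?_) h3 (norm_nonneg _) (by positivity))
          gcongr
      _ = _ := by ring
  have h1 : ∀ i, ‖analysis h Γ (y (j + 1)) x (simulated h x η₁) i‖ ≤
      ‖(‖x i‖ * (1 + ‖K‖ * κh) + ‖K‖ * (κy + κh))‖ + ‖(‖K‖ * ‖η₁ i‖)‖ := by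
    intro i
    refine (norm_gainStep_le (H.obs j hj) H.obs_growth K (x i) (η₁ i)).trans ?_
    rw [Real.norm_of_nonneg (by positivity), Real.norm_of_nonneg (by positivity)]
    exact le_of_eq (by ring)
  have h2 : rms (fun i => ‖x i‖ * (1 + ‖K‖ * κh) + ‖K‖ * (κy + κh)) ≤
      ‖K‖ * (κy + κh) + (1 + ‖K‖ * κh) * rms x := by
    refine rms_le_const_add_mul (by positivity) (by positivity) fun i => ?_
    rw [Real.norm_of_nonneg (by positivity)]
    exact le_of_eq (by ring)
  have h3 : rms (fun i => ‖K‖ * ‖η₁ i‖) ≤ ‖K‖ * rms η₁ :=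
    rms_le_mul (norm_nonneg _) fun i => by rw [norm_mul, norm_norm, norm_norm]
  have h4 := (rms_le_add h1).trans (add_le_add h2 h3)
  have h5 : κy + κh * (1 + rms x) + rms η₁ ≤ (κy + κh * (1 + B) + 1) * Q := by
    have : κh * (1 + rms x) ≤ κh * ((1 + B) * Q) := mul_le_mul_of_nonneg_left (by linarith) hκh
    have : κy ≤ κy * Q := le_mul_of_one_le_right hκy hQ
    linarith
  have h6 : ‖K‖ * (κy + κh * (1 + rms x) + rms η₁) ≤
      (du * dy * (2 * (B * (κh * (1 + B)))) * c⁻¹ * Q ^ 2) * ((κy + κh * (1 + B) + 1) * Q) := by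
    refine mul_le_mul hK h5 ?_ (by positivity)
    have := rms_nonneg η₁
    positivity
  have h7 : B * Q ≤ B * Q ^ 3 := mul_le_mul_of_nonneg_left (le_self_pow₀ hQ (by norm_num)) hB
  calc _ ≤ rms x + ‖K‖ * (κy + κh * (1 + rms x) + rms η₁) := h4.trans (le_of_eq (by ring))
    _ ≤ B * Q ^ 3 + _ := add_le_add (hx.trans h7) h6
    _ = _ := by ring

/-- A polynomial bound for the ensemble in terms of the size of its inputs. -/
lemma exists_rms_particles_le (κy κΨ κh ℓh ℓΨ : ℝ) (J : ℕ) {Γ : Matrix (Fin dy) (Fin dy) ℝ}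
    (hΓ : Γ.PosDef) (hκy : 0 ≤ κy) (hκΨ : 0 ≤ κΨ) (hκh : 0 ≤ κh) (j : ℕ) :
    ∃ A : ℝ, 0 ≤ A ∧ ∃ p : ℕ, j ≤ J → ∀ (N : ℕ) [NeZero N] (y : ℕ → Vec dy) (h : Vec du → Vec dy)
      (Ψ₀ Ψ : Vec du → Vec du) (ε : ℝ), ModelBounds κy κΨ κh ℓh ℓΨ J y h Ψ₀ Ψ ε →
      ∀ (u₀ : Fin N → Vec du) (ξ : ℕ → Fin N → Vec du) (η : ℕ → Fin N → Vec dy) (M : ℝ), 1 ≤ M →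
      rms u₀ ≤ M → (∀ k < J, rms (ξ k) ≤ M) → (∀ k < J, rms (η (k + 1)) ≤ M) →
      rms (particles Ψ h Γ y u₀ ξ η j) ≤ A * M ^ p := by
  obtain ⟨c, hc, hcΓ⟩ := exists_pos_mul_sq_le hΓ
  induction j with
  | zero =>
    refine ⟨1, zero_le_one, 1, fun _ N _ y h Ψ₀ Ψ ε H u₀ ξ η M hM hu _ _ => ?_⟩
    simpa [particles] using hu
  | succ j ih =>
    obtain ⟨A, hA, p, ih⟩ := ih
    -- The one-step bound is applied with `Q = M ^ (p + 1)`. The extra power ensures `M ≤ Q` even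
    -- for `p = 0`, as the noises require, and the cube of `Q` gives the new exponent.
    refine ⟨((2 + κΨ * (1 + A)) + du * dy * (2 * ((2 + κΨ * (1 + A)) *
      (κh * (1 + (2 + κΨ * (1 + A)))))) * c⁻¹ * (κy + κh * (1 + (2 + κΨ * (1 + A))) + 1)),
      by positivity, (p + 1) * 3, fun hj N _ y h Ψ₀ Ψ ε H u₀ ξ η M hM hu hξ hη => ?_⟩
    have hjJ : j < J := hj
    have hMQ : M ≤ M ^ (p + 1) := le_self_pow₀ hM (by omega)
    have h1 : rms (particles Ψ h Γ y u₀ ξ η j) ≤ A * M ^ (p + 1) :=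
      (ih hjJ.le N y h Ψ₀ Ψ ε H u₀ ξ η M hM hu hξ hη).trans
        (mul_le_mul_of_nonneg_left (pow_le_pow_right₀ hM (by omega)) hA)
    have h2 := rms_dyn_le H (hM.trans hMQ) h1 ((hξ j hjJ).trans hMQ)
    have h3 := rms_analysis_le H hjJ hΓ hc hcΓ (by positivity) (hM.trans hMQ) h2
      ((hη j hjJ).trans hMQ)
    rwa [← pow_mul] at h3

end Pathwise

end EnKF

namespace EnKF

/-! ### Distance between the ensemble and the mean-field particles -/

section Pathwise

open scoped Matrix.Norms.L2Operator

variable {du dy N : ℕ} {κy κΨ κh ℓh ℓΨ ε : ℝ} {J : ℕ} {y : ℕ → Vec dy} {h : Vec du → Vec dy}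
  {Ψ₀ Ψ : Vec du → Vec du}

/-- A mean-field particle with bounded gains is controlled by the size of its inputs. -/
lemma exists_meanField_le (κy κΨ κh ℓh ℓΨ κK : ℝ) (J : ℕ) (hκy : 0 ≤ κy)
    (hκΨ : 0 ≤ κΨ) (hκh : 0 ≤ κh) (hκK : 0 ≤ κK) (j : ℕ) :
    ∃ A : ℝ, 0 ≤ A ∧ (j ≤ J → ∀ (y : ℕ → Vec dy) (h : Vec du → Vec dy)
      (Ψ₀ Ψ : Vec du → Vec du) (ε : ℝ), ModelBounds κy κΨ κh ℓh ℓΨ J y h Ψ₀ Ψ ε →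
      ∀ K : ℕ → Matrix (Fin du) (Fin dy) ℝ, (∀ k < j, ‖K k‖ ≤ κK) →
      ∀ (u₀ : Vec du) (ξ : ℕ → Vec du) (η : ℕ → Vec dy),
        ‖meanField Ψ₀ h K y u₀ ξ η j‖ ≤ A * inputSize J u₀ ξ η) := by
  induction j with
  | zero =>
    refine ⟨1, zero_le_one, fun _ y h Ψ₀ Ψ ε _ K _ u₀ ξ η => ?_⟩
    simpa [meanField] using norm_init_le_inputSize J u₀ ξ η
  | succ j ih =>
    obtain ⟨A, hA, ih⟩ := ih
    -- With gains bounded in advance the step is linear in the input size, so no powers accumulate.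
    refine ⟨(2 + κΨ * (1 + A)) + κK * (κy + κh * (1 + (2 + κΨ * (1 + A))) + 1), by positivity,
      fun hj y h Ψ₀ Ψ ε H K hK u₀ ξ η => ?_⟩
    have hjJ : j < J := hj
    have h1 := ih hjJ.le y h Ψ₀ Ψ ε H K (fun k hk => hK k (by omega)) u₀ ξ η
    have h2 := norm_pred_le H.reference (one_le_inputSize J u₀ ξ η) h1
      (norm_state_le_inputSize u₀ ξ η hjJ)
    exact norm_gainStep_le_mul H hjJ (one_le_inputSize J u₀ ξ η) (hK j (by omega)) h2
      (norm_obs_le_inputSize u₀ ξ η hjJ)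

/-- Propagation of the distance to the mean-field particles in one analysis step. -/
lemma rms_analysis_sub_le [NeZero N] (H : ModelBounds κy κΨ κh ℓh ℓΨ J y h Ψ₀ Ψ ε) {j : ℕ}
    (hj : j < J) {Γ : Matrix (Fin dy) (Fin dy) ℝ} (hΓ : Γ.PosDef) {c : ℝ} (hc : 0 < c)
    (hcΓ : ∀ x : Vec dy, c * ‖x‖ ^ 2 ≤ dotProduct x.ofLp (Γ.mulVec x.ofLp))
    {B Q R κK : ℝ} (hB : 0 ≤ B) (hQ : 1 ≤ Q) (hR : 0 ≤ R) {x z : Fin N → Vec du}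
    {η₁ w : Fin N → Vec dy}
    (hx : rms x ≤ B * Q) (hz : rms z ≤ B * Q) (hη : rms η₁ ≤ Q)
    {Cuh : Matrix (Fin du) (Fin dy) ℝ} {Chh : Matrix (Fin dy) (Fin dy) ℝ} (hChh : Chh.PosSemidef)
    (hK : ‖Cuh * (Chh + Γ)⁻¹‖ ≤ κK)
    (hUH : ‖covUH h (empirical fun k => (z k, w k)) - Cuh‖ ≤ R * Q)
    (hHH : ‖covHH h (empirical fun k => (z k, w k)) - Chh‖ ≤ R * Q) :
    rms (fun i => analysis h Γ (y (j + 1)) x (simulated h x η₁) i -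
        gainStep h (Cuh * (Chh + Γ)⁻¹) (y (j + 1)) (z i) (η₁ i)) ≤
      ((1 + κK * ℓh) + c⁻¹ * ((du * dy * (2 * κh * (1 + B) + 2 * ℓh * B) + 1) +
        κK * (dy * dy * (4 * ℓh * (κh * (1 + B))) + 1)) * (κy + κh * (1 + B) + 1)) *
      (rms (fun i => x i - z i) + R) * Q ^ 2 := by
  set K := gain h Γ (empirical fun k => (x k, simulated h x η₁ k)) with hKdef
  set K' := Cuh * (Chh + Γ)⁻¹ with hK'def
  set D := rms fun i => x i - z i with hD
  have hD0 : 0 ≤ D := rms_nonneg _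
  have hκh := H.κh_nonneg
  have hκy := H.κy_nonneg
  have hℓh := H.ℓh_nonneg
  have hκK : 0 ≤ κK := (norm_nonneg _).trans hK
  have hQ0 : 0 ≤ Q := by linarith
  have hpsd := covHH_empirical_posSemidef H.continuous_obs x (simulated h x η₁)
  -- The empirical covariance of the ensemble is compared with that of the mean-field cloud `z`, at
  -- a cost proportional to `D * Q`, and the latter with its limit, at the cost `R * Q`.
  have hUH' : ‖covUH h (empirical fun k => (x k, simulated h x η₁ k)) - Cuh‖ ≤
      (du * dy * (2 * κh * (1 + B) + 2 * ℓh * B) + 1) * ((D + R) * Q) := by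
    have h1 := norm_covUH_empirical_sub_le H x z (simulated h x η₁) w
    have h2 : (du * dy * ((2 * κh * (1 + rms x) + 2 * ℓh * rms z) * D) : ℝ) ≤
        du * dy * ((2 * κh * ((1 + B) * Q) + 2 * ℓh * (B * Q)) * D) := by
      gcongr
      linarith
    have h3 := norm_sub_le_norm_sub_add_norm_sub
      (covUH h (empirical fun k => (x k, simulated h x η₁ k)))
      (covUH h (empirical fun k => (z k, w k))) Cuh
    have h4 : (0 : ℝ) ≤ du * dy * (2 * κh * (1 + B) + 2 * ℓh * B) * (R * Q) := by positivity
    have h5 : 0 ≤ D * Q := by positivity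
    linarith
  have hHH' : ‖covHH h (empirical fun k => (x k, simulated h x η₁ k)) - Chh‖ ≤
      (dy * dy * (4 * ℓh * (κh * (1 + B))) + 1) * ((D + R) * Q) := by
    have h1 := norm_covHH_empirical_sub_le H x z (simulated h x η₁) w
    have h2 : (dy * dy * ((2 * ℓh * (κh * (1 + rms x)) + 2 * ℓh * (κh * (1 + rms z))) * D) : ℝ) ≤
        dy * dy * ((2 * ℓh * (κh * ((1 + B) * Q)) + 2 * ℓh * (κh * ((1 + B) * Q))) * D) := by
      gcongr <;> linarith
    have h3 := norm_sub_le_norm_sub_add_norm_sub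
      (covHH h (empirical fun k => (x k, simulated h x η₁ k)))
      (covHH h (empirical fun k => (z k, w k))) Chh
    have h4 : (0 : ℝ) ≤ dy * dy * (4 * ℓh * (κh * (1 + B))) * (R * Q) := by positivity
    have h5 : 0 ≤ D * Q := by positivity
    linarith
  have hKK' : ‖K - K'‖ ≤ c⁻¹ * ((du * dy * (2 * κh * (1 + B) + 2 * ℓh * B) + 1) +
      κK * (dy * dy * (4 * ℓh * (κh * (1 + B))) + 1)) * ((D + R) * Q) := by
    have h1 := opNorm_mul_inv_sub_le
      (C := covUH h (empirical fun k => (x k, simulated h x η₁ k))) (C' := Cuh)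
      (isUnit_det_posSemidef_add hpsd hΓ) (isUnit_det_posSemidef_add hChh hΓ)
    rw [add_sub_add_right_eq_sub] at h1
    have h2 := opNorm_inv_posSemidef_add_le hpsd hΓ hc hcΓ
    calc ‖K - K'‖ ≤ _ := h1
      _ ≤ ((du * dy * (2 * κh * (1 + B) + 2 * ℓh * B) + 1) * ((D + R) * Q) +
        κK * ((dy * dy * (4 * ℓh * (κh * (1 + B))) + 1) * ((D + R) * Q))) * c⁻¹ := by
          refine mul_le_mul (add_le_add hUH' ?_) h2 (norm_nonneg _) (by positivity)
          exact mul_le_mul hK hHH' (norm_nonneg _) hκK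
      _ = _ := by ring
  have hpt : ∀ i, ‖analysis h Γ (y (j + 1)) x (simulated h x η₁) i -
      gainStep h K' (y (j + 1)) (z i) (η₁ i)‖ ≤
      ‖(‖x i - z i‖ * (1 + κK * ℓh))‖ +
        ‖(‖K - K'‖ * (κy + κh * (1 + ‖x i‖) + ‖η₁ i‖))‖ := by
    intro i
    refine (gainStep_sub_le (H.obs j hj) H.obs_growth H.obs_lip K K' (x i) (z i) (η₁ i)).trans ?_
    rw [Real.norm_of_nonneg (by positivity), Real.norm_of_nonneg (by positivity)]
    have : ‖K'‖ * ℓh * ‖x i - z i‖ ≤ κK * ℓh * ‖x i - z i‖ := by gcongr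
    linarith
  have h1 : rms (fun i => ‖x i - z i‖ * (1 + κK * ℓh)) ≤ (1 + κK * ℓh) * D :=
    rms_le_mul (by positivity) fun i => by
      rw [Real.norm_of_nonneg (by positivity), mul_comm]
  have h2 : rms (fun i => κy + κh * (1 + ‖x i‖) + ‖η₁ i‖) ≤ (κy + κh) + κh * rms x + rms η₁ := by
    have h21 : rms (fun i => κy + κh * (1 + ‖x i‖)) ≤ (κy + κh) + κh * rms x :=
      rms_le_const_add_mul (by positivity) (by positivity) fun i => by
        rw [Real.norm_of_nonneg (by positivity)]
        exact le_of_eq (by ring)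
    refine (rms_le_add fun i => ?_).trans (add_le_add h21 (le_refl (rms η₁)))
    rw [Real.norm_of_nonneg (by positivity), Real.norm_of_nonneg (by positivity)]
  have h3 : rms (fun i => ‖K - K'‖ * (κy + κh * (1 + ‖x i‖) + ‖η₁ i‖)) ≤
      ‖K - K'‖ * rms fun i => κy + κh * (1 + ‖x i‖) + ‖η₁ i‖ :=
    rms_le_mul (norm_nonneg _) fun i => by rw [norm_mul, norm_norm]
  have h4 : (κy + κh) + κh * rms x + rms η₁ ≤ (κy + κh * (1 + B) + 1) * Q := by
    have : κh * rms x ≤ κh * (B * Q) := mul_le_mul_of_nonneg_left hx hκh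
    have : κy ≤ κy * Q := le_mul_of_one_le_right hκy hQ
    have : κh ≤ κh * Q := le_mul_of_one_le_right hκh hQ
    linarith
  have h5 := mul_le_mul hKK' (h2.trans h4) (rms_nonneg _) (by positivity)
  have h6 : (1 + κK * ℓh) * D ≤ (1 + κK * ℓh) * ((D + R) * Q ^ 2) := by
    refine mul_le_mul_of_nonneg_left ?_ (by positivity)
    calc D ≤ D + R := by linarith
      _ ≤ (D + R) * Q ^ 2 := le_mul_of_one_le_right (by linarith) (one_le_pow₀ hQ)
  calc _ ≤ _ := (rms_le_add hpt).trans (add_le_add (h1.trans h6) (h3.trans h5))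
    _ = _ := by ring

/-- Polynomial bounds, in terms of the root mean square of the sizes of the inputs, for the
ensemble, for the mean-field particles and for the distance between the two. -/
lemma exists_rms_particles_sub_meanField_le (κy κΨ κh ℓh ℓΨ κK : ℝ) (J : ℕ)
    {Γ : Matrix (Fin dy) (Fin dy) ℝ} (hΓ : Γ.PosDef) (hκy : 0 ≤ κy) (hκΨ : 0 ≤ κΨ) (hκh : 0 ≤ κh)
    (hℓh : 0 ≤ ℓh) (hκK : 0 ≤ κK) (j : ℕ) :
    ∃ A : ℝ, 0 ≤ A ∧ ∃ p : ℕ, j ≤ J → ∀ (N : ℕ) [NeZero N] (y : ℕ → Vec dy) (h : Vec du → Vec dy)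
      (Ψ₀ Ψ : Vec du → Vec du) (ε : ℝ), ModelBounds κy κΨ κh ℓh ℓΨ J y h Ψ₀ Ψ ε →
      ∀ (Cuh : ℕ → Matrix (Fin du) (Fin dy) ℝ) (Chh : ℕ → Matrix (Fin dy) (Fin dy) ℝ),
      (∀ k < j, (Chh k).PosSemidef) → (∀ k < j, ‖Cuh k * (Chh k + Γ)⁻¹‖ ≤ κK) →
      ∀ (u₀ : Fin N → Vec du) (ξ : ℕ → Fin N → Vec du) (η : ℕ → Fin N → Vec dy) (M R : ℝ),
      0 ≤ R → (rms fun i => inputSize J (u₀ i) (fun k => ξ k i) (fun k => η k i)) ≤ M → 1 ≤ M →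
      (∀ k < j, ‖covUH h (empirical fun i => (meanFieldPred Ψ₀ h
        (fun k => Cuh k * (Chh k + Γ)⁻¹) y (u₀ i) (fun k => ξ k i) (fun k => η k i) k,
        (0 : Vec dy))) - Cuh k‖ ≤ R * M) →
      (∀ k < j, ‖covHH h (empirical fun i => (meanFieldPred Ψ₀ h
        (fun k => Cuh k * (Chh k + Γ)⁻¹) y (u₀ i) (fun k => ξ k i) (fun k => η k i) k,
        (0 : Vec dy))) - Chh k‖ ≤ R * M) →
      rms (fun i => particles Ψ h Γ y u₀ ξ η j i - meanField Ψ₀ h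
        (fun k => Cuh k * (Chh k + Γ)⁻¹) y (u₀ i) (fun k => ξ k i) (fun k => η k i) j) ≤
        A * (ε + R) * M ^ p := by
  obtain ⟨c, hc, hcΓ⟩ := exists_pos_mul_sq_le hΓ
  induction j with
  | zero =>
    -- The two systems share their initial particles.
    refine ⟨0, le_rfl, 0, fun _ N _ y h Ψ₀ Ψ ε H Cuh Chh _ _ u₀ ξ η M R _ _ _ _ _ => ?_⟩
    simp [particles, meanField, rms_const]
  | succ j ih =>
    obtain ⟨A, hA, p, ih⟩ := ih
    obtain ⟨A₁, hA₁, p₁, h₁⟩ := exists_rms_particles_le (du := du) κy κΨ κh ℓh ℓΨ J hΓ hκy hκΨ hκh j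
    obtain ⟨A₂, hA₂, h₂⟩ := exists_meanField_le (du := du) (dy := dy) κy κΨ κh ℓh ℓΨ κK J hκy hκΨ
      hκh hκK j
    -- `A₁` belongs to the ensemble and `A₂` to the mean-field particles; their sum gives one
    -- constant for both predicted clouds.
    set B : ℝ := 2 + κΨ * (1 + (A₁ + A₂)) with hB
    have hB0 : 0 ≤ B := by positivity
    set E : ℝ := (1 + κK * ℓh) + c⁻¹ * ((du * dy * (2 * κh * (1 + B) + 2 * ℓh * B) + 1) +
        κK * (dy * dy * (4 * ℓh * (κh * (1 + B))) + 1)) * (κy + κh * (1 + B) + 1) with hE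
    have hE0 : 0 ≤ E := by positivity
    -- Prediction turns the distance `A * (ε + R) * M ^ p` into `ε` plus `3 * κΨ` times it; the
    -- analysis adds `R` and multiplies by `E * Q ^ 2` with `Q = M ^ (p₁ + 1)`. The dependence on `ε
    -- + R` stays linear.
    refine ⟨E * (2 + 3 * κΨ * A), by positivity, p + (p₁ + 1) * 2,
      fun hj N _ y h Ψ₀ Ψ ε H Cuh Chh hpsd hK u₀ ξ η M R hR hWM hM hUH hHH => ?_⟩
    have hjJ : j < J := hj
    set V : ℕ → Fin N → Vec du := fun k i => meanField Ψ₀ h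
        (fun k => Cuh k * (Chh k + Γ)⁻¹) y (u₀ i) (fun k => ξ k i) (fun k => η k i) k with hV
    have hM0 : 0 ≤ M := by linarith
    have hW : ∀ i, ‖inputSize J (u₀ i) (fun k => ξ k i) (fun k => η k i)‖ =
        inputSize J (u₀ i) (fun k => ξ k i) (fun k => η k i) := fun i =>
      Real.norm_of_nonneg (zero_le_one.trans (one_le_inputSize _ _ _ _))
    have hu₀ : rms u₀ ≤ M := (rms_mono fun i => by
      rw [hW]; exact norm_init_le_inputSize J (u₀ i) _ _).trans hWM
    have hξ : ∀ k < J, rms (ξ k) ≤ M := fun k hk => (rms_mono fun i => by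
      rw [hW]; exact norm_state_le_inputSize (u₀ i) (fun k => ξ k i) _ hk).trans hWM
    have hη : ∀ k < J, rms (η (k + 1)) ≤ M := fun k hk => (rms_mono fun i => by
      rw [hW]; exact norm_obs_le_inputSize (u₀ i) _ (fun k => η k i) hk).trans hWM
    set Q : ℝ := M ^ (p₁ + 1) with hQ
    have hMQ : M ≤ Q := le_self_pow₀ hM (by omega)
    have hQ1 : 1 ≤ Q := hM.trans hMQ
    have hu : rms (particles Ψ h Γ y u₀ ξ η j) ≤ (A₁ + A₂) * Q := by
      refine (h₁ hjJ.le N y h Ψ₀ Ψ ε H u₀ ξ η M hM hu₀ hξ hη).trans ?_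
      exact mul_le_mul (by linarith) (pow_le_pow_right₀ hM (by omega)) (by positivity)
        (by positivity)
    have hv : rms (V j) ≤ (A₁ + A₂) * Q := by
      have h3 : rms (V j) ≤ A₂ * rms fun i =>
          inputSize J (u₀ i) (fun k => ξ k i) (fun k => η k i) :=
        rms_le_mul hA₂ fun i => by
          rw [hW]
          exact h₂ hjJ.le y h Ψ₀ Ψ ε H _ (fun k hk => hK k (by omega)) _ _ _
      refine h3.trans ?_
      exact mul_le_mul (by linarith) (hWM.trans hMQ) (rms_nonneg _) (by positivity)
    have hx := rms_dyn_le H hQ1 hu ((hξ j hjJ).trans hMQ)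
    have hz := rms_dyn_le H.reference hQ1 hv ((hξ j hjJ).trans hMQ)
    have hRM : R * M ≤ R * Q := mul_le_mul_of_nonneg_left hMQ hR
    have hD : rms (fun i => predicted Ψ (particles Ψ h Γ y u₀ ξ η j) (ξ j) i -
        predicted Ψ₀ (V j) (ξ j) i) ≤ ε + 3 * κΨ * (A * (ε + R) * M ^ p) := by
      have h4 : rms (fun i => predicted Ψ (particles Ψ h Γ y u₀ ξ η j) (ξ j) i -
          predicted Ψ₀ (V j) (ξ j) i) ≤
          ε + 3 * κΨ * rms fun i => particles Ψ h Γ y u₀ ξ η j i - V j i := by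
        refine rms_le_const_add_mul H.eps_nonneg (by positivity) fun i => ?_
        -- The defect `Ψ - Ψ₀` is evaluated at the ensemble particle, so the distance is propagated
        -- by the Lipschitz constant of `Ψ₀` alone.
        have : predicted Ψ (particles Ψ h Γ y u₀ ξ η j) (ξ j) i - predicted Ψ₀ (V j) (ξ j) i =
            (Ψ (particles Ψ h Γ y u₀ ξ η j i) - Ψ₀ (particles Ψ h Γ y u₀ ξ η j i)) +
            (Ψ₀ (particles Ψ h Γ y u₀ ξ η j i) - Ψ₀ (V j i)) := by
          simp only [predicted]; abel
        rw [this]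
        exact (norm_add_le _ _).trans (add_le_add (H.close _) (H.ref_lip _ _))
      refine h4.trans (add_le_add le_rfl (mul_le_mul_of_nonneg_left ?_ (by positivity)))
      exact ih hjJ.le N y h Ψ₀ Ψ ε H Cuh Chh (fun k hk => hpsd k (by omega))
        (fun k hk => hK k (by omega)) u₀ ξ η M R hR hWM hM (fun k hk => hUH k (by omega))
        (fun k hk => hHH k (by omega))
    have key := rms_analysis_sub_le H hjJ hΓ hc hcΓ hB0 hQ1 hR hx hz ((hη j hjJ).trans hMQ)
      (hpsd j (by omega)) (hK j (by omega)) ((hUH j (by omega)).trans hRM)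
      ((hHH j (by omega)).trans hRM)
    have hε := H.eps_nonneg
    have hMp : 1 ≤ M ^ p := one_le_pow₀ hM
    calc _ ≤ _ := key
      _ ≤ E * ((2 + 3 * κΨ * A) * (ε + R) * M ^ p) * Q ^ 2 := by
        refine mul_le_mul_of_nonneg_right (mul_le_mul_of_nonneg_left ?_ hE0) (by positivity)
        have : ε + R ≤ (ε + R) * M ^ p := le_mul_of_one_le_right (by positivity) hMp
        have : 0 ≤ (ε + R) * M ^ p := by positivity
        linarith
      _ = _ := by rw [hQ, ← pow_mul]; ring

end Pathwise

end EnKF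

namespace EnKF

/-! ### Moments of Gaussian measures -/

section Moments

lemma IsGaussian.integrable_norm_pow {E : Type*} [NormedAddCommGroup E] [NormedSpace ℝ E]
    [MeasurableSpace E] [BorelSpace E] [SecondCountableTopology E] [CompleteSpace E]
    (μ : Measure E) [IsGaussian μ] (p : ℕ) : Integrable (fun x => ‖x‖ ^ p) μ := by
  rcases eq_or_ne p 0 with rfl | hp
  · simp
  · have := (IsGaussian.memLp_id μ (p : ENNReal) (ENNReal.natCast_ne_top p)).integrable_norm_pow hp
    simpa using this

/-- Write the variable as `√v * z + a` with `z` standard. The quantity `1 + a ^ 2 + v` dominates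
both `√v` and `|a|`, so it factors out and leaves an absolute moment of `z`. -/
lemma exists_integral_abs_pow_gaussianReal_le (p : ℕ) :
    ∃ C : ℝ, 0 ≤ C ∧ ∀ (a : ℝ) (v : NNReal),
      ∫ x, |x| ^ (p + 1) ∂(gaussianReal a v) ≤ C * (1 + a ^ 2 + v) ^ (p + 1) := by
  set B : ℝ := ∫ z, |z| ^ (p + 1) ∂(gaussianReal 0 1) with hB
  have hB0 : 0 ≤ B := integral_nonneg fun z => by positivity
  have hint : Integrable (fun z : ℝ => |z| ^ (p + 1)) (gaussianReal 0 1) :=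
    IsGaussian.integrable_norm_pow (gaussianReal 0 1) (p + 1)
  refine ⟨2 ^ p * (1 + B), by positivity, fun a v => ?_⟩
  have hlaw : gaussianReal a v = (gaussianReal 0 1).map fun z => √v * z + a := by
    have h1 : (gaussianReal 0 1).map (fun z : ℝ => √v * z) = gaussianReal 0 v := by
      rw [gaussianReal_map_const_mul]
      simp only [mul_zero, mul_one]
      congr 1
      ext
      simp
    have h2 := gaussianReal_map_add_const (μ := 0) (v := v) a
    rw [← h1, Measure.map_map (by fun_prop) (by fun_prop), zero_add] at h2
    exact h2.symm
  have hs : √(v : ℝ) ≤ 1 + a ^ 2 + v := by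
    have h1 := Real.sq_sqrt v.2
    have h2 := Real.sqrt_nonneg (v : ℝ)
    change √(v : ℝ) ^ 2 = (v : ℝ) at h1
    nlinarith [sq_nonneg (√(v : ℝ) - 1), sq_nonneg a]
  have ha : |a| ≤ 1 + a ^ 2 + v := by
    have h1 := sq_abs a
    nlinarith [sq_nonneg (|a| - 1), v.2, abs_nonneg a]
  have hQ : (0 : ℝ) ≤ 1 + a ^ 2 + v := by positivity
  rw [hlaw, integral_map (by fun_prop) (by fun_prop)]
  calc ∫ z, |√v * z + a| ^ (p + 1) ∂(gaussianReal 0 1)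
      ≤ ∫ z, 2 ^ p * (1 + a ^ 2 + v) ^ (p + 1) * (1 + |z| ^ (p + 1)) ∂(gaussianReal 0 1) := by
        refine integral_mono_of_nonneg (ae_of_all _ fun z => by positivity)
          (((integrable_const _).add hint).const_mul _) (ae_of_all _ fun z => ?_)
        have h1 : |√v * z + a| ≤ (1 + a ^ 2 + v) * (|z| + 1) := by
          refine (abs_add_le _ _).trans ?_
          rw [abs_mul, abs_of_nonneg (Real.sqrt_nonneg _)]
          have := mul_le_mul_of_nonneg_right hs (abs_nonneg z)
          linarith
        calc |√v * z + a| ^ (p + 1) ≤ ((1 + a ^ 2 + v) * (|z| + 1)) ^ (p + 1) :=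
              pow_le_pow_left₀ (abs_nonneg _) h1 _
          _ = (1 + a ^ 2 + v) ^ (p + 1) * (|z| + 1) ^ (p + 1) := mul_pow _ _ _
          _ ≤ (1 + a ^ 2 + v) ^ (p + 1) * (2 ^ p * (|z| ^ (p + 1) + 1 ^ (p + 1))) :=
              mul_le_mul_of_nonneg_left (add_pow_le (abs_nonneg z) zero_le_one _) (by positivity)
          _ = _ := by rw [one_pow]; ring
    _ = 2 ^ p * (1 + B) * (1 + a ^ 2 + v) ^ (p + 1) := by
        rw [integral_const_mul, integral_add (integrable_const _) hint]
        simp only [integral_const, probReal_univ, smul_eq_mul, ← hB]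
        ring

lemma sum_pow_succ_le {ι : Type*} (s : Finset ι) {f : ι → ℝ} (hf : ∀ i ∈ s, 0 ≤ f i) (p : ℕ) :
    (∑ i ∈ s, f i) ^ (p + 1) ≤ (s.card : ℝ) ^ p * ∑ i ∈ s, f i ^ (p + 1) := by
  rcases s.eq_empty_or_nonempty with rfl | hs
  · simp
  · have hc : (0 : ℝ) < (s.card : ℝ) ^ p := by
      have := hs.card_pos
      positivity
    have := pow_sum_div_card_le_sum_pow hf p
    rwa [div_le_iff₀' hc] at this

/-- Each coordinate is a real Gaussian whose squared mean and variance add up to its second moment.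
Thus the second moment controls all others, and one moment bound on the initial law suffices for
every power that occurs. -/
lemma exists_integral_norm_pow_le (n p : ℕ) :
    ∃ C : ℝ, 0 ≤ C ∧ ∀ (μ : Measure (Vec n)), IsGaussian μ →
      ∫ x, ‖x‖ ^ (p + 1) ∂μ ≤ C * (1 + ∫ x, ‖x‖ ^ 2 ∂μ) ^ (p + 1) := by
  obtain ⟨C, hC, hCb⟩ := exists_integral_abs_pow_gaussianReal_le p
  refine ⟨n ^ p * (n * (C * 2 ^ (p + 1))), by positivity, fun μ hμ => ?_⟩
  set B : ℝ := ∫ x, ‖x‖ ^ 2 ∂μ with hB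
  have hB0 : 0 ≤ B := integral_nonneg fun x => by positivity
  have hsq := IsGaussian.integrable_norm_pow μ 2
  have hpw := IsGaussian.integrable_norm_pow μ (p + 1)
  have hcint : ∀ (a : Fin n) (q : ℕ), Integrable (fun x : Vec n => |x a| ^ q) μ := fun a q =>
    (IsGaussian.integrable_norm_pow μ q).mono (by fun_prop) (ae_of_all _ fun x => by
      rw [Real.norm_of_nonneg (by positivity), Real.norm_of_nonneg (by positivity)]
      exact pow_le_pow_left₀ (abs_nonneg _) (abs_coord_le_norm x a) q)
  have hcoord : ∀ a : Fin n, ∫ x, |x a| ^ (p + 1) ∂μ ≤ C * 2 ^ (p + 1) * (1 + B) ^ (p + 1) := by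
    intro a
    set L : StrongDual ℝ (Vec n) := EuclideanSpace.proj a with hL
    have hlaw := IsGaussian.map_eq_gaussianReal (μ := μ) L
    have hmem : MemLp L 2 μ := IsGaussian.memLp_dual μ L 2 (by simp)
    have h2 : ∫ x, L x ^ 2 ∂μ ≤ B := by
      refine integral_mono_of_nonneg (ae_of_all _ fun x => by positivity) hsq
        (ae_of_all _ fun x => ?_)
      have := pow_le_pow_left₀ (abs_nonneg _) (abs_coord_le_norm x a) 2
      simpa [hL] using this
    have hvar := variance_eq_sub hmem
    have hvar0 := variance_nonneg L μ
    simp only [Pi.pow_apply] at hvar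
    have hval : 1 + (μ[L]) ^ 2 + ((Var[L; μ]).toNNReal : ℝ) ≤ 2 * (1 + B) := by
      rw [Real.coe_toNNReal _ hvar0]
      linarith
    calc ∫ x, |x a| ^ (p + 1) ∂μ = ∫ t, |t| ^ (p + 1) ∂(μ.map L) := by
          rw [integral_map (by fun_prop) (by fun_prop)]
          rfl
      _ ≤ C * (1 + (μ[L]) ^ 2 + ((Var[L; μ]).toNNReal : ℝ)) ^ (p + 1) := by
          rw [hlaw]; exact hCb _ _
      _ ≤ C * (2 * (1 + B)) ^ (p + 1) := by gcongr
      _ = _ := by rw [mul_pow]; ring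
  calc ∫ x, ‖x‖ ^ (p + 1) ∂μ ≤ ∫ x, (n : ℝ) ^ p * ∑ a, |x a| ^ (p + 1) ∂μ := by
        refine integral_mono hpw ((integrable_finsetSum _ fun a _ => hcint a _).const_mul _)
          fun x => ?_
        refine (pow_le_pow_left₀ (norm_nonneg _) (norm_le_sum_abs_coord x) _).trans ?_
        simpa using sum_pow_succ_le Finset.univ (f := fun a => |x a|) (fun a _ => abs_nonneg _) p
    _ = (n : ℝ) ^ p * ∑ a, ∫ x, |x a| ^ (p + 1) ∂μ := by
        rw [integral_const_mul, integral_finsetSum _ fun a _ => hcint a _]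
    _ ≤ (n : ℝ) ^ p * ∑ _a : Fin n, C * 2 ^ (p + 1) * (1 + B) ^ (p + 1) := by
        gcongr with a; exact hcoord a
    _ = _ := by simp; ring

end Moments

end EnKF

namespace EnKF

/-! ### Moments of the input sizes -/

section InputMoments

universe w

variable {du dy : ℕ}

lemma integral_norm_pow_of_map_eq {Ω : Type*} [MeasurableSpace Ω] {P : Measure Ω} {n : ℕ}
    {X : Ω → Vec n} (hX : Measurable X) {μ : Measure (Vec n)} (hlaw : P.map X = μ) [IsGaussian μ]
    (p : ℕ) : Integrable (fun ω => ‖X ω‖ ^ p) P ∧ ∫ ω, ‖X ω‖ ^ p ∂P = ∫ x, ‖x‖ ^ p ∂μ := by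
  have h1 := IsGaussian.integrable_norm_pow μ p
  constructor
  · rw [← hlaw] at h1
    exact (integrable_map_measure (by fun_prop) hX.aemeasurable).1 h1
  · rw [← hlaw, integral_map hX.aemeasurable (by fun_prop)]

/-- The size of the inputs of a particle has moments of all orders. -/
lemma exists_integral_inputSize_pow_le (S : Matrix (Fin du) (Fin du) ℝ)
    (Γ : Matrix (Fin dy) (Fin dy) ℝ) (J : ℕ) (m₂ : ℝ) (p : ℕ) :
    ∃ C : ℝ, 0 ≤ C ∧ ∀ (N : ℕ) (Ω : Type w) [MeasurableSpace Ω] (P : Measure Ω)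
      [IsProbabilityMeasure P] (μ₀ : Measure (Vec du)) (u₀ : Fin N → Ω → Vec du)
      (ξ : ℕ → Fin N → Ω → Vec du) (η : ℕ → Fin N → Ω → Vec dy), IsInput P μ₀ S Γ J u₀ ξ η →
      IsGaussian μ₀ → ∫ u, ‖u‖ ^ 2 ∂μ₀ ≤ m₂ → ∀ i,
      Integrable (fun ω => inputSize J (u₀ i ω) (fun k => ξ k i ω) (fun k => η k i ω) ^ p) P ∧
      ∫ ω, inputSize J (u₀ i ω) (fun k => ξ k i ω) (fun k => η k i ω) ^ p ∂P ≤ C := by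
  -- The exponent is raised to `p + 1`. This is harmless because the size is at least one, and it
  -- keeps the exponents in the convexity inequalities free of truncated subtraction.
  obtain ⟨C, hC, hCb⟩ := exists_integral_norm_pow_le du p
  set A : ℝ := ∫ x, ‖x‖ ^ (p + 1) ∂(multivariateGaussian 0 S : Measure (Vec du)) with hA
  set B : ℝ := ∫ x, ‖x‖ ^ (p + 1) ∂(multivariateGaussian 0 Γ : Measure (Vec dy)) with hB
  have hA0 : 0 ≤ A := integral_nonneg fun x => by positivity
  have hB0 : 0 ≤ B := integral_nonneg fun x => by positivity
  set c₁ : ℝ := 2 ^ p with hc₁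
  set c₂ : ℝ := (J : ℝ) ^ p with hc₂
  refine ⟨c₁ * (c₁ * (1 + C * (1 + |m₂|) ^ (p + 1)) + c₂ * (J * (c₁ * (A + B)))), by positivity,
    fun N Ω _ P _ μ₀ u₀ ξ η hI hμ₀ hm i => ?_⟩
  obtain ⟨hui, hue⟩ := integral_norm_pow_of_map_eq (hI.measurable_init i) (hI.law_init i) (p + 1)
  have hξi : ∀ k ∈ Finset.range J, Integrable (fun ω => ‖ξ k i ω‖ ^ (p + 1)) P := fun k hk =>
    (integral_norm_pow_of_map_eq (hI.measurable_state k (Finset.mem_range.1 hk) i)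
      (hI.law_state k (Finset.mem_range.1 hk) i) (p + 1)).1
  have hξe : ∀ k ∈ Finset.range J, ∫ ω, ‖ξ k i ω‖ ^ (p + 1) ∂P = A := fun k hk =>
    (integral_norm_pow_of_map_eq (hI.measurable_state k (Finset.mem_range.1 hk) i)
      (hI.law_state k (Finset.mem_range.1 hk) i) (p + 1)).2
  have hηi : ∀ k ∈ Finset.range J, Integrable (fun ω => ‖η (k + 1) i ω‖ ^ (p + 1)) P := fun k hk =>
    (integral_norm_pow_of_map_eq (hI.measurable_obs k (Finset.mem_range.1 hk) i)
      (hI.law_obs k (Finset.mem_range.1 hk) i) (p + 1)).1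
  have hηe : ∀ k ∈ Finset.range J, ∫ ω, ‖η (k + 1) i ω‖ ^ (p + 1) ∂P = B := fun k hk =>
    (integral_norm_pow_of_map_eq (hI.measurable_obs k (Finset.mem_range.1 hk) i)
      (hI.law_obs k (Finset.mem_range.1 hk) i) (p + 1)).2
  have hmeas : Measurable fun ω => inputSize J (u₀ i ω) (fun k => ξ k i ω) (fun k => η k i ω) := by
    unfold inputSize
    refine ((hI.measurable_init i).norm.const_add 1).add (Finset.measurable_fun_sum _ fun k hk => ?_)
    exact (hI.measurable_state k (Finset.mem_range.1 hk) i).norm.add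
      (hI.measurable_obs k (Finset.mem_range.1 hk) i).norm
  set g : Ω → ℝ := fun ω => c₁ * (c₁ * (1 + ‖u₀ i ω‖ ^ (p + 1)) +
    c₂ * ∑ k ∈ Finset.range J, c₁ * (‖ξ k i ω‖ ^ (p + 1) + ‖η (k + 1) i ω‖ ^ (p + 1))) with hg
  have hsum : ∀ k ∈ Finset.range J,
      Integrable (fun ω => c₁ * (‖ξ k i ω‖ ^ (p + 1) + ‖η (k + 1) i ω‖ ^ (p + 1))) P :=
    fun k hk => ((hξi k hk).add (hηi k hk)).const_mul _
  have hui' : Integrable (fun ω => c₁ * (1 + ‖u₀ i ω‖ ^ (p + 1))) P :=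
    ((integrable_const _).add hui).const_mul _
  have hsum' : Integrable (fun ω => c₂ * ∑ k ∈ Finset.range J,
      c₁ * (‖ξ k i ω‖ ^ (p + 1) + ‖η (k + 1) i ω‖ ^ (p + 1))) P :=
    (integrable_finsetSum _ hsum).const_mul _
  have hgint : Integrable g P := (hui'.add hsum').const_mul _
  have hle : ∀ ω, inputSize J (u₀ i ω) (fun k => ξ k i ω) (fun k => η k i ω) ^ p ≤ g ω := by
    intro ω
    have h1 := one_le_inputSize J (u₀ i ω) (fun k => ξ k i ω) (fun k => η k i ω)
    have hs := inputSize_sum_nonneg J (fun k => ξ k i ω) (fun k => η k i ω)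
    refine (pow_le_pow_right₀ h1 (Nat.le_succ p)).trans ?_
    have h2 := add_pow_le (by positivity : 0 ≤ 1 + ‖u₀ i ω‖) hs (p + 1)
    have h3 := add_pow_le zero_le_one (norm_nonneg (u₀ i ω)) (p + 1)
    have h4 := sum_pow_succ_le (Finset.range J)
      (f := fun k => ‖ξ k i ω‖ + ‖η (k + 1) i ω‖) (fun _ _ => by positivity) p
    have h5 : ∑ k ∈ Finset.range J, (‖ξ k i ω‖ + ‖η (k + 1) i ω‖) ^ (p + 1) ≤
        ∑ k ∈ Finset.range J, c₁ * (‖ξ k i ω‖ ^ (p + 1) + ‖η (k + 1) i ω‖ ^ (p + 1)) :=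
      Finset.sum_le_sum fun k _ => add_pow_le (norm_nonneg _) (norm_nonneg _) (p + 1)
    rw [one_pow] at h3
    rw [Finset.card_range] at h4
    simp only [Nat.add_sub_cancel] at h2 h3
    refine h2.trans (mul_le_mul_of_nonneg_left (add_le_add h3 (h4.trans ?_)) (by positivity))
    exact mul_le_mul_of_nonneg_left h5 (by positivity)
  have hW0 : ∀ ω, 0 ≤ inputSize J (u₀ i ω) (fun k => ξ k i ω) (fun k => η k i ω) ^ p := fun ω =>
    pow_nonneg (zero_le_one.trans (one_le_inputSize _ _ _ _)) _
  have hint : Integrable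
      (fun ω => inputSize J (u₀ i ω) (fun k => ξ k i ω) (fun k => η k i ω) ^ p) P :=
    hgint.mono (hmeas.pow_const p).aestronglyMeasurable (ae_of_all _ fun ω => by
      rw [Real.norm_of_nonneg (hW0 ω)]
      exact (hle ω).trans (le_abs_self _))
  refine ⟨hint, (integral_mono hint hgint hle).trans ?_⟩
  rw [hg, integral_const_mul, integral_add hui' hsum', integral_const_mul, integral_const_mul,
    integral_add (integrable_const _) hui, integral_finsetSum _ hsum]
  have h1 : ∀ k ∈ Finset.range J,
      ∫ ω, c₁ * (‖ξ k i ω‖ ^ (p + 1) + ‖η (k + 1) i ω‖ ^ (p + 1)) ∂P = c₁ * (A + B) := fun k hk => by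
    rw [integral_const_mul, integral_add (hξi k hk) (hηi k hk), hξe k hk, hηe k hk]
  rw [Finset.sum_congr rfl h1, hue]
  simp only [integral_const, probReal_univ, smul_eq_mul, mul_one, Finset.sum_const,
    Finset.card_range, nsmul_eq_mul]
  have h2 : ∫ x, ‖x‖ ^ (p + 1) ∂μ₀ ≤ C * (1 + |m₂|) ^ (p + 1) := by
    refine (hCb μ₀ hμ₀).trans ?_
    have : 0 ≤ ∫ u, ‖u‖ ^ 2 ∂μ₀ := integral_nonneg fun u => by positivity
    have := le_abs_self m₂
    gcongr
    linarith
  gcongr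

end InputMoments

end EnKF

namespace EnKF

/-! ### Densities of Gaussian measures -/

section Density

open scoped MatrixOrder RealInnerProductSpace

/-- The two measures are finite and have the same characteristic function, by the Fourier transform
of the Gaussian; the normalization cancels the factor `(2 * π) ^ (n / 2)`. -/
lemma stdGaussian_eq_withDensity (n : ℕ) :
    stdGaussian (Vec n) = (volume : Measure (Vec n)).withDensity fun x =>
      ENNReal.ofReal ((√((2 * Real.pi) ^ n))⁻¹ * Real.exp (-(1 / 2) * ‖x‖ ^ 2)) := by
  set c : ℝ := (√((2 * Real.pi) ^ n))⁻¹ with hc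
  have hcpos : 0 < c := by positivity
  have hint : Integrable (fun x : Vec n => c * Real.exp (-(1 / 2) * ‖x‖ ^ 2)) := by
    have h := GaussianFourier.integrable_cexp_neg_mul_sq_norm_add (V := Vec n) (b := (1 / 2 : ℂ))
      (by norm_num) 0 0
    have h2 := h.re.const_mul c
    refine h2.congr (ae_of_all _ fun x => ?_)
    simp only [zero_mul, add_zero]
    congr 1
    have : (-(1 / 2 : ℂ) * (‖x‖ : ℂ) ^ 2) = ((-(1 / 2) * ‖x‖ ^ 2 : ℝ) : ℂ) := by push_cast; ring
    rw [this, ← Complex.ofReal_exp]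
    rfl
  have hfin : IsFiniteMeasure ((volume : Measure (Vec n)).withDensity fun x =>
      ENNReal.ofReal (c * Real.exp (-(1 / 2) * ‖x‖ ^ 2))) :=
    isFiniteMeasure_withDensity_ofReal hint.2
  refine Measure.ext_of_charFun ?_
  ext t
  rw [charFun_stdGaussian, charFun_apply, integral_withDensity_eq_integral_toReal_smul
    (by fun_prop) (ae_of_all _ fun x => ENNReal.ofReal_lt_top)]
  have h := GaussianFourier.integral_cexp_neg_mul_sq_norm_add (V := Vec n) (b := (1 / 2 : ℂ))
    (by norm_num) Complex.I t
  have h1 : ∀ x : Vec n, (ENNReal.ofReal (c * Real.exp (-(1 / 2) * ‖x‖ ^ 2))).toReal •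
      Complex.exp (⟪x, t⟫ * Complex.I) =
      (c : ℂ) * Complex.exp (-(1 / 2 : ℂ) * (‖x‖ : ℂ) ^ 2 + Complex.I * ⟪t, x⟫) := by
    intro x
    rw [ENNReal.toReal_ofReal (by positivity), Complex.exp_add, real_inner_comm t x,
      Complex.real_smul, mul_comm Complex.I]
    push_cast
    ring
  simp only [h1]
  rw [integral_const_mul, h, ← mul_assoc]
  have h2 : (c : ℂ) * ((Real.pi : ℂ) / (1 / 2)) ^ (Module.finrank ℝ (Vec n) / 2 : ℂ) = 1 := by
    have h3 : ((Real.pi : ℂ) / (1 / 2)) = ((2 * Real.pi : ℝ) : ℂ) := by push_cast; ring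
    have h4 : (Module.finrank ℝ (Vec n) / 2 : ℂ) = ((n / 2 : ℝ) : ℂ) := by
      simp
    rw [h3, h4, ← Complex.ofReal_cpow (by positivity), ← Complex.ofReal_mul]
    have h5 : (2 * Real.pi) ^ (n / 2 : ℝ) = √((2 * Real.pi) ^ n) := by
      rw [Real.sqrt_eq_rpow, ← Real.rpow_natCast, ← Real.rpow_mul (by positivity)]
      congr 1; ring
    rw [h5, hc, inv_mul_cancel₀ (by positivity), Complex.ofReal_one]
  rw [h2, one_mul]
  congr 1
  rw [Complex.I_sq]
  ring

lemma gaussianDensity_nonneg {n : ℕ} (S : Matrix (Fin n) (Fin n) ℝ) (z : Vec n) :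
    0 ≤ gaussianDensity S z := by
  unfold gaussianDensity
  positivity

lemma continuous_weightedSq {n : ℕ} (S : Matrix (Fin n) (Fin n) ℝ) :
    Continuous (weightedSq S) := by
  unfold weightedSq
  simp only [dotProduct, Matrix.mulVec]
  fun_prop

lemma continuous_gaussianDensity {n : ℕ} (S : Matrix (Fin n) (Fin n) ℝ) :
    Continuous (gaussianDensity S) := by
  have := continuous_weightedSq S
  unfold gaussianDensity
  fun_prop

/-- Change of variables under the symmetric square root `A` of `S`, which maps the standard Gaussian
to this one: it carries the Euclidean norm to the weighted one, and `|A.det| = √S.det` is the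
Jacobian. -/
lemma multivariateGaussian_eq_withDensity {n : ℕ} {S : Matrix (Fin n) (Fin n) ℝ}
    (hS : S.PosDef) : multivariateGaussian 0 S =
      (volume : Measure (Vec n)).withDensity fun x => ENNReal.ofReal (gaussianDensity S x) := by
  have hSn : 0 ≤ S := hS.posSemidef.nonneg
  set A : Matrix (Fin n) (Fin n) ℝ := CFC.sqrt S with hA
  have hAA : A * A = S := CFC.sqrt_mul_sqrt_self S hSn
  have hdetS := hS.det_pos
  have hdet2 : A.det * A.det = S.det := by rw [← Matrix.det_mul, hAA]
  have hdetA : A.det ≠ 0 := fun h0 => by rw [h0, zero_mul] at hdet2; exact hdetS.ne hdet2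
  have habs : |A.det| = √S.det := by rw [← hdet2, Real.sqrt_mul_self_eq_abs]
  have hAsymm : A.transpose = A := by
    have := (CFC.sqrt_nonneg S).isSelfAdjoint
    rw [IsSelfAdjoint, Matrix.star_eq_conjTranspose, Matrix.conjTranspose_eq_transpose_of_trivial]
      at this
    exact this
  set T : Vec n →L[ℝ] Vec n := Matrix.toEuclideanCLM (𝕜 := ℝ) A with hT
  have hTdet : LinearMap.det (T : Vec n →ₗ[ℝ] Vec n) = A.det := LinearMap.det_toLpLin 2 A
  have hTx : ∀ x, weightedSq S (T x) = ‖x‖ ^ 2 := by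
    intro x
    have h1 : (T x).ofLp = A.mulVec x.ofLp := rfl
    rw [weightedSq, h1, ← hAA, Matrix.mul_inv_rev, Matrix.mulVec_mulVec, Matrix.mul_assoc,
      Matrix.nonsing_inv_mul A (isUnit_iff_ne_zero.2 hdetA), Matrix.mul_one,
      ← Matrix.vecMul_transpose, hAsymm, ← Matrix.dotProduct_mulVec, Matrix.mulVec_mulVec,
      Matrix.mul_nonsing_inv A (isUnit_iff_ne_zero.2 hdetA), Matrix.one_mulVec, dotProduct_self_eq]
  have hmap : (volume : Measure (Vec n)).map T = ENNReal.ofReal |A.det⁻¹| • volume := by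
    have := Measure.map_linearMap_addHaar_eq_smul_addHaar (volume : Measure (Vec n))
      (f := (T : Vec n →ₗ[ℝ] Vec n)) (by rwa [hTdet])
    rwa [hTdet] at this
  have hdens : ∀ x, (√((2 * Real.pi) ^ n))⁻¹ * Real.exp (-(1 / 2) * ‖x‖ ^ 2) =
      |A.det| * gaussianDensity S (T x) := by
    intro x
    rw [gaussianDensity, hTx, Real.sqrt_mul (by positivity), habs]
    have := (Real.sqrt_pos.2 hdetS).ne'
    field_simp
  have hgd := (continuous_gaussianDensity S).measurable
  refine Measure.ext fun s hs => ?_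
  have hstep : (multivariateGaussian 0 S : Measure (Vec n)) s = stdGaussian (Vec n) (T ⁻¹' s) := by
    rw [multivariateGaussian, Measure.map_apply (by fun_prop) hs]
    simp only [zero_add]
    rfl
  have hg2 : Measurable fun x => s.indicator (fun x => ENNReal.ofReal (gaussianDensity S x)) x :=
    hgd.ennreal_ofReal.indicator hs
  rw [hstep, stdGaussian_eq_withDensity, withDensity_apply _ (T.measurable hs),
    withDensity_apply _ hs, ← lintegral_indicator (T.measurable hs), ← lintegral_indicator hs]
  have h1 : ∀ x, (T ⁻¹' s).indicator (fun x => ENNReal.ofReal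
      ((√((2 * Real.pi) ^ n))⁻¹ * Real.exp (-(1 / 2) * ‖x‖ ^ 2))) x =
      ENNReal.ofReal |A.det| *
        s.indicator (fun x => ENNReal.ofReal (gaussianDensity S x)) (T x) := by
    intro x
    by_cases hx : T x ∈ s
    · rw [Set.indicator_of_mem (show x ∈ T ⁻¹' s from hx), Set.indicator_of_mem hx, hdens,
        ENNReal.ofReal_mul (abs_nonneg _)]
    · rw [Set.indicator_of_notMem (show x ∉ T ⁻¹' s from hx), Set.indicator_of_notMem hx, mul_zero]
  simp only [h1]
  have hg3 : Measurable fun x => s.indicator (fun x => ENNReal.ofReal (gaussianDensity S x)) (T x) :=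
    hg2.comp T.measurable
  have h2 := lintegral_map (μ := volume) hg2 T.measurable
  rw [lintegral_const_mul _ hg3, ← h2, hmap, lintegral_smul_measure, smul_eq_mul, ← mul_assoc, ← ENNReal.ofReal_mul (abs_nonneg _), ← abs_mul,
    mul_inv_cancel₀ hdetA, abs_one, ENNReal.ofReal_one, one_mul]

end Density

end EnKF

namespace EnKF

/-! ### The filtering recursion in terms of measures -/

section Filter

variable {du dy : ℕ}

lemma weightedSq_nonneg {n : ℕ} {S : Matrix (Fin n) (Fin n) ℝ} (hS : S.PosDef) (x : Vec n) :
    0 ≤ weightedSq S x := by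
  have := hS.inv.posSemidef.dotProduct_mulVec_nonneg x.ofLp
  simpa [weightedSq] using this

lemma gaussianDensity_le {n : ℕ} {S : Matrix (Fin n) (Fin n) ℝ} (hS : S.PosDef) (x : Vec n) :
    gaussianDensity S x ≤ 1 / √((2 * Real.pi) ^ n * S.det) := by
  refine mul_le_of_le_one_right (by positivity) (Real.exp_le_one_iff.2 ?_)
  linarith [weightedSq_nonneg hS x]

lemma gaussianDensity_pos {n : ℕ} {S : Matrix (Fin n) (Fin n) ℝ} (hS : S.PosDef) (x : Vec n) :
    0 < gaussianDensity S x := by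
  have := hS.det_pos
  unfold gaussianDensity
  positivity

/-- The law of `Ψ v + ξ` for independent `v ∼ μ` and `ξ ∼ N(0, S)`. -/
noncomputable def predLaw (Ψ : Vec du → Vec du) (S : Matrix (Fin du) (Fin du) ℝ)
    (μ : Measure (Vec du)) : Measure (Vec du) :=
  (μ.prod (multivariateGaussian 0 S)).map fun p => Ψ p.1 + p.2

lemma isProbabilityMeasure_predLaw {Ψ : Vec du → Vec du} (hΨ : Measurable Ψ)
    (S : Matrix (Fin du) (Fin du) ℝ) (μ : Measure (Vec du)) [IsProbabilityMeasure μ] :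
    IsProbabilityMeasure (predLaw Ψ S μ) :=
  Measure.isProbabilityMeasure_map (by fun_prop)

lemma lintegral_predLaw {Ψ : Vec du → Vec du} (hΨ : Measurable Ψ)
    (S : Matrix (Fin du) (Fin du) ℝ) (μ : Measure (Vec du)) [IsProbabilityMeasure μ]
    {F : Vec du → ENNReal} (hF : Measurable F) :
    ∫⁻ u, F u ∂(predLaw Ψ S μ) = ∫⁻ v, ∫⁻ z, F (Ψ v + z) ∂(multivariateGaussian 0 S) ∂μ := by
  rw [predLaw, lintegral_map hF (by fun_prop), lintegral_prod _ (by fun_prop)]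

lemma ofReal_predictOp {Ψ : Vec du → Vec du} (hΨ : Measurable Ψ)
    {S : Matrix (Fin du) (Fin du) ℝ} (hS : S.PosDef) (μ : Measure (Vec du))
    [IsProbabilityMeasure μ] (u : Vec du) :
    ENNReal.ofReal (predictOp Ψ S μ u) =
      ∫⁻ v, ENNReal.ofReal (gaussianDensity S (u - Ψ v)) ∂μ := by
  have hg := (continuous_gaussianDensity S).measurable
  refine ofReal_integral_eq_lintegral_ofReal ?_ (ae_of_all _ fun v => gaussianDensity_nonneg S _)
  refine Integrable.of_bound (Measurable.aestronglyMeasurable (by fun_prop))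
    (1 / √((2 * Real.pi) ^ du * S.det)) (ae_of_all _ fun v => ?_)
  rw [Real.norm_of_nonneg (gaussianDensity_nonneg S _)]
  exact gaussianDensity_le hS _

/-- Translate the Gaussian density by `Ψ v`, then exchange the integrals over `v` and `u` by
Tonelli. This replaces the density that defines the filter by a law that can be realized by random
variables. -/
lemma predLaw_eq_withDensity {Ψ : Vec du → Vec du} (hΨ : Measurable Ψ)
    {S : Matrix (Fin du) (Fin du) ℝ} (hS : S.PosDef) (μ : Measure (Vec du))
    [IsProbabilityMeasure μ] :
    predLaw Ψ S μ = volume.withDensity fun u => ENNReal.ofReal (predictOp Ψ S μ u) := by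
  have hg := (continuous_gaussianDensity S).measurable
  refine Measure.ext fun s hs => ?_
  rw [← lintegral_indicator_one hs, lintegral_predLaw hΨ S μ (measurable_one.indicator hs),
    withDensity_apply _ hs, ← lintegral_indicator hs]
  have h1 : ∀ v, ∫⁻ z, s.indicator (1 : Vec du → ENNReal) (Ψ v + z) ∂(multivariateGaussian 0 S) =
      ∫⁻ u, s.indicator (1 : Vec du → ENNReal) u *
        ENNReal.ofReal (gaussianDensity S (u - Ψ v)) := by
    intro v
    have hm : Measurable fun z : Vec du => s.indicator (1 : Vec du → ENNReal) (Ψ v + z) :=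
      (measurable_one.indicator hs).comp (measurable_const_add (Ψ v))
    rw [multivariateGaussian_eq_withDensity hS,
      lintegral_withDensity_eq_lintegral_mul _ (by fun_prop) hm,
      ← lintegral_sub_right_eq_self _ (Ψ v)]
    refine lintegral_congr fun u => ?_
    simp only [Pi.mul_apply]
    rw [add_sub_cancel, mul_comm]
  simp only [h1]
  have hm2 : Measurable fun p : Vec du × Vec du => s.indicator (1 : Vec du → ENNReal) p.2 *
      ENNReal.ofReal (gaussianDensity S (p.2 - Ψ p.1)) := by
    have : Measurable fun p : Vec du × Vec du => s.indicator (1 : Vec du → ENNReal) p.2 :=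
      (measurable_one.indicator hs).comp measurable_snd
    fun_prop
  rw [lintegral_lintegral_swap hm2.aemeasurable]
  refine lintegral_congr fun u => ?_
  rw [lintegral_const_mul _ (by fun_prop), ← ofReal_predictOp hΨ hS]
  by_cases hu : u ∈ s <;> simp [hu]

/-- The likelihood of the datum `y`. -/
noncomputable def likelihood (h : Vec du → Vec dy) (Γ : Matrix (Fin dy) (Fin dy) ℝ) (y : Vec dy)
    (u : Vec du) : ℝ := gaussianDensity Γ (y - h u)

lemma measurable_likelihood {h : Vec du → Vec dy} (hh : Measurable h)
    (Γ : Matrix (Fin dy) (Fin dy) ℝ) (y : Vec dy) : Measurable (likelihood h Γ y) :=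
  (continuous_gaussianDensity Γ).measurable.comp (measurable_const.sub hh)

/-- The likelihood is positive everywhere; with its boundedness this makes the normalization in
Bayes' formula legitimate. -/
lemma lintegral_likelihood_ne_zero {h : Vec du → Vec dy} (hh : Measurable h)
    {Γ : Matrix (Fin dy) (Fin dy) ℝ} (hΓ : Γ.PosDef) (y : Vec dy) (μ : Measure (Vec du))
    [IsProbabilityMeasure μ] : ∫⁻ u, ENNReal.ofReal (likelihood h Γ y u) ∂μ ≠ 0 := by
  intro h0
  rw [lintegral_eq_zero_iff (measurable_likelihood hh Γ y).ennreal_ofReal] at h0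
  have : ∀ᵐ _u ∂μ, False := by
    filter_upwards [h0] with u hu
    have := gaussianDensity_pos hΓ (y - h u)
    simp only [Pi.zero_apply, ENNReal.ofReal_eq_zero, likelihood] at hu
    linarith
  simp at this
  exact IsProbabilityMeasure.ne_zero μ this

lemma lintegral_likelihood_ne_top {h : Vec du → Vec dy}
    {Γ : Matrix (Fin dy) (Fin dy) ℝ} (hΓ : Γ.PosDef) (y : Vec dy) (μ : Measure (Vec du))
    [IsProbabilityMeasure μ] : ∫⁻ u, ENNReal.ofReal (likelihood h Γ y u) ∂μ ≠ ⊤ := by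
  refine ne_top_of_le_ne_top (b := ENNReal.ofReal (1 / √((2 * Real.pi) ^ dy * Γ.det)))
    ENNReal.ofReal_ne_top ?_
  calc _ ≤ ∫⁻ _u, ENNReal.ofReal (1 / √((2 * Real.pi) ^ dy * Γ.det)) ∂μ :=
        lintegral_mono fun u => ENNReal.ofReal_le_ofReal (gaussianDensity_le hΓ _)
    _ = _ := by simp

/-- Translates the recursion on Lebesgue densities into Bayes' rule for measures: the predicted law
is reweighted with the likelihood and normalized. The real-valued normalizing integral of `condOp`
equals the extended one because the latter is finite. -/
lemma analysisStep_eq {h : Vec du → Vec dy} (hh : Measurable h) {Ψ : Vec du → Vec du}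
    (hΨ : Measurable Ψ) {S : Matrix (Fin du) (Fin du) ℝ} (hS : S.PosDef)
    {Γ : Matrix (Fin dy) (Fin dy) ℝ} (hΓ : Γ.PosDef) (y : Vec dy) (μ : Measure (Vec du))
    [IsProbabilityMeasure μ] :
    (volume.withDensity fun u =>
        ENNReal.ofReal (condOp y (liftOp h Γ (predictOp Ψ S μ)) u)) =
      (∫⁻ u, ENNReal.ofReal (likelihood h Γ y u) ∂(predLaw Ψ S μ))⁻¹ •
        (predLaw Ψ S μ).withDensity fun u => ENNReal.ofReal (likelihood h Γ y u) := by
  have := isProbabilityMeasure_predLaw hΨ S μ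
  have hL := measurable_likelihood hh Γ y
  have hg := (continuous_gaussianDensity S).measurable
  have hp0 : ∀ u, 0 ≤ predictOp Ψ S μ u := fun u =>
    integral_nonneg fun v => gaussianDensity_nonneg S _
  have hpm : Measurable fun u => ENNReal.ofReal (predictOp Ψ S μ u) := by
    simp only [ofReal_predictOp hΨ hS]
    exact Measurable.lintegral_prod_right (f := fun u v =>
      ENNReal.ofReal (gaussianDensity S (u - Ψ v))) (by fun_prop)
  have hpm' : Measurable (predictOp Ψ S μ) := by
    have := hpm.ennreal_toReal
    simpa only [ENNReal.toReal_ofReal (hp0 _)] using this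
  have hL0 : ∀ u, 0 ≤ likelihood h Γ y u := fun u => gaussianDensity_nonneg Γ _
  have hnorm : ∫⁻ u, ENNReal.ofReal (likelihood h Γ y u) ∂(predLaw Ψ S μ) =
      ∫⁻ u, ENNReal.ofReal (liftOp h Γ (predictOp Ψ S μ) (u, y)) := by
    rw [predLaw_eq_withDensity hΨ hS, lintegral_withDensity_eq_lintegral_mul _ hpm hL.ennreal_ofReal]
    refine lintegral_congr fun u => ?_
    rw [Pi.mul_apply, ← ENNReal.ofReal_mul (hp0 u), mul_comm]
    rfl
  have hc0 := lintegral_likelihood_ne_zero hh hΓ y (predLaw Ψ S μ)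
  have hct := lintegral_likelihood_ne_top (h := h) hΓ y (predLaw Ψ S μ)
  have hreal : ∫ U, liftOp h Γ (predictOp Ψ S μ) (U, y) =
      (∫⁻ u, ENNReal.ofReal (likelihood h Γ y u) ∂(predLaw Ψ S μ)).toReal := by
    rw [hnorm]
    exact integral_eq_lintegral_of_nonneg_ae
      (ae_of_all _ fun u => mul_nonneg (hL0 u) (hp0 u)) (hL.mul hpm').aestronglyMeasurable
  have hpos := ENNReal.toReal_pos hc0 hct
  rw [← withDensity_smul _ hL.ennreal_ofReal]
  conv_rhs => rw [predLaw_eq_withDensity hΨ hS]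
  rw [← withDensity_mul _ hpm (hL.ennreal_ofReal.const_smul _)]
  congr 1
  ext u
  simp only [condOp, hreal, Pi.mul_apply, Pi.smul_apply, smul_eq_mul]
  rw [ENNReal.ofReal_div_of_pos hpos, ENNReal.ofReal_toReal hct, ENNReal.div_eq_inv_mul,
    ← predLaw_eq_withDensity hΨ hS]
  change _ * ENNReal.ofReal (likelihood h Γ y u * predictOp Ψ S μ u) = _
  rw [ENNReal.ofReal_mul (hL0 u)]
  ring

lemma trueFilter_succ {h : Vec du → Vec dy} (hh : Measurable h) {Ψ : Vec du → Vec du}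
    (hΨ : Measurable Ψ) {S : Matrix (Fin du) (Fin du) ℝ} (hS : S.PosDef)
    {Γ : Matrix (Fin dy) (Fin dy) ℝ} (hΓ : Γ.PosDef) (y : ℕ → Vec dy) (μ₀ : Measure (Vec du))
    (j : ℕ) [IsProbabilityMeasure (trueFilter Ψ h S Γ y μ₀ j)] :
    trueFilter Ψ h S Γ y μ₀ (j + 1) =
      (∫⁻ u, ENNReal.ofReal (likelihood h Γ (y (j + 1)) u)
        ∂(predLaw Ψ S (trueFilter Ψ h S Γ y μ₀ j)))⁻¹ •
      (predLaw Ψ S (trueFilter Ψ h S Γ y μ₀ j)).withDensity fun u =>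
        ENNReal.ofReal (likelihood h Γ (y (j + 1)) u) :=
  analysisStep_eq hh hΨ hS hΓ (y (j + 1)) _

lemma isProbabilityMeasure_trueFilter {h : Vec du → Vec dy} (hh : Measurable h)
    {Ψ : Vec du → Vec du} (hΨ : Measurable Ψ) {S : Matrix (Fin du) (Fin du) ℝ} (hS : S.PosDef)
    {Γ : Matrix (Fin dy) (Fin dy) ℝ} (hΓ : Γ.PosDef) (y : ℕ → Vec dy) (μ₀ : Measure (Vec du))
    [hμ₀ : IsProbabilityMeasure μ₀] (j : ℕ) :
    IsProbabilityMeasure (trueFilter Ψ h S Γ y μ₀ j) := by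
  induction j with
  | zero => exact hμ₀
  | succ j ih =>
    have := isProbabilityMeasure_predLaw hΨ S (trueFilter Ψ h S Γ y μ₀ j)
    refine ⟨?_⟩
    rw [trueFilter_succ hh hΨ hS hΓ, Measure.smul_apply, withDensity_apply _ MeasurableSet.univ,
      setLIntegral_univ, smul_eq_mul]
    exact ENNReal.inv_mul_cancel (lintegral_likelihood_ne_zero hh hΓ _ _)
      (lintegral_likelihood_ne_top hΓ _ _)

end Filter

end EnKF

namespace EnKF

/-! ### The Kalman update of a Gaussian law -/

section Kalman

variable {du dy : ℕ} {Ω : Type*} [MeasurableSpace Ω] {P : Measure Ω}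

lemma covariance_fun_add_left [IsFiniteMeasure P] {X Y Z : Ω → ℝ} (hX : MemLp X 2 P)
    (hY : MemLp Y 2 P) (hZ : MemLp Z 2 P) :
    cov[fun ω => X ω + Y ω, Z; P] = cov[X, Z; P] + cov[Y, Z; P] :=
  covariance_add_left hX hY hZ

lemma covariance_fun_add_right [IsFiniteMeasure P] {X Y Z : Ω → ℝ} (hX : MemLp X 2 P)
    (hY : MemLp Y 2 P) (hZ : MemLp Z 2 P) :
    cov[X, fun ω => Y ω + Z ω; P] = cov[X, Y; P] + cov[X, Z; P] :=
  covariance_add_right hX hY hZ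

lemma continuous_integral_of_bounded {α β : Type*} [TopologicalSpace α] [FirstCountableTopology α]
    [MeasurableSpace β] {μ : Measure β} [IsFiniteMeasure μ] {f : α → β → ℝ} {C : ℝ}
    (hm : ∀ a, Measurable (f a)) (hb : ∀ a b, |f a b| ≤ C) (hc : ∀ b, Continuous fun a => f a b) :
    Continuous fun a => ∫ b, f a b ∂μ :=
  continuous_of_dominated (F := f) (bound := fun _ => C) (fun a => (hm a).aestronglyMeasurable)
    (fun a => ae_of_all _ (hb a)) (integrable_const C) (ae_of_all _ hc)

lemma ofReal_integral_of_bounded {β : Type*} [MeasurableSpace β] {μ : Measure β}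
    [IsFiniteMeasure μ] {f : β → ℝ} {C : ℝ} (hm : Measurable f) (h0 : ∀ b, 0 ≤ f b)
    (hb : ∀ b, |f b| ≤ C) : ENNReal.ofReal (∫ b, f b ∂μ) = ∫⁻ b, ENNReal.ofReal (f b) ∂μ :=
  ofReal_integral_eq_lintegral_ofReal
    (Integrable.of_bound hm.aestronglyMeasurable C (ae_of_all _ hb)) (ae_of_all _ h0)

/-- For affine `h` the analysis step is the regression residual translated by a vector that depends
on the datum only. The law of the residual thus determines the law after the update. -/
lemma gainStep_eq_of_affine (h : Vec du →ᵃ[ℝ] Vec dy) (K : Matrix (Fin du) (Fin dy) ℝ)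
    (y : Vec dy) (u : Vec du) (z : Vec dy) :
    gainStep h K y u z = u - WithLp.toLp 2 (K.mulVec (h.linear u + z).ofLp) +
      WithLp.toLp 2 (K.mulVec (y - h 0).ofLp) := by
  have hu : h u = h.linear u + h 0 := by
    simpa using h.map_vadd 0 u
  ext a
  simp only [gainStep, hu, Matrix.mulVec_sub, Matrix.mulVec_add, WithLp.ofLp_sub,
      WithLp.ofLp_add, PiLp.add_apply, PiLp.sub_apply, Pi.sub_apply, Pi.add_apply]
  ring

/-- The residual of the linear regression on the observation is independent of it. -/
lemma indepFun_regression_residual [IsProbabilityMeasure P] {X : Ω → Vec du} {η : Ω → Vec dy}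
    (hX : HasGaussianLaw X P) (hηm : Measurable η) {Γ : Matrix (Fin dy) (Fin dy) ℝ} (hΓ : Γ.PosDef)
    (hη : P.map η = multivariateGaussian 0 Γ) (hXη : IndepFun X η P)
    (L : Vec du →ₗ[ℝ] Vec dy) {Cuh : Matrix (Fin du) (Fin dy) ℝ}
    {Chh : Matrix (Fin dy) (Fin dy) ℝ} (hdet : IsUnit (Chh + Γ).det)
    (hUH : ∀ a b, Cuh a b = cov[fun ω => X ω a, fun ω => L (X ω) b; P])
    (hHH : ∀ a b, Chh a b = cov[fun ω => L (X ω) a, fun ω => L (X ω) b; P]) :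
    HasGaussianLaw (fun ω => (X ω - WithLp.toLp 2
        ((Cuh * (Chh + Γ)⁻¹).mulVec (L (X ω) + η ω).ofLp), L (X ω) + η ω)) P ∧
    IndepFun (fun ω => X ω - WithLp.toLp 2
        ((Cuh * (Chh + Γ)⁻¹).mulVec (L (X ω) + η ω).ofLp)) (fun ω => L (X ω) + η ω) P := by
  set K := Cuh * (Chh + Γ)⁻¹ with hK
  have hηG : HasGaussianLaw η P := ⟨by rw [hη]; infer_instance⟩
  have hjoint := hXη.hasGaussianLaw hX hηG
  set Lc : Vec du →L[ℝ] Vec dy := LinearMap.toContinuousLinearMap L with hLc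
  set Kc : Vec dy →L[ℝ] Vec du := LinearMap.toContinuousLinearMap (Matrix.toEuclideanLin K) with hKc
  set T : Vec du × Vec dy →L[ℝ] Vec dy :=
    Lc ∘L ContinuousLinearMap.fst ℝ (Vec du) (Vec dy) + ContinuousLinearMap.snd ℝ (Vec du) (Vec dy)
    with hT
  -- Residual and observation form a linear image of the jointly Gaussian pair of state and noise.
  have hG : HasGaussianLaw (fun ω => (X ω - WithLp.toLp 2 (K.mulVec (L (X ω) + η ω).ofLp),
      L (X ω) + η ω)) P :=
    hjoint.map_fun ((ContinuousLinearMap.fst ℝ (Vec du) (Vec dy) - Kc ∘L T).prod T)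
  refine ⟨hG, ?_⟩
  have hXm : ∀ a, MemLp (fun ω => X ω a) 2 P := fun a =>
    (hX.map_fun (EuclideanSpace.proj a : Vec du →L[ℝ] ℝ)).memLp_two
  have hLXm : ∀ b, MemLp (fun ω => L (X ω) b) 2 P := fun b =>
    (hX.map_fun ((EuclideanSpace.proj b : Vec dy →L[ℝ] ℝ) ∘L Lc)).memLp_two
  have hηM : ∀ b, MemLp (fun ω => η ω b) 2 P := fun b =>
    (hηG.map_fun (EuclideanSpace.proj b : Vec dy →L[ℝ] ℝ)).memLp_two
  have hYm : ∀ b, MemLp (fun ω => L (X ω) b + η ω b) 2 P := fun b => (hLXm b).add (hηM b)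
  have hXη0 : ∀ a b, cov[fun ω => X ω a, fun ω => η ω b; P] = 0 := fun a b =>
    IndepFun.covariance_eq_zero (hXη.comp (φ := fun x : Vec du => x a) (ψ := fun x : Vec dy => x b)
      (by fun_prop) (by fun_prop)) (hXm a) (hηM b)
  have hLm : Measurable L := Lc.continuous.measurable
  have hLη0 : ∀ a b, cov[fun ω => L (X ω) a, fun ω => η ω b; P] = 0 := fun a b =>
    IndepFun.covariance_eq_zero (hXη.comp (φ := fun x : Vec du => L x a)
      (ψ := fun x : Vec dy => x b) (by fun_prop) (by fun_prop)) (hLXm a) (hηM b)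
  have hηη : ∀ a b, cov[fun ω => η ω a, fun ω => η ω b; P] = Γ a b := fun a b => by
    have h1 := covariance_eval_multivariateGaussian (μ := 0) hΓ.posSemidef a b
    rw [← hη, covariance_map (by fun_prop) (by fun_prop) hηm.aemeasurable] at h1
    exact h1
  have hXY : ∀ a b, cov[fun ω => X ω a, fun ω => L (X ω) b + η ω b; P] = Cuh a b := fun a b => by
    rw [covariance_fun_add_right (hXm a) (hLXm b) (hηM b), hXη0, add_zero, hUH]
  have hYY : ∀ a b, cov[fun ω => L (X ω) a + η ω a, fun ω => L (X ω) b + η ω b; P] =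
      (Chh + Γ) a b := fun a b => by
    rw [covariance_fun_add_left (hLXm a) (hηM a) (hYm b),
      covariance_fun_add_right (hLXm a) (hLXm b) (hηM b),
      covariance_fun_add_right (hηM a) (hLXm b) (hηM b), hLη0, covariance_comm, ← hHH,
      hηη, covariance_comm (fun ω => η ω a), hLη0, add_zero, zero_add, Matrix.add_apply, hHH, hHH,
      covariance_comm]
  have hKYm : ∀ a c, MemLp (fun ω => K a c * (L (X ω) c + η ω c)) 2 P := fun a c =>
    (hYm c).const_mul _
  -- Normal equations: this covariance is `Cuh - K * (Chh + Γ)`, which vanishes by the choice of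
  -- `K`. For a jointly Gaussian pair, vanishing correlation implies independence.
  have hZY : ∀ a b, cov[fun ω => X ω a - ∑ c, K a c * (L (X ω) c + η ω c),
      fun ω => L (X ω) b + η ω b; P] = 0 := fun a b => by
    rw [covariance_fun_sub_left (hXm a) (memLp_finsetSum _ fun c _ => hKYm a c) (hYm b), hXY,
      covariance_fun_sum_left (hKYm a) (hYm b)]
    simp only [covariance_const_mul_left, hYY]
    have : Cuh = K * (Chh + Γ) := by
      rw [hK, Matrix.mul_assoc, Matrix.nonsing_inv_mul _ hdet, Matrix.mul_one]
    rw [this, Matrix.mul_apply]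
    exact sub_self _
  refine hG.indepFun_of_covariance_inner fun x z => ?_
  have hZm : ∀ a, MemLp (fun ω => x a * (X ω a - ∑ c, K a c * (L (X ω) c + η ω c))) 2 P := fun a =>
    ((hXm a).sub (memLp_finsetSum _ fun c _ => hKYm a c)).const_mul _
  have hzYm : ∀ b, MemLp (fun ω => z b * (L (X ω) b + η ω b)) 2 P := fun b => (hYm b).const_mul _
  have hsum := covariance_fun_sum_fun_sum hZm hzYm
  simp only [covariance_const_mul_left, covariance_const_mul_right, hZY, mul_zero,
    Finset.sum_const_zero] at hsum
  rw [← hsum]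
  congr 1 <;> ext ω <;> simp [PiLp.inner_apply, Matrix.mulVec, dotProduct, mul_comm]

end Kalman

end EnKF

namespace EnKF

/-! ### Conditioning a Gaussian state on its noisy observation -/

section Kalman

variable {du dy : ℕ} {Ω : Type*} [MeasurableSpace Ω] {P : Measure Ω}

/-- The joint law of a state and its noisy observation, integrated against product functions. -/
lemma lintegral_mul_observation [IsProbabilityMeasure P] {X : Ω → Vec du} {η : Ω → Vec dy}
    (hX : Measurable X) (hηm : Measurable η) {Γ : Matrix (Fin dy) (Fin dy) ℝ} (hΓ : Γ.PosDef)
    (hη : P.map η = multivariateGaussian 0 Γ) (hXη : IndepFun X η P) {h : Vec du → Vec dy}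
    (hh : Measurable h) {F : Vec du → ENNReal} (hF : Measurable F) {G : Vec dy → ENNReal}
    (hG : Measurable G) :
    ∫⁻ ω, F (X ω) * G (h (X ω) + η ω) ∂P =
      ∫⁻ y, G y * ∫⁻ x, F x * ENNReal.ofReal (likelihood h Γ y x) ∂(P.map X) := by
  have hg := (continuous_gaussianDensity Γ).measurable
  have hjoint := (indepFun_iff_map_prod_eq_prod_map_map hX.aemeasurable hηm.aemeasurable).1 hXη
  have : IsProbabilityMeasure (P.map X) := Measure.isProbabilityMeasure_map hX.aemeasurable
  have h1 : ∫⁻ ω, F (X ω) * G (h (X ω) + η ω) ∂P =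
      ∫⁻ p, F p.1 * G (h p.1 + p.2) ∂(P.map fun ω => (X ω, η ω)) := by
    rw [lintegral_map (by fun_prop) (by fun_prop)]
  have h2 : ∀ x, ∫⁻ z, F x * G (h x + z) ∂(multivariateGaussian 0 Γ) =
      ∫⁻ y, G y * (F x * ENNReal.ofReal (likelihood h Γ y x)) := by
    intro x
    rw [multivariateGaussian_eq_withDensity hΓ,
      lintegral_withDensity_eq_lintegral_mul _ (by fun_prop) (by fun_prop),
      ← lintegral_sub_right_eq_self _ (h x)]
    refine lintegral_congr fun u => ?_
    simp only [Pi.mul_apply, likelihood]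
    rw [add_sub_cancel]
    ring
  rw [h1, hjoint, hη, lintegral_prod _ (by fun_prop)]
  simp only [h2]
  have hm : Measurable fun p : Vec du × Vec dy =>
      G p.2 * (F p.1 * ENNReal.ofReal (likelihood h Γ p.2 p.1)) := by
    unfold likelihood
    fun_prop
  rw [lintegral_lintegral_swap hm.aemeasurable]
  refine lintegral_congr fun y => ?_
  have hL := measurable_likelihood hh Γ y
  rw [lintegral_const_mul _ (by fun_prop)]

/-- The Kalman update: the analysis step with the optimal gain realizes conditioning of a Gaussian
law on the datum. -/
theorem map_gainStep_eq [IsProbabilityMeasure P] {X : Ω → Vec du} {η : Ω → Vec dy}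
    (hXm : Measurable X) (hX : HasGaussianLaw X P) (hηm : Measurable η)
    {Γ : Matrix (Fin dy) (Fin dy) ℝ} (hΓ : Γ.PosDef)
    (hη : P.map η = multivariateGaussian 0 Γ) (hXη : IndepFun X η P)
    (h : Vec du →ᵃ[ℝ] Vec dy) {Cuh : Matrix (Fin du) (Fin dy) ℝ}
    {Chh : Matrix (Fin dy) (Fin dy) ℝ} (hdet : IsUnit (Chh + Γ).det)
    (hUH : ∀ a b, Cuh a b = cov[fun ω => X ω a, fun ω => h (X ω) b; P])
    (hHH : ∀ a b, Chh a b = cov[fun ω => h (X ω) a, fun ω => h (X ω) b; P]) (y : Vec dy) :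
    HasGaussianLaw (fun ω => gainStep h (Cuh * (Chh + Γ)⁻¹) y (X ω) (η ω)) P ∧
    P.map (fun ω => gainStep h (Cuh * (Chh + Γ)⁻¹) y (X ω) (η ω)) =
      (∫⁻ u, ENNReal.ofReal (likelihood h Γ y u) ∂(P.map X))⁻¹ •
        (P.map X).withDensity fun u => ENNReal.ofReal (likelihood h Γ y u) := by
  set K := Cuh * (Chh + Γ)⁻¹ with hK
  set L : Vec du →L[ℝ] Vec dy := LinearMap.toContinuousLinearMap h.linear with hL
  set Kc : Vec dy →L[ℝ] Vec du := LinearMap.toContinuousLinearMap (Matrix.toEuclideanLin K)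
  have hu : ∀ u, h u = L u + h 0 := fun u => by
    have := h.map_vadd 0 u
    rwa [vadd_eq_add, add_zero, vadd_eq_add] at this
  have huX : ∀ ω, h (X ω) = L (X ω) + h 0 := fun ω => hu (X ω)
  have hhc : Continuous h := by
    have : ⇑h = fun u => L u + h 0 := funext hu
    rw [this]; fun_prop
  have hhm : Measurable h := hhc.measurable
  have hPX : IsProbabilityMeasure (P.map X) := Measure.isProbabilityMeasure_map hXm.aemeasurable
  have hLXi : ∀ b, Integrable (fun ω => L (X ω) b) P := fun b =>
    (hX.map_fun ((EuclideanSpace.proj b : Vec dy →L[ℝ] ℝ) ∘L L)).integrable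
  -- The constant `h 0` does not affect covariances, so the regression may be done with the linear
  -- part.
  have hUH' : ∀ a b, Cuh a b = cov[fun ω => X ω a, fun ω => h.linear (X ω) b; P] := fun a b => by
    rw [hUH]
    refine Eq.trans ?_ (covariance_add_const_right (X := fun ω => X ω a) (hLXi b) (h 0 b))
    simp only [huX]
    rfl
  have hHH' : ∀ a b, Chh a b = cov[fun ω => h.linear (X ω) a, fun ω => h.linear (X ω) b; P] :=
    fun a b => by
    have h1 := covariance_add_const_right (X := fun ω => L (X ω) a) (hLXi b) (h 0 b)
    have h2 := covariance_add_const_left (Y := fun ω => L (X ω) b + h 0 b) (hLXi a) (h 0 a)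
    rw [hHH]
    refine Eq.trans ?_ (h2.trans h1)
    simp only [huX]
    rfl
  obtain ⟨hG, hind⟩ := indepFun_regression_residual hX hηm hΓ hη hXη h.linear hdet hUH' hHH'
  set Z : Ω → Vec du := fun ω => X ω - Kc (L (X ω) + η ω) with hZ
  have hZm : Measurable Z := by fun_prop
  set Y : Ω → Vec dy := fun ω => h (X ω) + η ω with hY
  have hYm : Measurable Y := by fun_prop
  have hgs : ∀ ω, gainStep h K y (X ω) (η ω) = Z ω + Kc (y - h 0) := fun ω =>
    gainStep_eq_of_affine h K y (X ω) (η ω)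
  have hZY : IndepFun Z Y P := by
    have h1 := hind.comp (φ := fun z => z) (ψ := fun w => w + h 0) measurable_id (by fun_prop)
    have h2 : Y = (fun w => w + h 0) ∘ fun ω => h.linear (X ω) + η ω := by
      ext1 ω
      simp only [hY, Function.comp_apply, huX]
      change L (X ω) + h 0 + η ω = L (X ω) + η ω + h 0
      abel
    rw [h2]
    exact h1
  -- The regression read backwards: the state is the independent residual plus a function of the
  -- observation. Setting the observation equal to the datum gives precisely the analysis step.
  have hXZ : ∀ ω, X ω = Z ω + Kc (Y ω - h 0) := fun ω => by
    have : Y ω - h 0 = L (X ω) + η ω := by simp only [hY, huX]; abel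
    rw [this]
    simp [hZ]
  have hPZ : IsProbabilityMeasure (P.map Z) := Measure.isProbabilityMeasure_map hZm.aemeasurable
  refine ⟨?_, ?_⟩
  · have h1 : HasGaussianLaw Z P := hG.fst
    refine ⟨?_⟩
    have h2 := h1.isGaussian_map
    have h3 : P.map (fun ω => gainStep h K y (X ω) (η ω)) =
        (P.map Z).map fun z => z + Kc (y - h 0) := by
      rw [Measure.map_map (by fun_prop) hZm]
      congr 1
      ext1 ω
      exact hgs ω
    rw [h3]
    infer_instance
  have hLm : ∀ y, Measurable (likelihood h Γ y) := fun y => measurable_likelihood hhm Γ y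
  have hc0 := lintegral_likelihood_ne_zero hhm hΓ y (P.map X)
  have hct := lintegral_likelihood_ne_top (h := h) hΓ y (P.map X)
  set cΓ : ℝ := 1 / √((2 * Real.pi) ^ dy * Γ.det) with hcΓ
  have hL0 : ∀ y u, 0 ≤ likelihood h Γ y u := fun y u => gaussianDensity_nonneg Γ _
  have hLb : ∀ y u, |likelihood h Γ y u| ≤ cΓ := fun y u => by
    rw [abs_of_nonneg (hL0 y u)]
    exact gaussianDensity_le hΓ _
  have hLc : ∀ u, Continuous fun y => likelihood h Γ y u := fun u =>
    (continuous_gaussianDensity Γ).comp (continuous_id.sub continuous_const)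
  -- the disintegration identity, for every datum
  have key : ∀ F : BoundedContinuousFunction (Vec du) NNReal, ∀ y,
      ∫⁻ x, (F x : ENNReal) * ENNReal.ofReal (likelihood h Γ y x) ∂(P.map X) =
        (∫⁻ x, ENNReal.ofReal (likelihood h Γ y x) ∂(P.map X)) *
          ∫⁻ z, (F (z + Kc (y - h 0)) : ENNReal) ∂(P.map Z) := by
    intro F
    have hFm : Measurable fun x => (F x : ENNReal) := F.continuous.measurable.coe_nnreal_ennreal
    obtain ⟨B, hB⟩ : ∃ B : ℝ, ∀ x, |((F x : NNReal) : ℝ)| ≤ B :=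
      ⟨nndist F 0, fun x => by
        rw [NNReal.abs_eq]; exact_mod_cast BoundedContinuousFunction.NNReal.upper_bound F x⟩
    have hFr : Measurable fun x => ((F x : NNReal) : ℝ) := F.continuous.measurable.coe_nnreal_real
    set a : Vec dy → ℝ := fun y => ∫ x, (F x : ℝ) * likelihood h Γ y x ∂(P.map X) with ha
    set a₁ : Vec dy → ℝ := fun y => ∫ x, likelihood h Γ y x ∂(P.map X) with ha₁
    set b : Vec dy → ℝ := fun y => ∫ z, (F (z + Kc (y - h 0)) : ℝ) ∂(P.map Z) with hb
    have hFLb : ∀ y x, |(F x : ℝ) * likelihood h Γ y x| ≤ B * cΓ := fun y x => by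
      rw [abs_mul]
      exact mul_le_mul (hB x) (hLb y x) (abs_nonneg _) ((abs_nonneg _).trans (hB x))
    have hac : Continuous a := continuous_integral_of_bounded
      (fun y => hFr.mul (hLm y)) hFLb (fun x => (hLc x).const_mul _)
    have ha₁c : Continuous a₁ := continuous_integral_of_bounded hLm hLb hLc
    have hbc : Continuous b := by
      refine continuous_integral_of_bounded (fun y => hFr.comp (by fun_prop)) (fun y z => hB _)
        fun z => ?_
      exact (NNReal.continuous_coe.comp F.continuous).comp (by fun_prop)
    have hae : ∀ y, ENNReal.ofReal (a y) =
        ∫⁻ x, (F x : ENNReal) * ENNReal.ofReal (likelihood h Γ y x) ∂(P.map X) := fun y => by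
      refine (ofReal_integral_of_bounded (f := fun x => (F x : ℝ) * likelihood h Γ y x)
        (hFr.mul (hLm y)) (fun x => mul_nonneg (F x).coe_nonneg (hL0 y x)) (hFLb y)).trans ?_
      refine lintegral_congr fun x => ?_
      rw [ENNReal.ofReal_mul (F x).coe_nonneg, ENNReal.ofReal_coe_nnreal]
    have ha₁e : ∀ y, ENNReal.ofReal (a₁ y) =
        ∫⁻ x, ENNReal.ofReal (likelihood h Γ y x) ∂(P.map X) := fun y =>
      ofReal_integral_of_bounded (hLm y) (hL0 y) (hLb y)
    have hbe : ∀ y, ENNReal.ofReal (b y) =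
        ∫⁻ z, (F (z + Kc (y - h 0)) : ENNReal) ∂(P.map Z) := fun y => by
      refine (ofReal_integral_of_bounded (f := fun z => (F (z + Kc (y - h 0)) : ℝ))
        (hFr.comp (by fun_prop)) (fun z => (F _).coe_nonneg) (fun z => hB _)).trans ?_
      refine lintegral_congr fun z => ?_
      exact ENNReal.ofReal_coe_nnreal
    have ha0 : ∀ y, 0 ≤ a y := fun y =>
      integral_nonneg fun x => mul_nonneg (F x).coe_nonneg (hL0 y x)
    have ha₁0 : ∀ y, 0 ≤ a₁ y := fun y => integral_nonneg fun x => hL0 y x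
    have hb0 : ∀ y, 0 ≤ b y := fun y => integral_nonneg fun z => (F _).coe_nonneg
    -- The expectation of `F X` on the event that `Y` lies in `s` is computed twice: from the joint
    -- density of state and observation, and from the independence of `Z` and `Y`. As `s` is
    -- arbitrary, the integrands agree for almost every `y`.
    have hab : ∀ᵐ y, ENNReal.ofReal (a y) = ENNReal.ofReal (a₁ y * b y) := by
      refine ae_eq_of_forall_setLIntegral_eq_of_sigmaFinite (by fun_prop) (by fun_prop)
        fun s hs _ => ?_
      have hGm : Measurable (s.indicator (1 : Vec dy → ENNReal)) := measurable_one.indicator hs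
      have h1 := lintegral_mul_observation hXm hηm hΓ hη hXη hhm hFm hGm
      have hPY : ∀ G : Vec dy → ENNReal, Measurable G →
          ∫⁻ y, G y ∂(P.map Y) = ∫⁻ y, G y * ENNReal.ofReal (a₁ y) := fun G hGm => by
        have h3 := lintegral_mul_observation hXm hηm hΓ hη hXη hhm measurable_one hGm
        simp only [Pi.one_apply, one_mul, ← ha₁e] at h3
        rw [lintegral_map hGm hYm]
        exact h3
      have hjoint := (indepFun_iff_map_prod_eq_prod_map_map hYm.aemeasurable hZm.aemeasurable).1
        hZY.symm
      have hFGm : Measurable fun p : Vec dy × Vec du =>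
          (F (p.2 + Kc (p.1 - h 0)) : ENNReal) * s.indicator 1 p.1 :=
        Measurable.mul (hFm.comp (by fun_prop)) (hGm.comp measurable_fst)
      have h4 : ∫⁻ ω, (F (X ω) : ENNReal) * s.indicator 1 (h (X ω) + η ω) ∂P =
          ∫⁻ p, (F (p.2 + Kc (p.1 - h 0)) : ENNReal) * s.indicator 1 p.1
            ∂(P.map fun ω => (Y ω, Z ω)) := by
        rw [lintegral_map hFGm (by fun_prop)]
        refine lintegral_congr fun ω => ?_
        have := hXZ ω
        simp only [← this]
        rfl
      have : IsProbabilityMeasure (P.map Y) := Measure.isProbabilityMeasure_map hYm.aemeasurable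
      rw [hjoint, lintegral_prod _ hFGm.aemeasurable] at h4
      have h5 : ∀ y, ∫⁻ z, (F (z + Kc (y - h 0)) : ENNReal) * s.indicator 1 y ∂(P.map Z) =
          s.indicator 1 y * ENNReal.ofReal (b y) := fun y => by
        have : Measurable fun z => (F (z + Kc (y - h 0)) : ENNReal) := hFm.comp (by fun_prop)
        rw [lintegral_mul_const _ this, ← hbe, mul_comm]
      simp only [h5] at h4
      rw [hPY (fun y => s.indicator 1 y * ENNReal.ofReal (b y)) (by fun_prop), h1] at h4
      simp only [← hae] at h4
      have h6 : ∀ (f : Vec dy → ENNReal), ∫⁻ y in s, f y = ∫⁻ y, s.indicator 1 y * f y := by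
        intro f
        rw [← lintegral_indicator hs]
        refine lintegral_congr fun y => ?_
        by_cases hy : y ∈ s <;> simp [hy]
      rw [h6, h6, h4]
      refine lintegral_congr fun y => ?_
      rw [ENNReal.ofReal_mul (ha₁0 y)]
      ring
    -- Conditioning is needed at one given datum, which is a null event for positive `dy`. Both
    -- sides are continuous in `y`, so equality almost everywhere becomes equality everywhere.
    have hab' : a = fun y => a₁ y * b y := by
      refine (Continuous.ae_eq_iff_eq volume hac (ha₁c.mul hbc)).1 ?_
      filter_upwards [hab] with y hy
      rwa [ENNReal.ofReal_eq_ofReal_iff (ha0 y) (mul_nonneg (ha₁0 y) (hb0 y))] at hy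
    intro y
    rw [← hae, ← ha₁e, ← hbe, ← ENNReal.ofReal_mul (ha₁0 y)]
    exact congrArg ENNReal.ofReal (congrFun hab' y)
  have hmapm : Measurable fun ω => gainStep h K y (X ω) (η ω) := by
    simp only [hgs]; fun_prop
  have : IsProbabilityMeasure (P.map fun ω => gainStep h K y (X ω) (η ω)) :=
    Measure.isProbabilityMeasure_map hmapm.aemeasurable
  -- Bounded continuous test functions determine a finite measure, and for these the continuity in
  -- the datum was available.
  refine ext_of_forall_lintegral_eq_of_IsFiniteMeasure fun F => ?_
  have hFm : Measurable fun x => (F x : ENNReal) := F.continuous.measurable.coe_nnreal_ennreal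
  rw [lintegral_smul_measure, lintegral_withDensity_eq_lintegral_mul _ (hLm y).ennreal_ofReal hFm,
    lintegral_map hFm hmapm]
  have h1 : ∫⁻ x, ((fun u => ENNReal.ofReal (likelihood h Γ y u)) * fun x => (F x : ENNReal)) x
      ∂(P.map X) = ∫⁻ x, (F x : ENNReal) * ENNReal.ofReal (likelihood h Γ y x) ∂(P.map X) :=
    lintegral_congr fun x => by rw [Pi.mul_apply, mul_comm]
  have h2 : Measurable fun z => (F (z + Kc (y - h 0)) : ENNReal) := hFm.comp (by fun_prop)
  rw [h1, key F y, smul_eq_mul, ← mul_assoc, ENNReal.inv_mul_cancel hc0 hct, one_mul,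
    lintegral_map h2 hZm]
  simp only [hgs]

end Kalman

end EnKF

namespace EnKF

/-! ### Independence of the inputs -/

section Independence

variable {du dy N J : ℕ} {Ω : Type*}

/-- The index set of the inputs. -/
abbrev InputIndex (N J : ℕ) : Type := Fin N ⊕ (Fin J × Fin N) ⊕ (Fin J × Fin N)

/-- The σ-algebras generated by the single inputs. -/
@[reducible] def inputSigma (J : ℕ) (u₀ : Fin N → Ω → Vec du) (ξ : ℕ → Fin N → Ω → Vec du)
    (η : ℕ → Fin N → Ω → Vec dy) : InputIndex N J → MeasurableSpace Ω :=
  Sum.elim (fun i : Fin N => MeasurableSpace.comap (u₀ i) inferInstance)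
    (Sum.elim
      (fun k : Fin J × Fin N => MeasurableSpace.comap (ξ k.1 k.2) inferInstance)
      (fun k : Fin J × Fin N => MeasurableSpace.comap (η (k.1 + 1) k.2) inferInstance))

/-- The particle to which an input belongs. -/
def InputIndex.particle : InputIndex N J → Fin N :=
  Sum.elim id (Sum.elim Prod.snd Prod.snd)

/-- The first time at which a particle depends on an input. -/
def InputIndex.time : InputIndex N J → ℕ :=
  Sum.elim (fun _ => 0) (Sum.elim (fun k => k.1 + 1) (fun k => k.1 + 1))

/-- The σ-algebra generated by a set of inputs. -/
@[reducible] def sigmaOf (u₀ : Fin N → Ω → Vec du) (ξ : ℕ → Fin N → Ω → Vec du)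
    (η : ℕ → Fin N → Ω → Vec dy) (s : Set (InputIndex N J)) : MeasurableSpace Ω :=
  ⨆ k ∈ s, inputSigma J u₀ ξ η k

variable {u₀ : Fin N → Ω → Vec du} {ξ : ℕ → Fin N → Ω → Vec du} {η : ℕ → Fin N → Ω → Vec dy}

lemma sigmaOf_mono {s t : Set (InputIndex N J)} (h : s ⊆ t) :
    sigmaOf u₀ ξ η s ≤ sigmaOf u₀ ξ η t :=
  biSup_mono h

lemma measurable_sigmaOf_init {s : Set (InputIndex N J)} {i : Fin N} (hi : Sum.inl i ∈ s) :
    Measurable[sigmaOf u₀ ξ η s] (u₀ i) :=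
  Measurable.mono (comap_measurable (u₀ i)) (le_biSup (inputSigma J u₀ ξ η) hi) le_rfl

lemma measurable_sigmaOf_state {s : Set (InputIndex N J)} {j : ℕ} (hj : j < J) {i : Fin N}
    (hi : Sum.inr (Sum.inl (⟨j, hj⟩, i)) ∈ s) : Measurable[sigmaOf u₀ ξ η s] (ξ j i) :=
  Measurable.mono (comap_measurable (ξ j i)) (le_biSup (inputSigma J u₀ ξ η) hi) le_rfl

lemma measurable_sigmaOf_obs {s : Set (InputIndex N J)} {j : ℕ} (hj : j < J) {i : Fin N}
    (hi : Sum.inr (Sum.inr (⟨j, hj⟩, i)) ∈ s) : Measurable[sigmaOf u₀ ξ η s] (η (j + 1) i) :=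
  Measurable.mono (comap_measurable (η (j + 1) i)) (le_biSup (inputSigma J u₀ ξ η) hi) le_rfl

variable [mΩ : MeasurableSpace Ω] {P : Measure Ω} {μ₀ : Measure (Vec du)}
  {S : Matrix (Fin du) (Fin du) ℝ} {Γ : Matrix (Fin dy) (Fin dy) ℝ}

lemma IsInput.inputSigma_le (hI : IsInput P μ₀ S Γ J u₀ ξ η) (k : InputIndex N J) :
    inputSigma J u₀ ξ η k ≤ mΩ := by
  rcases k with i | ⟨j, i⟩ | ⟨j, i⟩
  · exact (hI.measurable_init i).comap_le
  · exact (hI.measurable_state j j.2 i).comap_le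
  · exact (hI.measurable_obs j j.2 i).comap_le

lemma IsInput.sigmaOf_le (hI : IsInput P μ₀ S Γ J u₀ ξ η) (s : Set (InputIndex N J)) :
    sigmaOf u₀ ξ η s ≤ mΩ :=
  iSup₂_le fun k _ => hI.inputSigma_le k

/-- Functions of disjoint sets of inputs are independent. -/
lemma IsInput.indepFun (hI : IsInput P μ₀ S Γ J u₀ ξ η) {s t : Set (InputIndex N J)}
    (hst : Disjoint s t) {E F : Type*} [MeasurableSpace E] [MeasurableSpace F] {f : Ω → E}
    {g : Ω → F} (hf : Measurable[sigmaOf u₀ ξ η s] f) (hg : Measurable[sigmaOf u₀ ξ η t] g) :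
    IndepFun f g P := by
  have h := indep_iSup_of_disjoint hI.inputSigma_le hI.indep hst
  rw [IndepFun_iff_Indep]
  exact indep_of_indep_of_le_left (indep_of_indep_of_le_right h hg.comap_le) hf.comap_le

lemma measurable_gainStep {h : Vec du → Vec dy} (hh : Continuous h)
    (K : Matrix (Fin du) (Fin dy) ℝ) (y : Vec dy) :
    Measurable fun p : Vec du × Vec dy => gainStep h K y p.1 p.2 := by
  have : Continuous fun w : Vec dy => (WithLp.toLp 2 (K.mulVec w.ofLp) : Vec du) :=
    (LinearMap.toContinuousLinearMap (Matrix.toEuclideanLin K)).continuous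
  unfold gainStep
  have h2 : Continuous fun p : Vec du × Vec dy =>
      p.1 + (WithLp.toLp 2 (K.mulVec (y - (h p.1 + p.2)).ofLp) : Vec du) :=
    continuous_fst.add (this.comp (by fun_prop))
  exact h2.measurable

/-- The inputs on which particle `i` depends at time `j`. -/
def pastOf (J : ℕ) (i : Fin N) (j : ℕ) : Set (InputIndex N J) :=
  {k | k.particle = i ∧ k.time ≤ j}

/-- The inputs on which the predicted particle `i` depends at time `j`. -/
def predPastOf (J : ℕ) (i : Fin N) (j : ℕ) : Set (InputIndex N J) :=
  pastOf J i j ∪ {k | ∃ hj : j < J, k = Sum.inr (Sum.inl (⟨j, hj⟩, i))}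

omit mΩ in
lemma measurable_meanField {Ψ₀ : Vec du → Vec du} (hΨ₀ : Continuous Ψ₀) {h : Vec du → Vec dy}
    (hh : Continuous h) (K : ℕ → Matrix (Fin du) (Fin dy) ℝ) (y : ℕ → Vec dy) (i : Fin N) (j : ℕ)
    (hj : j ≤ J) : Measurable[sigmaOf u₀ ξ η (pastOf J i j)]
      fun ω => meanField Ψ₀ h K y (u₀ i ω) (fun k => ξ k i ω) (fun k => η k i ω) j := by
  induction j with
  | zero => exact measurable_sigmaOf_init ⟨rfl, le_rfl⟩
  | succ j ih =>
    have hjJ : j < J := hj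
    have h1 := Measurable.mono (ih hjJ.le) (sigmaOf_mono (u₀ := u₀) (ξ := ξ) (η := η)
      (s := pastOf J i j) (t := pastOf J i (j + 1)) fun k hk => ⟨hk.1, hk.2.trans (Nat.le_succ j)⟩)
      le_rfl
    have h2 : Measurable[sigmaOf u₀ ξ η (pastOf J i (j + 1))] (ξ j i) :=
      measurable_sigmaOf_state hjJ ⟨rfl, le_rfl⟩
    have h3 : Measurable[sigmaOf u₀ ξ η (pastOf J i (j + 1))] (η (j + 1) i) :=
      measurable_sigmaOf_obs hjJ ⟨rfl, le_rfl⟩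
    have hΨm := hΨ₀.measurable
    exact (measurable_gainStep hh (K j) (y (j + 1))).comp
      (((hΨm.comp h1).add h2).prodMk h3)

omit mΩ in
lemma measurable_meanFieldPred {Ψ₀ : Vec du → Vec du} (hΨ₀ : Continuous Ψ₀)
    {h : Vec du → Vec dy} (hh : Continuous h) (K : ℕ → Matrix (Fin du) (Fin dy) ℝ)
    (y : ℕ → Vec dy) (i : Fin N) {j : ℕ} (hj : j < J) :
    Measurable[sigmaOf u₀ ξ η (predPastOf J i j)]
      fun ω => meanFieldPred Ψ₀ h K y (u₀ i ω) (fun k => ξ k i ω) (fun k => η k i ω) j := by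
  have h1 := Measurable.mono (measurable_meanField (u₀ := u₀) (ξ := ξ) (η := η) hΨ₀ hh K y i j hj.le)
    (sigmaOf_mono (t := predPastOf J i j) Set.subset_union_left) le_rfl
  have h2 : Measurable[sigmaOf u₀ ξ η (predPastOf J i j)] (ξ j i) :=
    measurable_sigmaOf_state hj (Or.inr ⟨hj, rfl⟩)
  exact (hΨ₀.measurable.comp h1).add h2

lemma predPastOf_subset (i : Fin N) (j : ℕ) :
    predPastOf J i j ⊆ {k | k.particle = i} := by
  rintro k (hk | ⟨hj, rfl⟩)
  · exact hk.1
  · rfl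

/-- The noise with index `j` carries time `j + 1`, so it has not yet been used by the particle at
time `j`. -/
lemma disjoint_pastOf_state (i : Fin N) {j : ℕ} (hj : j < J) :
    Disjoint (pastOf J i j) {Sum.inr (Sum.inl (⟨j, hj⟩, i))} := by
  rw [Set.disjoint_singleton_right]
  rintro ⟨-, h⟩
  exact absurd h (by simp [InputIndex.time])

lemma disjoint_predPastOf_obs (i : Fin N) {j : ℕ} (hj : j < J) :
    Disjoint (predPastOf J i j) {Sum.inr (Sum.inr (⟨j, hj⟩, i))} := by
  rw [Set.disjoint_singleton_right]
  rintro (⟨-, h⟩ | ⟨_, h⟩)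
  · exact absurd h (by simp [InputIndex.time])
  · simp at h

/-- Sums over a set of particles are independent of a further particle. -/
lemma IsInput.indepFun_sum (hI : IsInput P μ₀ S Γ J u₀ ξ η) {X : Fin N → Ω → ℝ}
    (hX : ∀ i, Measurable[sigmaOf u₀ ξ η {k : InputIndex N J | k.particle = i}] (X i))
    (s : Finset (Fin N)) {a : Fin N} (ha : a ∉ s) :
    IndepFun (fun ω => ∑ i ∈ s, X i ω) (X a) P := by
  refine hI.indepFun (s := {k | k.particle ∈ s}) (t := {k | k.particle = a}) ?_ ?_ (hX a)
  · rw [Set.disjoint_left]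
    rintro k hk rfl
    exact ha hk
  · exact Finset.measurable_fun_sum s fun i hi => Measurable.mono (hX i)
      (sigmaOf_mono fun k hk => by
        have : k.particle = i := hk
        simpa [this] using hi) le_rfl

end Independence

/-! ### Moments of sums of independent centered variables -/

section Fluctuations

variable {Ω : Type*} [MeasurableSpace Ω] {P : Measure Ω}

lemma memLp_four_integrable_pow [IsFiniteMeasure P] {X : Ω → ℝ} (hX : MemLp X 4 P) {k : ℕ}
    (hk : k ≤ 4) : Integrable (fun ω => X ω ^ k) P := by
  rcases Nat.eq_zero_or_pos k with rfl | hk0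
  · simp
  have h1 : MemLp X (k : ENNReal) P := hX.mono_exponent (by exact_mod_cast hk)
  have h2 := h1.integrable_norm_pow hk0.ne'
  exact h2.mono (hX.1.pow k) (ae_of_all _ fun ω => by simp)

/-- Induction on the index set. After expanding the power, every cross term with a first power of
one factor vanishes by independence and centering. The fourth moment closes because `3 * n ^ 2 + 6 *
n + 1 ≤ 3 * (n + 1) ^ 2`. -/
lemma integral_sum_pow_le [IsProbabilityMeasure P] {ι : Type*} {X : ι → Ω → ℝ} {b : ℝ}
    (hb : 0 ≤ b) (hX : ∀ i, MemLp (X i) 4 P) (h0 : ∀ i, ∫ ω, X i ω ∂P = 0)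
    (h2 : ∀ i, ∫ ω, X i ω ^ 2 ∂P ≤ b) (h4 : ∀ i, ∫ ω, X i ω ^ 4 ∂P ≤ b ^ 2)
    (hind : ∀ (s : Finset ι) (a : ι), a ∉ s → IndepFun (fun ω => ∑ i ∈ s, X i ω) (X a) P)
    (s : Finset ι) :
    ∫ ω, (∑ i ∈ s, X i ω) ^ 2 ∂P ≤ s.card * b ∧
      ∫ ω, (∑ i ∈ s, X i ω) ^ 4 ∂P ≤ 3 * (s.card : ℝ) ^ 2 * b ^ 2 := by
  classical
  induction s using Finset.induction_on with
  | empty => simp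
  | insert a s ha ih =>
    obtain ⟨ih2, ih4⟩ := ih
    set T : Ω → ℝ := fun ω => ∑ i ∈ s, X i ω with hT
    have hTm : MemLp T 4 P := memLp_finsetSum s fun i _ => hX i
    have hi := hind s a ha
    have hTi : ∀ {k : ℕ}, k ≤ 4 → Integrable (fun ω => T ω ^ k) P := memLp_four_integrable_pow hTm
    have hXi : ∀ {k : ℕ}, k ≤ 4 → Integrable (fun ω => X a ω ^ k) P :=
      memLp_four_integrable_pow (hX a)
    have hpow : ∀ k l : ℕ, IndepFun (fun ω => T ω ^ k) (fun ω => X a ω ^ l) P := fun k l =>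
      hi.comp (measurable_id.pow_const k) (measurable_id.pow_const l)
    have hprod : ∀ {k l : ℕ}, k ≤ 4 → l ≤ 4 → Integrable (fun ω => T ω ^ k * X a ω ^ l) P :=
      fun hk hl => (hpow _ _).integrable_mul (hTi hk) (hXi hl)
    have hmul : ∀ {k l : ℕ}, k ≤ 4 → l ≤ 4 →
        ∫ ω, T ω ^ k * X a ω ^ l ∂P = (∫ ω, T ω ^ k ∂P) * ∫ ω, X a ω ^ l ∂P := fun hk hl =>
      (hpow _ _).integral_fun_mul_eq_mul_integral (hTi hk).1 (hXi hl).1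
    have hT0 : ∫ ω, T ω ^ 1 ∂P = 0 := by
      simp only [pow_one, hT]
      rw [integral_finsetSum s fun i _ => (hX i).integrable (by norm_num)]
      simp [h0]
    have hX0 : ∫ ω, X a ω ^ 1 ∂P = 0 := by simpa using h0 a
    have hsum : ∀ ω, ∑ i ∈ insert a s, X i ω = T ω + X a ω := fun ω => by
      rw [Finset.sum_insert ha, add_comm]
    have hT2 : 0 ≤ ∫ ω, T ω ^ 2 ∂P := integral_nonneg fun ω => by positivity
    have hX2 : 0 ≤ ∫ ω, X a ω ^ 2 ∂P := integral_nonneg fun ω => by positivity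
    simp only [hsum, Finset.card_insert_of_notMem ha]
    push_cast
    constructor
    · have he : ∀ ω, (T ω + X a ω) ^ 2 = T ω ^ 2 + 2 * (T ω ^ 1 * X a ω ^ 1) + X a ω ^ 2 :=
        fun ω => by ring
      have i1 : Integrable (fun ω => T ω ^ 2) P := hTi (by norm_num)
      have i2 : Integrable (fun ω => 2 * (T ω ^ 1 * X a ω ^ 1)) P :=
        (hprod (by norm_num) (by norm_num)).const_mul 2
      have i12 : Integrable (fun ω => T ω ^ 2 + 2 * (T ω ^ 1 * X a ω ^ 1)) P := i1.add i2
      simp only [he]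
      rw [integral_add i12 (hXi (by norm_num)), integral_add i1 i2, integral_const_mul,
        hmul (by norm_num) (by norm_num), hT0]
      linarith [h2 a]
    · have he : ∀ ω, (T ω + X a ω) ^ 4 = T ω ^ 4 + 4 * (T ω ^ 3 * X a ω ^ 1) +
          6 * (T ω ^ 2 * X a ω ^ 2) + 4 * (T ω ^ 1 * X a ω ^ 3) + X a ω ^ 4 :=
        fun ω => by ring
      have i1 : Integrable (fun ω => T ω ^ 4) P := hTi (by norm_num)
      have i2 : Integrable (fun ω => 4 * (T ω ^ 3 * X a ω ^ 1)) P :=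
        (hprod (by norm_num) (by norm_num)).const_mul 4
      have i3 : Integrable (fun ω => 6 * (T ω ^ 2 * X a ω ^ 2)) P :=
        (hprod (by norm_num) (by norm_num)).const_mul 6
      have i4 : Integrable (fun ω => 4 * (T ω ^ 1 * X a ω ^ 3)) P :=
        (hprod (by norm_num) (by norm_num)).const_mul 4
      have i12 : Integrable (fun ω => T ω ^ 4 + 4 * (T ω ^ 3 * X a ω ^ 1)) P := i1.add i2
      have i123 : Integrable (fun ω => T ω ^ 4 + 4 * (T ω ^ 3 * X a ω ^ 1) +
        6 * (T ω ^ 2 * X a ω ^ 2)) P := i12.add i3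
      have i1234 : Integrable (fun ω => T ω ^ 4 + 4 * (T ω ^ 3 * X a ω ^ 1) +
        6 * (T ω ^ 2 * X a ω ^ 2) + 4 * (T ω ^ 1 * X a ω ^ 3)) P := i123.add i4
      simp only [he]
      rw [integral_add i1234 (hXi (by norm_num)), integral_add i123 i4, integral_add i12 i3,
        integral_add i1 i2, integral_const_mul, integral_const_mul, integral_const_mul,
        hmul (by norm_num) (by norm_num), hmul (by norm_num) (by norm_num),
        hmul (by norm_num) (by norm_num), hT0, hX0]
      have h5 : (∫ ω, T ω ^ 2 ∂P) * ∫ ω, X a ω ^ 2 ∂P ≤ (s.card * b) * b :=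
        mul_le_mul ih2 (h2 a) hX2 (by positivity)
      have h6 : 0 ≤ b ^ 2 := by positivity
      linarith [h4 a]

end Fluctuations

end EnKF

namespace EnKF

/-! ### The mean-field particles realize the filter of the affine Gaussian model -/

section Kalman

open scoped Matrix.Norms.L2Operator

universe w

variable {du dy N J : ℕ}

/-- The law of the pairs `(u, 0)`, where `u` has the law predicted by the filter at time `j`. -/
noncomputable def filterPred (Ψ₀ : Vec du → Vec du) (h : Vec du → Vec dy)
    (S : Matrix (Fin du) (Fin du) ℝ) (Γ : Matrix (Fin dy) (Fin dy) ℝ) (y : ℕ → Vec dy)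
    (μ₀ : Measure (Vec du)) (j : ℕ) : Measure (Vec du × Vec dy) :=
  (predLaw Ψ₀ S (trueFilter Ψ₀ h S Γ y μ₀ j)).map fun u => (u, 0)

/-- The gains computed from the filtering distributions. -/
noncomputable def filterGain (Ψ₀ : Vec du → Vec du) (h : Vec du → Vec dy)
    (S : Matrix (Fin du) (Fin du) ℝ) (Γ : Matrix (Fin dy) (Fin dy) ℝ) (y : ℕ → Vec dy)
    (μ₀ : Measure (Vec du)) (j : ℕ) : Matrix (Fin du) (Fin dy) ℝ :=
  gain h Γ (filterPred Ψ₀ h S Γ y μ₀ j)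

lemma continuous_affine {n k : ℕ} (f : Vec n →ᵃ[ℝ] Vec k) : Continuous f :=
  AffineMap.continuous_of_finiteDimensional f

lemma hasGaussianLaw_affine {Ω : Type*} [MeasurableSpace Ω] {P : Measure Ω} {n k : ℕ}
    {X : Ω → Vec n} (hX : HasGaussianLaw X P) (f : Vec n →ᵃ[ℝ] Vec k) :
    HasGaussianLaw (fun ω => f (X ω)) P := by
  have h1 := hX.map_fun (LinearMap.toContinuousLinearMap f.linear)
  have hu : ∀ u, f u = LinearMap.toContinuousLinearMap f.linear u + f 0 := fun u => by
    have := f.map_vadd 0 u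
    rwa [vadd_eq_add, add_zero, vadd_eq_add] at this
  have h2 := h1.isGaussian_map
  have : IsProbabilityMeasure P := hX.isProbabilityMeasure
  refine ⟨?_⟩
  have h3 : P.map (fun ω => f (X ω)) =
      (P.map fun ω => LinearMap.toContinuousLinearMap f.linear (X ω)).map (· + f 0) := by
    rw [AEMeasurable.map_map_of_aemeasurable (by fun_prop) h1.aemeasurable]
    congr 1
    funext ω
    exact hu (X ω)
  rw [h3]
  infer_instance

variable {Ω : Type w} [mΩ : MeasurableSpace Ω] {P : Measure Ω} [IsProbabilityMeasure P]
  {μ₀ : Measure (Vec du)} {S : Matrix (Fin du) (Fin du) ℝ} {Γ : Matrix (Fin dy) (Fin dy) ℝ}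
  {u₀ : Fin N → Ω → Vec du} {ξ : ℕ → Fin N → Ω → Vec du} {η : ℕ → Fin N → Ω → Vec dy}

lemma IsInput.map_pred (hI : IsInput P μ₀ S Γ J u₀ ξ η) {Ψ : Vec du → Vec du}
    (hΨ : Measurable Ψ) {i : Fin N} {j : ℕ} (hj : j < J) {V : Ω → Vec du}
    (hV : Measurable[sigmaOf u₀ ξ η (pastOf J i j)] V) :
    P.map (fun ω => Ψ (V ω) + ξ j i ω) = predLaw Ψ S (P.map V) := by
  have hind : IndepFun V (ξ j i) P := hI.indepFun (disjoint_pastOf_state i hj) hV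
    (measurable_sigmaOf_state hj rfl)
  have hVm : Measurable V := hV.mono (hI.sigmaOf_le _) le_rfl
  have hξm := hI.measurable_state j hj i
  have h1 := (indepFun_iff_map_prod_eq_prod_map_map hVm.aemeasurable hξm.aemeasurable).1 hind
  rw [predLaw, ← hI.law_state j hj i, ← h1, Measure.map_map (by fun_prop) (hVm.prodMk hξm)]
  rfl

variable {h : Vec du →ᵃ[ℝ] Vec dy} {Ψ₀ : Vec du →ᵃ[ℝ] Vec du} {y : ℕ → Vec dy}

-- The gain reads only the state, so the second component of `filterPred` may be zero, and the
-- covariances can be computed from any random vector with the predicted law.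
omit [IsProbabilityMeasure P] in
lemma covUH_filterPred {X : Ω → Vec du} (hX : Measurable X) {j : ℕ}
    (hlaw : P.map X = predLaw Ψ₀ S (trueFilter Ψ₀ h S Γ y μ₀ j)) (a : Fin du) (b : Fin dy) :
    covUH h (filterPred Ψ₀ h S Γ y μ₀ j) a b = cov[fun ω => X ω a, fun ω => h (X ω) b; P] := by
  have hh := continuous_affine h
  have hm : Measurable fun u : Vec du => (u, (0 : Vec dy)) := by fun_prop
  rw [filterPred, ← hlaw, Measure.map_map hm hX]
  exact covariance_map_fun (Continuous.aestronglyMeasurable (by fun_prop))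
    (Continuous.aestronglyMeasurable (by fun_prop)) (hm.comp hX).aemeasurable

omit [IsProbabilityMeasure P] in
lemma covHH_filterPred {X : Ω → Vec du} (hX : Measurable X) {j : ℕ}
    (hlaw : P.map X = predLaw Ψ₀ S (trueFilter Ψ₀ h S Γ y μ₀ j)) (a b : Fin dy) :
    covHH h (filterPred Ψ₀ h S Γ y μ₀ j) a b =
      cov[fun ω => h (X ω) a, fun ω => h (X ω) b; P] := by
  have hh := continuous_affine h
  have hm : Measurable fun u : Vec du => (u, (0 : Vec dy)) := by fun_prop
  rw [filterPred, ← hlaw, Measure.map_map hm hX]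
  exact covariance_map_fun (Continuous.aestronglyMeasurable (by fun_prop))
    (Continuous.aestronglyMeasurable (by fun_prop)) (hm.comp hX).aemeasurable

lemma covHH_filterPred_posSemidef {X : Ω → Vec du} (hX : Measurable X)
    (hG : HasGaussianLaw X P) {j : ℕ}
    (hlaw : P.map X = predLaw Ψ₀ S (trueFilter Ψ₀ h S Γ y μ₀ j)) :
    (covHH h (filterPred Ψ₀ h S Γ y μ₀ j)).PosSemidef := by
  have hh := continuous_affine h
  have hm : Measurable fun u : Vec du => (u, (0 : Vec dy)) := by fun_prop
  have hc : ∀ b, Continuous fun p : Vec du × Vec dy => h p.1 b := fun b => by fun_prop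
  have he : filterPred Ψ₀ h S Γ y μ₀ j = P.map fun ω => (X ω, (0 : Vec dy)) := by
    rw [filterPred, ← hlaw, Measure.map_map hm hX]
    rfl
  have hXm : Measurable fun ω => (X ω, (0 : Vec dy)) := hm.comp hX
  have := Measure.isProbabilityMeasure_map (μ := P) hXm.aemeasurable
  rw [he]
  refine covHH_posSemidef fun b => ?_
  rw [memLp_map_measure_iff (hc b).aestronglyMeasurable hXm.aemeasurable]
  exact ((hasGaussianLaw_affine hG h).map_fun (EuclideanSpace.proj b : Vec dy →L[ℝ] ℝ)).memLp_two

/-- Induction in time. Prediction adds an independent Gaussian noise to an affine image of a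
Gaussian; the analysis step uses the gain of that very predicted law, so it performs the Bayesian
update. Gaussianity is carried along because the update is exact only for Gaussian laws of the
state. -/
lemma IsInput.meanField_law (hI : IsInput P μ₀ S Γ J u₀ ξ η) (hS : S.PosDef) (hΓ : Γ.PosDef)
    (hμ₀ : IsGaussian μ₀) (h : Vec du →ᵃ[ℝ] Vec dy) (Ψ₀ : Vec du →ᵃ[ℝ] Vec du)
    (y : ℕ → Vec dy) (i : Fin N) (j : ℕ) (hj : j ≤ J) :
    HasGaussianLaw (fun ω => meanField Ψ₀ h (filterGain Ψ₀ h S Γ y μ₀) y (u₀ i ω)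
      (fun k => ξ k i ω) (fun k => η k i ω) j) P ∧
    P.map (fun ω => meanField Ψ₀ h (filterGain Ψ₀ h S Γ y μ₀) y (u₀ i ω)
      (fun k => ξ k i ω) (fun k => η k i ω) j) = trueFilter Ψ₀ h S Γ y μ₀ j ∧
    (∀ _ : j < J, HasGaussianLaw (fun ω => meanFieldPred Ψ₀ h (filterGain Ψ₀ h S Γ y μ₀) y
        (u₀ i ω) (fun k => ξ k i ω) (fun k => η k i ω) j) P ∧
      P.map (fun ω => meanFieldPred Ψ₀ h (filterGain Ψ₀ h S Γ y μ₀) y (u₀ i ω)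
        (fun k => ξ k i ω) (fun k => η k i ω) j) =
        predLaw Ψ₀ S (trueFilter Ψ₀ h S Γ y μ₀ j)) := by
  have hhc := continuous_affine h
  have hΨc := continuous_affine Ψ₀
  -- The prediction half is separated because it serves both the induction step and the final claim
  -- at time `j`.
  have hpred : ∀ j, ∀ hj : j < J,
      HasGaussianLaw (fun ω => meanField Ψ₀ h (filterGain Ψ₀ h S Γ y μ₀) y (u₀ i ω)
        (fun k => ξ k i ω) (fun k => η k i ω) j) P →
      P.map (fun ω => meanField Ψ₀ h (filterGain Ψ₀ h S Γ y μ₀) y (u₀ i ω)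
        (fun k => ξ k i ω) (fun k => η k i ω) j) = trueFilter Ψ₀ h S Γ y μ₀ j →
      HasGaussianLaw (fun ω => meanFieldPred Ψ₀ h (filterGain Ψ₀ h S Γ y μ₀) y
        (u₀ i ω) (fun k => ξ k i ω) (fun k => η k i ω) j) P ∧
      P.map (fun ω => meanFieldPred Ψ₀ h (filterGain Ψ₀ h S Γ y μ₀) y (u₀ i ω)
        (fun k => ξ k i ω) (fun k => η k i ω) j) =
        predLaw Ψ₀ S (trueFilter Ψ₀ h S Γ y μ₀ j) := by
    intro j hj hG hl
    have hVm := measurable_meanField (u₀ := u₀) (ξ := ξ) (η := η) hΨc hhc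
      (filterGain Ψ₀ h S Γ y μ₀) y i j hj.le
    have hmap := hI.map_pred hΨc.measurable hj hVm
    rw [hl] at hmap
    refine ⟨?_, hmap⟩
    have hξ : HasGaussianLaw (ξ j i) P := by
      refine ⟨?_⟩
      rw [hI.law_state j hj i]
      infer_instance
    have hind := hI.indepFun (disjoint_pastOf_state i hj) hVm (measurable_sigmaOf_state hj rfl)
    have hind' : IndepFun (fun ω => Ψ₀ (meanField Ψ₀ h (filterGain Ψ₀ h S Γ y μ₀) y (u₀ i ω)
        (fun k => ξ k i ω) (fun k => η k i ω) j)) (ξ j i) P :=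
      hind.comp hΨc.measurable measurable_id
    exact (hind'.hasGaussianLaw (hasGaussianLaw_affine hG Ψ₀) hξ).fun_add
  have hmain : HasGaussianLaw (fun ω => meanField Ψ₀ h (filterGain Ψ₀ h S Γ y μ₀) y (u₀ i ω)
      (fun k => ξ k i ω) (fun k => η k i ω) j) P ∧
    P.map (fun ω => meanField Ψ₀ h (filterGain Ψ₀ h S Γ y μ₀) y (u₀ i ω)
      (fun k => ξ k i ω) (fun k => η k i ω) j) = trueFilter Ψ₀ h S Γ y μ₀ j := by
    induction j with
    | zero =>
      refine ⟨⟨?_⟩, hI.law_init i⟩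
      change IsGaussian (P.map (u₀ i))
      rw [hI.law_init i]
      exact hμ₀
    | succ j ih =>
      have hjJ : j < J := hj
      obtain ⟨hG, hl⟩ := ih hjJ.le
      obtain ⟨hGp, hlp⟩ := hpred j hjJ hG hl
      have hXm' := measurable_meanFieldPred (u₀ := u₀) (ξ := ξ) (η := η) hΨc hhc
        (filterGain Ψ₀ h S Γ y μ₀) y i hjJ
      have hXm := hXm'.mono (hI.sigmaOf_le _) le_rfl
      have hind := hI.indepFun (disjoint_predPastOf_obs i hjJ) hXm' (measurable_sigmaOf_obs hjJ rfl)
      have hprob : IsProbabilityMeasure (trueFilter Ψ₀ h S Γ y μ₀ j) := by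
        rw [← hl]; exact hG.isGaussian_map.toIsProbabilityMeasure
      -- The observation noise is independent of the predicted particle, and the entries of the two
      -- matrices are the covariances of that particle, as the Kalman update requires.
      have hup := map_gainStep_eq hXm hGp (hI.measurable_obs j hjJ i) hΓ (hI.law_obs j hjJ i)
        hind h (isUnit_det_posSemidef_add (covHH_filterPred_posSemidef hXm hGp hlp) hΓ)
        (covUH_filterPred hXm hlp) (covHH_filterPred hXm hlp) (y (j + 1))
      refine ⟨hup.1, ?_⟩
      rw [trueFilter_succ hhc.measurable hΨc.measurable hS hΓ, ← hlp]
      exact hup.2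
  exact ⟨hmain.1, hmain.2, fun hj' => hpred j hj' hmain.1 hmain.2⟩

end Kalman

end EnKF

namespace EnKF

/-! ### Uniform bounds for the gains of the filter -/

section GainBound

open scoped Matrix.Norms.L2Operator

universe w

/-- Since `1 ≤ W`, the second moment of `W` also bounds its mean. The expectation of the product
contributes `C` and the product of the expectations `C ^ 2`. -/
lemma abs_covariance_le_of_abs_le {Ω : Type*} [MeasurableSpace Ω] {P : Measure Ω}
    [IsProbabilityMeasure P] {f g W : Ω → ℝ} (hf : AEStronglyMeasurable f P)
    (hg : AEStronglyMeasurable g P) (hWm : AEStronglyMeasurable W P) {a b C : ℝ}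
    (hb : 0 ≤ b) (hfW : ∀ ω, |f ω| ≤ a * W ω) (hgW : ∀ ω, |g ω| ≤ b * W ω)
    (hW1 : ∀ ω, 1 ≤ W ω) (hW : Integrable (fun ω => W ω ^ 2) P) (hC : ∫ ω, W ω ^ 2 ∂P ≤ C) :
    |cov[f, g; P]| ≤ a * b * (C + C ^ 2) := by
  have hW2 : MemLp W 2 P := (memLp_two_iff_integrable_sq hWm).2 hW
  have hW0 : ∀ ω, ‖W ω‖ = W ω := fun ω => Real.norm_of_nonneg (zero_le_one.trans (hW1 ω))
  have hf2 : MemLp f 2 P := hW2.of_le_mul hf (ae_of_all _ fun ω => by rw [hW0]; exact hfW ω)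
  have hg2 : MemLp g 2 P := hW2.of_le_mul hg (ae_of_all _ fun ω => by rw [hW0]; exact hgW ω)
  have hWi : Integrable W P := hW2.integrable (by norm_num)
  have hWle : ∫ ω, W ω ∂P ≤ C := (integral_mono hWi hW fun ω => by
    have := hW1 ω
    nlinarith).trans hC
  have hWge : 0 ≤ ∫ ω, W ω ∂P := integral_nonneg fun ω => zero_le_one.trans (hW1 ω)
  have hC0 : 0 ≤ C := hWge.trans hWle
  have hab : 0 ≤ a := by
    obtain ⟨ω⟩ : Nonempty Ω := P.nonempty_of_neZero
    have := (abs_nonneg _).trans (hfW ω)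
    exact nonneg_of_mul_nonneg_left this (zero_lt_one.trans_le (hW1 ω))
  have h1 : |∫ ω, f ω ∂P| ≤ a * C := by
    refine (abs_integral_le_integral_abs).trans
      ((integral_mono (hf2.integrable (by norm_num)).abs (hWi.const_mul a) hfW).trans ?_)
    rw [integral_const_mul]
    exact mul_le_mul_of_nonneg_left hWle hab
  have h2 : |∫ ω, g ω ∂P| ≤ b * C := by
    refine (abs_integral_le_integral_abs).trans
      ((integral_mono (hg2.integrable (by norm_num)).abs (hWi.const_mul b) hgW).trans ?_)
    rw [integral_const_mul]
    exact mul_le_mul_of_nonneg_left hWle hb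
  have h3 : |∫ ω, f ω * g ω ∂P| ≤ a * b * C := by
    refine (abs_integral_le_integral_abs).trans
      ((integral_mono (hf2.integrable_mul hg2).abs (hW.const_mul (a * b)) fun ω => ?_).trans ?_)
    · change |f ω * g ω| ≤ _
      rw [abs_mul]
      refine (mul_le_mul (hfW ω) (hgW ω) (abs_nonneg _) ((abs_nonneg _).trans (hfW ω))).trans
        (le_of_eq (by ring))
    · rw [integral_const_mul]
      exact mul_le_mul_of_nonneg_left hC (by positivity)
  rw [covariance_eq_sub hf2 hg2]
  refine (abs_sub _ _).trans ?_
  rw [abs_mul]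
  have h4 : |∫ ω, f ω ∂P| * |∫ ω, g ω ∂P| ≤ (a * C) * (b * C) :=
    mul_le_mul h1 h2 (abs_nonneg _) (by positivity)
  have h5 : |∫ ω, (f * g) ω ∂P| ≤ a * b * C := h3
  linarith

variable {du dy : ℕ}

lemma IsInput.measurable_inputSize {N J : ℕ} {Ω : Type*} [MeasurableSpace Ω] {P : Measure Ω}
    {μ₀ : Measure (Vec du)} {S : Matrix (Fin du) (Fin du) ℝ} {Γ : Matrix (Fin dy) (Fin dy) ℝ}
    {u₀ : Fin N → Ω → Vec du} {ξ : ℕ → Fin N → Ω → Vec du} {η : ℕ → Fin N → Ω → Vec dy}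
    (hI : IsInput P μ₀ S Γ J u₀ ξ η) (i : Fin N) :
    Measurable fun ω => inputSize J (u₀ i ω) (fun k => ξ k i ω) (fun k => η k i ω) := by
  unfold inputSize
  refine ((hI.measurable_init i).norm.const_add 1).add (Finset.measurable_fun_sum _ fun k hk => ?_)
  exact (hI.measurable_state k (Finset.mem_range.1 hk) i).norm.add
    (hI.measurable_obs k (Finset.mem_range.1 hk) i).norm

/-- The gains computed from the filtering distributions are uniformly bounded. -/
lemma exists_norm_filterGain_le (S : Matrix (Fin du) (Fin du) ℝ) (hS : S.PosDef)
    {Γ : Matrix (Fin dy) (Fin dy) ℝ} (hΓ : Γ.PosDef) (κy κΨ κh ℓh ℓΨ m₂ : ℝ) (J : ℕ)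
    (hκy : 0 ≤ κy) (hκΨ : 0 ≤ κΨ) (hκh : 0 ≤ κh) :
    ∃ κK : ℝ, 0 ≤ κK ∧ ∀ (N : ℕ) [NeZero N] (Ω : Type w) [MeasurableSpace Ω] (P : Measure Ω)
      [IsProbabilityMeasure P] (μ₀ : Measure (Vec du)) (u₀ : Fin N → Ω → Vec du)
      (ξ : ℕ → Fin N → Ω → Vec du) (η : ℕ → Fin N → Ω → Vec dy), IsInput P μ₀ S Γ J u₀ ξ η →
      IsGaussian μ₀ → ∫ u, ‖u‖ ^ 2 ∂μ₀ ≤ m₂ → ∀ (y : ℕ → Vec dy) (h : Vec du →ᵃ[ℝ] Vec dy)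
      (Ψ₀ : Vec du →ᵃ[ℝ] Vec du) (Ψ : Vec du → Vec du) (ε : ℝ),
      ModelBounds κy κΨ κh ℓh ℓΨ J y h Ψ₀ Ψ ε →
      ∀ k < J, ‖filterGain Ψ₀ h S Γ y μ₀ k‖ ≤ κK := by
  obtain ⟨C, hC, hCb⟩ := exists_integral_inputSize_pow_le.{w} (du := du) (dy := dy) S Γ J m₂ 2
  obtain ⟨c, hc, hcΓ⟩ := exists_pos_mul_sq_le hΓ
  -- The gain at time `j` is a covariance of the mean-field particle, whose size depends on the
  -- earlier gains. Hence the induction carries a bound for all gains before `j`.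
  suffices H : ∀ j : ℕ, ∃ κK : ℝ, 0 ≤ κK ∧ (j ≤ J → ∀ (N : ℕ) [NeZero N] (Ω : Type w)
      [MeasurableSpace Ω] (P : Measure Ω)
      [IsProbabilityMeasure P] (μ₀ : Measure (Vec du)) (u₀ : Fin N → Ω → Vec du)
      (ξ : ℕ → Fin N → Ω → Vec du) (η : ℕ → Fin N → Ω → Vec dy), IsInput P μ₀ S Γ J u₀ ξ η →
      IsGaussian μ₀ → ∫ u, ‖u‖ ^ 2 ∂μ₀ ≤ m₂ → ∀ (y : ℕ → Vec dy) (h : Vec du →ᵃ[ℝ] Vec dy)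
      (Ψ₀ : Vec du →ᵃ[ℝ] Vec du) (Ψ : Vec du → Vec du) (ε : ℝ),
      ModelBounds κy κΨ κh ℓh ℓΨ J y h Ψ₀ Ψ ε →
      ∀ k < j, ‖filterGain Ψ₀ h S Γ y μ₀ k‖ ≤ κK) by
    obtain ⟨κK, h0, h1⟩ := H J
    exact ⟨κK, h0, h1 le_rfl⟩
  intro j
  induction j with
  | zero => exact ⟨0, le_rfl, fun _ => by simp⟩
  | succ j ih =>
    obtain ⟨κ, hκ, ih⟩ := ih
    obtain ⟨A, hA, hAb⟩ := exists_meanField_le (du := du) (dy := dy) κy κΨ κh ℓh ℓΨ κ J hκy hκΨ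
      hκh hκ j
    set B : ℝ := 2 + κΨ * (1 + A) with hB
    have hB0 : 0 ≤ B := by positivity
    refine ⟨max κ (du * dy * (B * (κh * (1 + B)) * (C + C ^ 2)) * c⁻¹), le_max_of_le_left hκ,
      fun hj N _ Ω _ P _ μ₀ u₀ ξ η hI hμ₀ hm y h Ψ₀ Ψ ε H k hk => ?_⟩
    have hjJ : j < J := hj
    have ihk := ih hjJ.le N Ω P μ₀ u₀ ξ η hI hμ₀ hm y h Ψ₀ Ψ ε H
    rcases Nat.lt_succ_iff_lt_or_eq.1 hk with hk | rfl
    · exact (ihk k hk).trans (le_max_left _ _)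
    refine le_max_of_le_right ?_
    -- The gain depends on the law only, so one particle suffices to represent it.
    obtain ⟨hWi, hWC⟩ := hCb N Ω P μ₀ u₀ ξ η hI hμ₀ hm 0
    obtain ⟨-, -, hlaw⟩ := hI.meanField_law hS hΓ hμ₀ h Ψ₀ y 0 k hjJ.le
    obtain ⟨hG, hlaw⟩ := hlaw hjJ
    have hhc := continuous_affine h
    have hXm := (measurable_meanFieldPred (u₀ := u₀) (ξ := ξ) (η := η) (continuous_affine Ψ₀) hhc
        (filterGain Ψ₀ h S Γ y μ₀) y 0 hjJ).mono (hI.sigmaOf_le _) le_rfl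
    set X : Ω → Vec du := fun ω => meanFieldPred Ψ₀ h (filterGain Ψ₀ h S Γ y μ₀) y
      (u₀ 0 ω) (fun k => ξ k 0 ω) (fun k => η k 0 ω) k with hX
    have hXB : ∀ ω, ‖X ω‖ ≤ B * inputSize J (u₀ 0 ω) (fun k => ξ k 0 ω) (fun k => η k 0 ω) :=
      fun ω => norm_pred_le H.reference (one_le_inputSize J _ _ _)
        (hAb hjJ.le y h Ψ₀ Ψ ε H _ ihk (u₀ 0 ω) (fun k => ξ k 0 ω) (fun k => η k 0 ω))
        (norm_state_le_inputSize (u₀ 0 ω) (fun k => ξ k 0 ω) (fun k => η k 0 ω) hjJ)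
    have hhB : ∀ ω, ‖h (X ω)‖ ≤
        κh * (1 + B) * inputSize J (u₀ 0 ω) (fun k => ξ k 0 ω) (fun k => η k 0 ω) := fun ω => by
      have h1 := one_le_inputSize J (u₀ 0 ω) (fun k => ξ k 0 ω) (fun k => η k 0 ω)
      refine (H.obs_growth _).trans ?_
      rw [mul_assoc]
      exact mul_le_mul_of_nonneg_left (by linarith [hXB ω]) hκh
    have hWm := (hI.measurable_inputSize 0).aestronglyMeasurable (μ := P)
    have hUH : ‖covUH h (filterPred Ψ₀ h S Γ y μ₀ k)‖ ≤
        du * dy * (B * (κh * (1 + B)) * (C + C ^ 2)) := by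
      refine opNorm_le_of_forall_abs_le _ fun a b => ?_
      rw [covUH_filterPred hXm hlaw]
      have hc1 : Continuous fun u : Vec du => u a := by fun_prop
      have hc2 : Continuous fun u : Vec du => h u b := by fun_prop
      exact abs_covariance_le_of_abs_le (hc1.measurable.comp hXm).aestronglyMeasurable
        (hc2.measurable.comp hXm).aestronglyMeasurable hWm (by positivity)
        (fun ω => (abs_coord_le_norm _ a).trans (hXB ω))
        (fun ω => (abs_coord_le_norm _ b).trans (hhB ω))
        (fun ω => one_le_inputSize _ _ _ _) hWi hWC
    refine (Matrix.l2_opNorm_mul _ _).trans (mul_le_mul hUH ?_ (norm_nonneg _) (by positivity))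
    exact opNorm_inv_posSemidef_add_le (covHH_filterPred_posSemidef hXm hG hlaw) hΓ hc hcΓ

end GainBound

end EnKF

namespace EnKF

/-! ### Fluctuations of averages over independent particles -/

section Averages

variable {du dy N J : ℕ} {Ω : Type*} [MeasurableSpace Ω] {P : Measure Ω} [IsProbabilityMeasure P]
  {μ₀ : Measure (Vec du)} {S : Matrix (Fin du) (Fin du) ℝ} {Γ : Matrix (Fin dy) (Fin dy) ℝ}
  {u₀ : Fin N → Ω → Vec du} {ξ : ℕ → Fin N → Ω → Vec du} {η : ℕ → Fin N → Ω → Vec dy}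

/-- Second and fourth moments of the fluctuations of an average over the particles. -/
lemma IsInput.integral_avg_sub_pow_le [NeZero N] (hI : IsInput P μ₀ S Γ J u₀ ξ η)
    {F : Fin N → Ω → ℝ}
    (hF : ∀ i, Measurable[sigmaOf u₀ ξ η {k : InputIndex N J | k.particle = i}] (F i))
    {W : Fin N → Ω → ℝ} (hWm : ∀ i, Measurable (W i)) (hW1 : ∀ i ω, 1 ≤ W i ω) {D : ℝ}
    (hWi : ∀ i, Integrable (fun ω => W i ω ^ 8) P) (hD : ∀ i, ∫ ω, W i ω ^ 8 ∂P ≤ D)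
    {a : ℝ} (ha : 0 ≤ a) (hFW : ∀ i ω, |F i ω| ≤ a * W i ω ^ 2) {c : ℝ}
    (hc : ∀ i, ∫ ω, F i ω ∂P = c) :
    Integrable (fun ω => (avg (fun i => F i ω) - c) ^ 2) P ∧
    ∫ ω, (avg (fun i => F i ω) - c) ^ 2 ∂P ≤ a ^ 2 * (1 + D) ^ 3 / N ∧
    Integrable (fun ω => (avg (fun i => F i ω) - c) ^ 4) P ∧
    ∫ ω, (avg (fun i => F i ω) - c) ^ 4 ∂P ≤ 3 * (a ^ 2 * (1 + D) ^ 3) ^ 2 / (N : ℝ) ^ 2 := by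
  have hN : (N : ℝ) ≠ 0 := Nat.cast_ne_zero.2 (NeZero.ne N)
  have hW0 : ∀ i ω, 0 ≤ W i ω := fun i ω => zero_le_one.trans (hW1 i ω)
  have hFm : ∀ i, Measurable (F i) := fun i => (hF i).mono (hI.sigmaOf_le _) le_rfl
  have hWk : ∀ i {k : ℕ}, k ≤ 8 → Integrable (fun ω => W i ω ^ k) P ∧ ∫ ω, W i ω ^ k ∂P ≤ D := by
    intro i k hk
    have hle : ∀ ω, W i ω ^ k ≤ W i ω ^ 8 := fun ω => pow_le_pow_right₀ (hW1 i ω) hk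
    have hint : Integrable (fun ω => W i ω ^ k) P :=
      (hWi i).mono ((hWm i).pow_const k).aestronglyMeasurable (ae_of_all _ fun ω => by
        rw [Real.norm_of_nonneg (pow_nonneg (hW0 i ω) _),
          Real.norm_of_nonneg (pow_nonneg (hW0 i ω) _)]
        exact hle ω)
    exact ⟨hint, (integral_mono hint (hWi i) hle).trans (hD i)⟩
  have hD0 : 0 ≤ D := (integral_nonneg fun ω => pow_nonneg (hW0 0 ω) 8).trans (hD 0)
  have hFi : ∀ i, Integrable (F i) P := fun i =>
    ((hWk i (k := 2) (by norm_num)).1.const_mul a).mono' (hFm i).aestronglyMeasurable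
      (ae_of_all _ fun ω => hFW i ω)
  have hcD : |c| ≤ a * D := by
    rw [← hc 0]
    refine abs_integral_le_integral_abs.trans ((integral_mono (hFi 0).abs
      ((hWk 0 (k := 2) (by norm_num)).1.const_mul a) (hFW 0)).trans ?_)
    rw [integral_const_mul]
    exact mul_le_mul_of_nonneg_left (hWk 0 (by norm_num)).2 ha
  set X : Fin N → Ω → ℝ := fun i ω => F i ω - c with hX
  have hXm : ∀ i, Measurable[sigmaOf u₀ ξ η {k : InputIndex N J | k.particle = i}] (X i) :=
    fun i => (hF i).sub_const c
  have hXW : ∀ i ω, |X i ω| ≤ a * (1 + D) * W i ω ^ 2 := by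
    intro i ω
    have h1 : 1 ≤ W i ω ^ 2 := one_le_pow₀ (hW1 i ω)
    have h2 : a * D ≤ a * D * W i ω ^ 2 := le_mul_of_one_le_right (by positivity) h1
    have h3 := abs_sub (F i ω) c
    have h4 := hFW i ω
    linarith
  have hXpow : ∀ i ω k, |X i ω| ^ k ≤ (a * (1 + D)) ^ k * W i ω ^ (2 * k) := fun i ω k => by
    rw [pow_mul, ← mul_pow]
    exact pow_le_pow_left₀ (abs_nonneg _) (hXW i ω) k
  -- The variables grow like `W ^ 2`, so their fourth moments need the eighth moment of `W`.
  have hX4 : ∀ i, MemLp (X i) 4 P := by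
    intro i
    have h1 := (integrable_norm_rpow_iff (μ := P) (f := X i) (p := 4)
      ((hFm i).sub_const c).aestronglyMeasurable (by norm_num) (by norm_num)).1
    refine h1 (((hWk i (k := 8) le_rfl).1.const_mul ((a * (1 + D)) ^ 4)).mono'
      (((hFm i).sub_const c).norm.pow_const _).aestronglyMeasurable (ae_of_all _ fun ω => ?_))
    have h2 := hXpow i ω 4
    have h3 : ‖X i ω‖ ^ (4 : ENNReal).toReal = |X i ω| ^ 4 := by
      rw [Real.norm_eq_abs, ← Real.rpow_natCast]
      norm_num
    rw [h3, Real.norm_of_nonneg (by positivity)]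
    exact h2
  have hX0 : ∀ i, ∫ ω, X i ω ∂P = 0 := fun i => by
    rw [integral_sub (hFi i) (integrable_const c), hc i]
    simp
  -- This constant bounds the second moments while its square bounds the fourth moments, as
  -- `integral_sum_pow_le` requires of a single `b`.
  have hb : 0 ≤ a ^ 2 * (1 + D) ^ 3 := by positivity
  have h2 : ∀ i, ∫ ω, X i ω ^ 2 ∂P ≤ a ^ 2 * (1 + D) ^ 3 := by
    intro i
    calc ∫ ω, X i ω ^ 2 ∂P ≤ ∫ ω, (a * (1 + D)) ^ 2 * W i ω ^ (2 * 2) ∂P :=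
          integral_mono (memLp_four_integrable_pow (hX4 i) (by norm_num))
            ((hWk i (by norm_num)).1.const_mul _) fun ω => by
              have := hXpow i ω 2
              rwa [sq_abs] at this
      _ ≤ (a * (1 + D)) ^ 2 * D := by
          rw [integral_const_mul]
          exact mul_le_mul_of_nonneg_left (hWk i (by norm_num)).2 (by positivity)
      _ ≤ (a * (1 + D)) ^ 2 * (1 + D) := by gcongr; linarith
      _ = _ := by ring
  have h4 : ∀ i, ∫ ω, X i ω ^ 4 ∂P ≤ (a ^ 2 * (1 + D) ^ 3) ^ 2 := by
    intro i
    calc ∫ ω, X i ω ^ 4 ∂P ≤ ∫ ω, (a * (1 + D)) ^ 4 * W i ω ^ (2 * 4) ∂P :=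
          integral_mono (memLp_four_integrable_pow (hX4 i) le_rfl)
            ((hWk i (by norm_num)).1.const_mul _) fun ω => by
              have := hXpow i ω 4
              rwa [Even.pow_abs (by decide)] at this
      _ ≤ (a * (1 + D)) ^ 4 * D := by
          rw [integral_const_mul]
          exact mul_le_mul_of_nonneg_left (hWk i (by norm_num)).2 (by positivity)
      _ ≤ (a * (1 + D)) ^ 4 * (1 + D) ^ 2 := by
          gcongr
          nlinarith
      _ = _ := by ring
  have hsum := integral_sum_pow_le hb hX4 hX0 h2 h4 (fun s i hi => hI.indepFun_sum hXm s hi)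
    Finset.univ
  rw [Finset.card_univ, Fintype.card_fin] at hsum
  have hm : MemLp (fun ω => ∑ i, X i ω) 4 P := memLp_finsetSum _ fun i _ => hX4 i
  have he : ∀ ω, avg (fun i => F i ω) - c = (N : ℝ)⁻¹ * ∑ i, X i ω := fun ω => by
    simp only [hX, avg, Finset.sum_sub_distrib, Finset.sum_const, Finset.card_univ,
      Fintype.card_fin, nsmul_eq_mul, mul_sub]
    field_simp
  simp only [he, mul_pow, integral_const_mul]
  refine ⟨(memLp_four_integrable_pow hm (by norm_num)).const_mul _, ?_,
    (memLp_four_integrable_pow hm le_rfl).const_mul _, ?_⟩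
  · calc _ ≤ ((N : ℝ)⁻¹) ^ 2 * (N * (a ^ 2 * (1 + D) ^ 3)) :=
          mul_le_mul_of_nonneg_left hsum.1 (by positivity)
      _ = _ := by field_simp
  · calc _ ≤ ((N : ℝ)⁻¹) ^ 4 * (3 * (N : ℝ) ^ 2 * (a ^ 2 * (1 + D) ^ 3) ^ 2) :=
          mul_le_mul_of_nonneg_left hsum.2 (by positivity)
      _ = _ := by field_simp

end Averages

end EnKF

namespace EnKF

/-! ### Errors of the empirical covariances of the mean-field particles -/

section CovarianceError

open scoped Matrix.Norms.L2Operator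

universe w

variable {du dy N J : ℕ}

/-- The size of the inputs of particle `i`, as a random variable. -/
noncomputable abbrev particleSize {Ω : Type*} (J : ℕ) (u₀ : Fin N → Ω → Vec du) (ξ : ℕ → Fin N → Ω → Vec du)
    (η : ℕ → Fin N → Ω → Vec dy) (i : Fin N) (ω : Ω) : ℝ :=
  inputSize J (u₀ i ω) (fun k => ξ k i ω) (fun k => η k i ω)

/-- The mean-field particles with the gains of the filter. -/
noncomputable abbrev refState {Ω : Type*} (Ψ₀ : Vec du → Vec du) (h : Vec du → Vec dy)
    (S : Matrix (Fin du) (Fin du) ℝ) (Γ : Matrix (Fin dy) (Fin dy) ℝ) (y : ℕ → Vec dy)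
    (μ₀ : Measure (Vec du)) (u₀ : Fin N → Ω → Vec du) (ξ : ℕ → Fin N → Ω → Vec du)
    (η : ℕ → Fin N → Ω → Vec dy) (j : ℕ) (i : Fin N) (ω : Ω) : Vec du :=
  meanField Ψ₀ h (filterGain Ψ₀ h S Γ y μ₀) y (u₀ i ω) (fun k => ξ k i ω) (fun k => η k i ω) j

/-- The predicted mean-field particles with the gains of the filter. -/
noncomputable abbrev refPred {Ω : Type*} (Ψ₀ : Vec du → Vec du) (h : Vec du → Vec dy)
    (S : Matrix (Fin du) (Fin du) ℝ) (Γ : Matrix (Fin dy) (Fin dy) ℝ) (y : ℕ → Vec dy)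
    (μ₀ : Measure (Vec du)) (u₀ : Fin N → Ω → Vec du) (ξ : ℕ → Fin N → Ω → Vec du)
    (η : ℕ → Fin N → Ω → Vec dy) (j : ℕ) (i : Fin N) (ω : Ω) : Vec du :=
  meanFieldPred Ψ₀ h (filterGain Ψ₀ h S Γ y μ₀) y (u₀ i ω) (fun k => ξ k i ω)
    (fun k => η k i ω) j

/-- The standing hypotheses: random inputs with a Gaussian initial law, and a model with affine
reference dynamics and affine observations. -/
structure Setting {Ω : Type w} [MeasurableSpace Ω] (P : Measure Ω) (κy κΨ κh ℓh ℓΨ m₂ : ℝ) (S : Matrix (Fin du) (Fin du) ℝ)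
    (Γ : Matrix (Fin dy) (Fin dy) ℝ) (J : ℕ) (μ₀ : Measure (Vec du)) (u₀ : Fin N → Ω → Vec du)
    (ξ : ℕ → Fin N → Ω → Vec du) (η : ℕ → Fin N → Ω → Vec dy) (y : ℕ → Vec dy)
    (h : Vec du →ᵃ[ℝ] Vec dy) (Ψ₀ : Vec du →ᵃ[ℝ] Vec du) (Ψ : Vec du → Vec du) (ε : ℝ) :
    Prop where
  input : IsInput P μ₀ S Γ J u₀ ξ η
  gaussian : IsGaussian μ₀
  moment : ∫ u, ‖u‖ ^ 2 ∂μ₀ ≤ m₂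
  bounds : ModelBounds κy κΨ κh ℓh ℓΨ J y h Ψ₀ Ψ ε

lemma one_le_rms_particleSize {Ω : Type*} [NeZero N] (u₀ : Fin N → Ω → Vec du) (ξ : ℕ → Fin N → Ω → Vec du)
    (η : ℕ → Fin N → Ω → Vec dy) (ω : Ω) : 1 ≤ rms fun i => particleSize J u₀ ξ η i ω := by
  have h := rms_mono (x := fun _ : Fin N => (1 : ℝ)) (z := fun i => particleSize J u₀ ξ η i ω)
    fun i => by
      rw [norm_one]
      exact (one_le_inputSize J _ _ _).trans (le_abs_self _)
  rwa [rms_const, norm_one] at h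

/-- Moments and growth of the mean-field particles, uniformly over the settings. -/
lemma exists_refState_le (S : Matrix (Fin du) (Fin du) ℝ) (hS : S.PosDef)
    {Γ : Matrix (Fin dy) (Fin dy) ℝ} (hΓ : Γ.PosDef) (κy κΨ κh ℓh ℓΨ m₂ : ℝ) (J : ℕ)
    (hκy : 0 ≤ κy) (hκΨ : 0 ≤ κΨ) (hκh : 0 ≤ κh) :
    ∃ κK B : ℝ, 0 ≤ κK ∧ 0 ≤ B ∧ ∀ (N : ℕ) [NeZero N] (Ω : Type w) [MeasurableSpace Ω]
      (P : Measure Ω) [IsProbabilityMeasure P] (μ₀ : Measure (Vec du)) (u₀ : Fin N → Ω → Vec du)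
      (ξ : ℕ → Fin N → Ω → Vec du) (η : ℕ → Fin N → Ω → Vec dy) (y : ℕ → Vec dy)
      (h : Vec du →ᵃ[ℝ] Vec dy) (Ψ₀ : Vec du →ᵃ[ℝ] Vec du) (Ψ : Vec du → Vec du) (ε : ℝ),
      Setting P κy κΨ κh ℓh ℓΨ m₂ S Γ J μ₀ u₀ ξ η y h Ψ₀ Ψ ε →
      (∀ k < J, ‖filterGain Ψ₀ h S Γ y μ₀ k‖ ≤ κK) ∧
      (∀ j ≤ J, ∀ i ω, ‖refState Ψ₀ h S Γ y μ₀ u₀ ξ η j i ω‖ ≤ B * particleSize J u₀ ξ η i ω) ∧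
      ∀ j < J, ∀ i ω, ‖refPred Ψ₀ h S Γ y μ₀ u₀ ξ η j i ω‖ ≤ B * particleSize J u₀ ξ η i ω := by
  obtain ⟨κK, hκK, hK⟩ := exists_norm_filterGain_le.{w} S hS hΓ κy κΨ κh ℓh ℓΨ m₂ J hκy hκΨ hκh
  choose A hA hAb using exists_meanField_le (du := du) (dy := dy) κy κΨ κh ℓh ℓΨ κK J hκy hκΨ
      hκh hκK
  -- The constants depend on the time; their sum dominates each of them, the final time `J`
  -- included.
  set A' : ℝ := ∑ j ∈ Finset.range (J + 1), A j with hA'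
  have hA'0 : 0 ≤ A' := Finset.sum_nonneg fun j _ => hA j
  have hAle : ∀ j ≤ J, A j ≤ A' := fun j hj =>
    Finset.single_le_sum (fun j _ => hA j) (Finset.mem_range.2 (Nat.lt_succ_of_le hj))
  refine ⟨κK, A' + (2 + κΨ * (1 + A')), hκK, by positivity,
    fun N _ Ω _ P _ μ₀ u₀ ξ η y h Ψ₀ Ψ ε H => ?_⟩
  have hKb := hK N Ω P μ₀ u₀ ξ η H.input H.gaussian H.moment y h Ψ₀ Ψ ε H.bounds
  have hst : ∀ j ≤ J, ∀ i ω,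
      ‖refState Ψ₀ h S Γ y μ₀ u₀ ξ η j i ω‖ ≤ A' * particleSize J u₀ ξ η i ω := by
    intro j hj i ω
    refine (hAb j hj y h Ψ₀ Ψ ε H.bounds _ (fun k hk => hKb k (hk.trans_le hj)) (u₀ i ω)
      (fun k => ξ k i ω) (fun k => η k i ω)).trans ?_
    exact mul_le_mul_of_nonneg_right (hAle j hj) (zero_le_one.trans (one_le_inputSize _ _ _ _))
  have hW : ∀ i ω, 0 ≤ particleSize J u₀ ξ η i ω := fun i ω =>
    zero_le_one.trans (one_le_inputSize _ _ _ _)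
  refine ⟨hKb, fun j hj i ω => (hst j hj i ω).trans ?_, fun j hj i ω =>
    (norm_pred_le H.bounds.reference (one_le_inputSize J (u₀ i ω) (fun k => ξ k i ω)
      (fun k => η k i ω)) (hst j hj.le i ω)
      (norm_state_le_inputSize (u₀ i ω) (fun k => ξ k i ω) (fun k => η k i ω) hj)).trans ?_⟩
  · exact mul_le_mul_of_nonneg_right (le_add_of_nonneg_right (by positivity)) (hW i ω)
  · exact mul_le_mul_of_nonneg_right (le_add_of_nonneg_left hA'0) (hW i ω)

/-- The coordinates of a state and of its observation. -/
def stateCoord (h : Vec du → Vec dy) : Fin du ⊕ Fin dy → Vec du → ℝ :=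
  Sum.elim (fun a u => u a) (fun b u => h u b)

lemma continuous_stateCoord {h : Vec du → Vec dy} (hh : Continuous h) (s : Fin du ⊕ Fin dy) :
    Continuous (stateCoord h s) := by
  rcases s with a | b
  · exact (EuclideanSpace.proj a : Vec du →L[ℝ] ℝ).continuous
  · exact (EuclideanSpace.proj b : Vec dy →L[ℝ] ℝ).continuous.comp hh

/-- The centered coordinates and their products. -/
def centeredCoord (h : Vec du → Vec dy) (m : Fin du ⊕ Fin dy → ℝ) :
    ((Fin du ⊕ Fin dy) × (Fin du ⊕ Fin dy)) ⊕ (Fin du ⊕ Fin dy) → Vec du → ℝ :=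
  Sum.elim (fun s u => (stateCoord h s.1 u - m s.1) * (stateCoord h s.2 u - m s.2))
    (fun s u => stateCoord h s u - m s)

/-- The empirical covariances of the mean-field particles differ from their limits by a random
variable of order `N ^ (-1 / 2)`. -/
lemma exists_covariance_error (S : Matrix (Fin du) (Fin du) ℝ) (hS : S.PosDef)
    {Γ : Matrix (Fin dy) (Fin dy) ℝ} (hΓ : Γ.PosDef) (κy κΨ κh ℓh ℓΨ m₂ : ℝ) (J : ℕ)
    (hκy : 0 ≤ κy) (hκΨ : 0 ≤ κΨ) (hκh : 0 ≤ κh) :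
    ∃ A : ℝ, 0 ≤ A ∧ ∀ (N : ℕ) [NeZero N] (Ω : Type w) [MeasurableSpace Ω]
      (P : Measure Ω) [IsProbabilityMeasure P] (μ₀ : Measure (Vec du)) (u₀ : Fin N → Ω → Vec du)
      (ξ : ℕ → Fin N → Ω → Vec du) (η : ℕ → Fin N → Ω → Vec dy) (y : ℕ → Vec dy)
      (h : Vec du →ᵃ[ℝ] Vec dy) (Ψ₀ : Vec du →ᵃ[ℝ] Vec du) (Ψ : Vec du → Vec du) (ε : ℝ),
      Setting P κy κΨ κh ℓh ℓΨ m₂ S Γ J μ₀ u₀ ξ η y h Ψ₀ Ψ ε →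
      ∃ R : Ω → ℝ, Measurable R ∧ (∀ ω, 0 ≤ R ω) ∧ Integrable (fun ω => R ω ^ 4) P ∧
      ∫ ω, R ω ^ 4 ∂P ≤ A / (N : ℝ) ^ 2 ∧
      (∀ k < J, ∀ ω, ‖covUH h (empirical fun i => (refPred Ψ₀ h S Γ y μ₀ u₀ ξ η k i ω,
        (0 : Vec dy))) - covUH h (filterPred Ψ₀ h S Γ y μ₀ k)‖ ≤
        R ω * rms fun i => particleSize J u₀ ξ η i ω) ∧
      ∀ k < J, ∀ ω, ‖covHH h (empirical fun i => (refPred Ψ₀ h S Γ y μ₀ u₀ ξ η k i ω,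
        (0 : Vec dy))) - covHH h (filterPred Ψ₀ h S Γ y μ₀ k)‖ ≤
        R ω * rms fun i => particleSize J u₀ ξ η i ω := by
  obtain ⟨κK, B, hκK, hB, hbd⟩ := exists_refState_le.{w} S hS hΓ κy κΨ κh ℓh ℓΨ m₂ J hκy hκΨ hκh
  obtain ⟨D, hD0, hD⟩ := exists_integral_inputSize_pow_le.{w} (du := du) (dy := dy) S Γ J m₂ 8
  obtain ⟨B₁, hB₁⟩ : ∃ x : ℝ, x = B + κh * (1 + B) := ⟨_, rfl⟩
  obtain ⟨B₂, hB₂⟩ : ∃ x : ℝ, x = B₁ * (1 + D) := ⟨_, rfl⟩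
  obtain ⟨a, ha⟩ : ∃ x : ℝ, x = B₂ + B₂ ^ 2 := ⟨_, rfl⟩
  have hB₁0 : 0 ≤ B₁ := by rw [hB₁]; positivity
  have hB₂0 : 0 ≤ B₂ := by rw [hB₂]; positivity
  have ha0 : 0 ≤ a := by rw [ha]; positivity
  -- One fluctuation for every time and every product of two centered coordinates, and one for every
  -- time and every centered coordinate.
  set ι := Fin J × (((Fin du ⊕ Fin dy) × (Fin du ⊕ Fin dy)) ⊕ (Fin du ⊕ Fin dy)) with hι
  obtain ⟨c₀, hc₀⟩ : ∃ x : ℝ, x = (du * dy + dy * dy) * (1 + B₂) := ⟨_, rfl⟩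
  obtain ⟨b, hb⟩ : ∃ x : ℝ, x = 3 * (a ^ 2 * (1 + D) ^ 3) ^ 2 := ⟨_, rfl⟩
  have hb0 : 0 ≤ b := by rw [hb]; positivity
  have hc₀0 : 0 ≤ c₀ := by rw [hc₀]; positivity
  refine ⟨c₀ ^ 4 * ((Fintype.card ι : ℝ) ^ 3 *
    (Fintype.card ι * b)), by positivity,
    fun N _ Ω _ P _ μ₀ u₀ ξ η y h Ψ₀ Ψ ε H => ?_⟩
  obtain ⟨-, -, hpred⟩ := hbd N Ω P μ₀ u₀ ξ η y h Ψ₀ Ψ ε H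
  have hDi := hD N Ω P μ₀ u₀ ξ η H.input H.gaussian H.moment
  have hhc := continuous_affine h
  have hΨc := continuous_affine Ψ₀
  have hW1 : ∀ i ω, 1 ≤ particleSize J u₀ ξ η i ω := fun i ω => one_le_inputSize _ _ _ _
  have hXs : ∀ k < J, ∀ i, Measurable[sigmaOf u₀ ξ η {s : InputIndex N J | s.particle = i}]
      (refPred Ψ₀ h S Γ y μ₀ u₀ ξ η k i) := fun k hk i =>
    (measurable_meanFieldPred hΨc hhc (filterGain Ψ₀ h S Γ y μ₀) y i hk).mono
      (sigmaOf_mono (predPastOf_subset i k)) le_rfl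
  have hXm : ∀ k < J, ∀ i, Measurable (refPred Ψ₀ h S Γ y μ₀ u₀ ξ η k i) := fun k hk i =>
    (hXs k hk i).mono (H.input.sigmaOf_le _) le_rfl
  have hlaw : ∀ k < J, ∀ i, P.map (refPred Ψ₀ h S Γ y μ₀ u₀ ξ η k i) =
      predLaw Ψ₀ S (trueFilter Ψ₀ h S Γ y μ₀ k) := fun k hk i =>
    ((H.input.meanField_law hS hΓ H.gaussian h Ψ₀ y i k hk.le).2.2 hk).2
  set ν : ℕ → Measure (Vec du) := fun k => predLaw Ψ₀ S (trueFilter Ψ₀ h S Γ y μ₀ k) with hν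
  have hlawν : ∀ k < J, ∀ i, P.map (refPred Ψ₀ h S Γ y μ₀ u₀ ξ η k i) = ν k := hlaw
  set m : ℕ → Fin du ⊕ Fin dy → ℝ := fun k s => ∫ u, stateCoord h s u ∂(ν k) with hm
  set F : ι → Vec du → ℝ := fun s u => centeredCoord h (m s.1) s.2 u with hF
  set Z : ι → Ω → ℝ := fun s ω =>
    avg (fun i => F s (refPred Ψ₀ h S Γ y μ₀ u₀ ξ η s.1 i ω)) - ∫ u, F s u ∂(ν s.1) with hZ
  have hcoord : ∀ k < J, ∀ s i ω, |stateCoord h s (refPred Ψ₀ h S Γ y μ₀ u₀ ξ η k i ω)| ≤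
      B₁ * particleSize J u₀ ξ η i ω := by
    intro k hk s i ω
    have h1 := hpred k hk i ω
    have h2 := H.bounds.obs_growth (refPred Ψ₀ h S Γ y μ₀ u₀ ξ η k i ω)
    have h3 := hW1 i ω
    have h4 : κh * (1 + ‖refPred Ψ₀ h S Γ y μ₀ u₀ ξ η k i ω‖) ≤
        κh * ((1 + B) * particleSize J u₀ ξ η i ω) :=
      mul_le_mul_of_nonneg_left (by linarith) hκh
    have h5 : 0 ≤ B * particleSize J u₀ ξ η i ω := by positivity
    have h6 : 0 ≤ κh * (1 + B) * particleSize J u₀ ξ η i ω := by positivity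
    rw [hB₁]
    rcases s with b | b
    · exact (abs_coord_le_norm _ b).trans (by linarith)
    · exact (abs_coord_le_norm _ b).trans (by linarith)
  have hWi : ∀ i, Integrable (fun ω => particleSize J u₀ ξ η i ω) P ∧
      ∫ ω, particleSize J u₀ ξ η i ω ∂P ≤ D := by
    intro i
    have hle : ∀ ω, particleSize J u₀ ξ η i ω ≤ particleSize J u₀ ξ η i ω ^ 8 := fun ω =>
      le_self_pow₀ (hW1 i ω) (by norm_num)
    have hint : Integrable (fun ω => particleSize J u₀ ξ η i ω) P :=
      (hDi i).1.mono' (H.input.measurable_inputSize i).aestronglyMeasurable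
        (ae_of_all _ fun ω => by
          rw [Real.norm_of_nonneg (zero_le_one.trans (hW1 i ω))]
          exact hle ω)
    exact ⟨hint, (integral_mono hint (hDi i).1 hle).trans (hDi i).2⟩
  have hmint : ∀ k < J, ∀ s, Integrable (stateCoord h s) (ν k) := by
    intro k hk s
    rw [← hlawν k hk 0]
    refine (integrable_map_measure (continuous_stateCoord hhc s).aestronglyMeasurable
      (hXm k hk 0).aemeasurable).2 ?_
    exact ((hWi 0).1.const_mul B₁).mono'
      ((continuous_stateCoord hhc s).measurable.comp (hXm k hk 0)).aestronglyMeasurable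
      (ae_of_all _ fun ω => hcoord k hk s 0 ω)
  have hmD : ∀ k < J, ∀ s, |m k s| ≤ B₁ * D := by
    intro k hk s
    have hi := hmint k hk s
    rw [← hlawν k hk 0] at hi
    have h1 : m k s = ∫ ω, stateCoord h s (refPred Ψ₀ h S Γ y μ₀ u₀ ξ η k 0 ω) ∂P := by
      change ∫ u, stateCoord h s u ∂(ν k) = _
      rw [← hlawν k hk 0, integral_map (hXm k hk 0).aemeasurable
        (continuous_stateCoord hhc s).aestronglyMeasurable]
    rw [h1]
    refine abs_integral_le_integral_abs.trans ((integral_mono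
      ((integrable_map_measure (continuous_stateCoord hhc s).aestronglyMeasurable
      (hXm k hk 0).aemeasurable).1 hi).abs ((hWi 0).1.const_mul B₁)
        (hcoord k hk s 0)).trans ?_)
    rw [integral_const_mul]
    exact mul_le_mul_of_nonneg_left (hWi 0).2 hB₁0
  have hcen : ∀ k < J, ∀ s i ω,
      |stateCoord h s (refPred Ψ₀ h S Γ y μ₀ u₀ ξ η k i ω) - m k s| ≤
        B₂ * particleSize J u₀ ξ η i ω := by
    intro k hk s i ω
    have h1 := hcoord k hk s i ω
    have h2 := hmD k hk s
    have h3 : B₁ * D ≤ B₁ * D * particleSize J u₀ ξ η i ω :=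
      le_mul_of_one_le_right (by positivity) (hW1 i ω)
    refine (abs_sub _ _).trans ?_
    rw [hB₂]
    linarith
  have hFc : ∀ s, Measurable (F s) := by
    rintro ⟨k, ⟨s, t⟩ | s⟩
    · exact (((continuous_stateCoord hhc s).measurable.sub_const _).mul
        ((continuous_stateCoord hhc t).measurable.sub_const _))
    · exact (continuous_stateCoord hhc s).measurable.sub_const _
  have hFW : ∀ s : ι, ∀ i ω, |F s (refPred Ψ₀ h S Γ y μ₀ u₀ ξ η s.1 i ω)| ≤
      a * particleSize J u₀ ξ η i ω ^ 2 := by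
    rintro ⟨k, ⟨s, t⟩ | s⟩ i ω
    · have h1 := hcen k k.2 s i ω
      have h2 := hcen k k.2 t i ω
      change |_ * _| ≤ _
      rw [abs_mul]
      refine (mul_le_mul h1 h2 (abs_nonneg _) ((abs_nonneg _).trans h1)).trans ?_
      have : 0 ≤ B₂ * particleSize J u₀ ξ η i ω ^ 2 := by positivity
      rw [ha]
      linarith
    · refine (hcen k k.2 s i ω).trans ?_
      have h3 : particleSize J u₀ ξ η i ω ≤ particleSize J u₀ ξ η i ω ^ 2 :=
        le_self_pow₀ (hW1 i ω) (by norm_num)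
      exact mul_le_mul (by rw [ha]; exact le_add_of_nonneg_right (by positivity)) h3
        (zero_le_one.trans (hW1 i ω)) ha0
  have hfl : ∀ s : ι, Integrable (fun ω => Z s ω ^ 4) P ∧
      ∫ ω, Z s ω ^ 4 ∂P ≤ b / (N : ℝ) ^ 2 := by
    intro s
    have := H.input.integral_avg_sub_pow_le
      (F := fun i ω => F s (refPred Ψ₀ h S Γ y μ₀ u₀ ξ η s.1 i ω))
      (fun i => (hFc s).comp (hXs s.1 s.1.2 i)) (W := particleSize J u₀ ξ η)
      H.input.measurable_inputSize hW1 (fun i => (hDi i).1) (fun i => (hDi i).2) ha0 (hFW s)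
      (c := ∫ u, F s u ∂(ν s.1)) (fun i => by
        rw [← hlawν s.1 s.1.2 i, integral_map (hXm s.1 s.1.2 i).aemeasurable
          (hFc s).aestronglyMeasurable])
    rw [hb]
    exact this.2.2
  have hZm : ∀ s, Measurable (Z s) := fun s =>
    (Measurable.const_mul (Finset.measurable_fun_sum _ fun i _ =>
      (hFc s).comp (hXm s.1 s.1.2 i)) _).sub_const _
  have hZ0 : ∀ s : Fin J × (Fin du ⊕ Fin dy), ∫ u, F (s.1, Sum.inr s.2) u ∂(ν s.1) = 0 := by
    rintro ⟨k, s⟩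
    have hpr : IsProbabilityMeasure (ν k) := by
      rw [← hlawν k k.2 0]
      exact Measure.isProbabilityMeasure_map (hXm k k.2 0).aemeasurable
    change ∫ u, (stateCoord h s u - m k s) ∂(ν k) = 0
    rw [integral_sub (hmint k k.2 s) (integrable_const _)]
    simp [hm]
  -- Finitely many fluctuations are summed, so that one random variable works simultaneously for all
  -- times and all matrix entries.
  set R₀ : Ω → ℝ := fun ω => ∑ s, |Z s ω| with hR₀
  have hR₀0 : ∀ ω, 0 ≤ R₀ ω := fun ω => Finset.sum_nonneg fun s _ => abs_nonneg _
  have hZR : ∀ s ω, |Z s ω| ≤ R₀ ω := fun s ω =>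
    Finset.single_le_sum (f := fun s => |Z s ω|) (fun s _ => abs_nonneg _) (Finset.mem_univ s)
  have hcov : ∀ (k : Fin J) (s t : Fin du ⊕ Fin dy) ω,
      |tupleCov (fun i => stateCoord h s (refPred Ψ₀ h S Γ y μ₀ u₀ ξ η k i ω))
        (fun i => stateCoord h t (refPred Ψ₀ h S Γ y μ₀ u₀ ξ η k i ω)) -
        cov[stateCoord h s, stateCoord h t; ν k]| ≤
      (1 + B₂) * R₀ ω * rms fun i => particleSize J u₀ ξ η i ω := by
    intro k s t ω
    have hM := one_le_rms_particleSize (J := J) u₀ ξ η ω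
    -- The error consists of the fluctuation of the centered product and of a product of two
    -- centered averages. One of these averages is kept as a fluctuation; the other is bounded
    -- crudely by the input sizes, which is why the root mean square appears on the right.
    rw [tupleCov_sub_eq _ _ (m k s) (m k t)]
    have h1 : |Z (k, Sum.inl (s, t)) ω| ≤ R₀ ω := hZR _ ω
    have h2 : |avg fun i => stateCoord h s (refPred Ψ₀ h S Γ y μ₀ u₀ ξ η k i ω) - m k s| ≤
        R₀ ω := by
      have := hZR (k, Sum.inr s) ω
      simp only [hZ, hZ0 (k, s), sub_zero] at this
      exact this
    have h3 : |avg fun i => stateCoord h t (refPred Ψ₀ h S Γ y μ₀ u₀ ξ η k i ω) - m k t| ≤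
        B₂ * rms fun i => particleSize J u₀ ξ η i ω :=
      (abs_avg_le_rms _).trans (rms_le_mul hB₂0 fun i => by
        rw [Real.norm_of_nonneg (zero_le_one.trans (hW1 i ω))]
        exact hcen k k.2 t i ω)
    refine (abs_sub _ _).trans ?_
    rw [abs_mul]
    have h4 := mul_le_mul h2 h3 (abs_nonneg _) (hR₀0 ω)
    have h5 : R₀ ω ≤ R₀ ω * rms fun i => particleSize J u₀ ξ η i ω :=
      le_mul_of_one_le_right (hR₀0 ω) hM
    have h6 := h1.trans h5
    refine (add_le_add h6 h4).trans (le_of_eq (by ring))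
  have hpos : ∀ ω, 0 ≤ (1 + B₂) * R₀ ω * rms fun i => particleSize J u₀ ξ η i ω := fun ω =>
    mul_nonneg (mul_nonneg (by positivity) (hR₀0 ω)) (rms_nonneg _)
  refine ⟨fun ω => c₀ * R₀ ω, (Finset.measurable_fun_sum _ fun s _ => (hZm s).abs).const_mul _,
    fun ω => mul_nonneg hc₀0 (hR₀0 ω), ?_⟩
  have hdom : ∀ ω, R₀ ω ^ 4 ≤ (Fintype.card ι : ℝ) ^ 3 * ∑ s, Z s ω ^ 4 := fun ω => by
    have := sum_pow_succ_le Finset.univ (f := fun s => |Z s ω|) (fun s _ => abs_nonneg _) 3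
    simpa only [Even.pow_abs (by decide : Even (3 + 1)), Finset.card_univ] using this
  have hdomi : Integrable (fun ω => (Fintype.card ι : ℝ) ^ 3 * ∑ s, Z s ω ^ 4) P :=
    (integrable_finsetSum _ fun s _ => (hfl s).1).const_mul _
  have hR₀i : Integrable (fun ω => R₀ ω ^ 4) P :=
    hdomi.mono' ((Finset.measurable_fun_sum _ fun s _ => (hZm s).abs).pow_const 4).aestronglyMeasurable
      (ae_of_all _ fun ω => by
        rw [Real.norm_of_nonneg (pow_nonneg (hR₀0 ω) 4)]
        exact hdom ω)
  have hpow : ∀ ω, (c₀ * R₀ ω) ^ 4 = c₀ ^ 4 * R₀ ω ^ 4 := fun ω => mul_pow _ _ _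
  simp only [hpow]
  refine ⟨hR₀i.const_mul _, ?_, fun k hk ω => ?_, fun k hk ω => ?_⟩
  · rw [integral_const_mul, mul_div_assoc]
    refine mul_le_mul_of_nonneg_left ((integral_mono hR₀i hdomi hdom).trans ?_) (by positivity)
    rw [integral_const_mul, integral_finsetSum _ fun s _ => (hfl s).1, mul_div_assoc]
    refine mul_le_mul_of_nonneg_left ((Finset.sum_le_sum fun s _ => (hfl s).2).trans ?_)
      (by positivity)
    rw [Finset.sum_const, Finset.card_univ, nsmul_eq_mul]
    exact le_of_eq (mul_div_assoc _ _ _).symm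
  · refine (opNorm_le_of_forall_abs_le _ (c := (1 + B₂) * R₀ ω *
      rms fun i => particleSize J u₀ ξ η i ω) fun a b => ?_).trans ?_
    · rw [Matrix.sub_apply, covUH_empirical, covUH_filterPred (hXm k hk 0) (hlaw k hk 0)]
      have := hcov ⟨k, hk⟩ (Sum.inl a) (Sum.inr b) ω
      rw [← hlawν k hk 0, covariance_map_fun
        (continuous_stateCoord hhc _).aestronglyMeasurable
        (continuous_stateCoord hhc _).aestronglyMeasurable (hXm k hk 0).aemeasurable] at this
      exact this
    · have := mul_nonneg (by positivity : (0 : ℝ) ≤ dy * dy) (hpos ω)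
      rw [hc₀]
      linarith
  · refine (opNorm_le_of_forall_abs_le _ (c := (1 + B₂) * R₀ ω *
      rms fun i => particleSize J u₀ ξ η i ω) fun a b => ?_).trans ?_
    · rw [Matrix.sub_apply, covHH_empirical, covHH_filterPred (hXm k hk 0) (hlaw k hk 0)]
      have := hcov ⟨k, hk⟩ (Sum.inr a) (Sum.inr b) ω
      rw [← hlawν k hk 0, covariance_map_fun
        (continuous_stateCoord hhc _).aestronglyMeasurable
        (continuous_stateCoord hhc _).aestronglyMeasurable (hXm k hk 0).aemeasurable] at this
      exact this
    · have := mul_nonneg (by positivity : (0 : ℝ) ≤ du * dy) (hpos ω)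
      rw [hc₀]
      linarith

end CovarianceError

end EnKF

namespace EnKF

/-! ### Error of the ensemble averages -/

section ParticleError

open scoped Matrix.Norms.L2Operator

universe w

variable {du dy N J : ℕ}

lemma continuous_of_abs_sub_le {L : ℝ} {φ : Vec du → ℝ}
    (hφ : ∀ u v, |φ u - φ v| ≤ L * ‖u - v‖ * (1 + ‖u‖ + ‖v‖)) : Continuous φ := by
  refine continuous_iff_continuousAt.2 fun v => ?_
  have h1 : Filter.Tendsto (fun u : Vec du => L * ‖u - v‖ * (1 + ‖u‖ + ‖v‖)) (nhds v)
      (nhds (L * ‖v - v‖ * (1 + ‖v‖ + ‖v‖))) :=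
    Continuous.tendsto (f := fun u : Vec du => L * ‖u - v‖ * (1 + ‖u‖ + ‖v‖)) (by fun_prop) v
  rw [sub_self, norm_zero, mul_zero, zero_mul] at h1
  refine tendsto_iff_dist_tendsto_zero.2 (squeeze_zero (fun u => dist_nonneg) (fun u => ?_) h1)
  rw [Real.dist_eq]
  exact hφ u v

lemma abs_le_mul_sq {L : ℝ} (hL : 0 ≤ L) {φ : Vec du → ℝ} (hφ0 : φ 0 = 0)
    (hφ : ∀ u v, |φ u - φ v| ≤ L * ‖u - v‖ * (1 + ‖u‖ + ‖v‖)) {B W : ℝ} (hW : 1 ≤ W)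
    {u : Vec du} (hu : ‖u‖ ≤ B * W) : |φ u| ≤ L * (B * (1 + B)) * W ^ 2 := by
  have h1 := hφ u 0
  rw [hφ0, sub_zero, sub_zero, norm_zero, add_zero] at h1
  have hBW : 0 ≤ B * W := (norm_nonneg u).trans hu
  calc |φ u| ≤ L * ‖u‖ * (1 + ‖u‖) := h1
    _ ≤ L * (B * W) * (W + B * W) := by gcongr
    _ = _ := by ring

/-- Cauchy–Schwarz pairs the increments with the linear factor in the local Lipschitz bound, so root
mean squares suffice for a test function of quadratic growth. -/
lemma avg_abs_sub_le [NeZero N] {L : ℝ} {φ : Vec du → ℝ} (hL : 0 ≤ L)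
    (hφ : ∀ u v, |φ u - φ v| ≤ L * ‖u - v‖ * (1 + ‖u‖ + ‖v‖)) (x z : Fin N → Vec du) :
    |avg (fun i => φ (x i)) - avg fun i => φ (z i)| ≤
      L * (rms (fun i => x i - z i) * (1 + rms x + rms z)) := by
  rw [← avg_sub]
  have h1 : rms (fun i => 1 + ‖x i‖ + ‖z i‖) ≤ 1 + rms x + rms z := by
    refine (rms_le_add (z := fun i => 1 + ‖x i‖) (w := z) fun i => ?_).trans
      (add_le_add ((rms_le_const_add_mul (z := x) zero_le_one zero_le_one fun i => ?_).trans
        (by rw [one_mul])) le_rfl)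
    · rw [Real.norm_of_nonneg (by positivity), Real.norm_of_nonneg (by positivity)]
    · rw [Real.norm_of_nonneg (by positivity), one_mul]
  calc |avg fun i => φ (x i) - φ (z i)| ≤ avg fun i => |φ (x i) - φ (z i)| := abs_avg_le_avg_abs _
    _ ≤ avg fun i => L * (‖x i - z i‖ * (1 + ‖x i‖ + ‖z i‖)) :=
        avg_mono fun i => (hφ _ _).trans (le_of_eq (by ring))
    _ ≤ L * (rms (fun i => ‖x i - z i‖) * rms fun i => 1 + ‖x i‖ + ‖z i‖) := by
        rw [avg_const_mul]
        exact mul_le_mul_of_nonneg_left ((le_abs_self _).trans (abs_avg_mul_le _ _)) hL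
    _ ≤ _ := by
        refine mul_le_mul_of_nonneg_left (mul_le_mul (rms_mono fun i => ?_) h1 (rms_nonneg _)
          (rms_nonneg _)) hL
        rw [norm_norm]

/-- Jensen's inequality for the average of squares; with even powers the square root disappears. -/
lemma rms_pow_two_mul_le [NeZero N] {f : Fin N → ℝ} (p : ℕ) :
    rms f ^ (2 * p) ≤ avg fun i => f i ^ (2 * p) := by
  rw [pow_mul, rms_sq]
  refine (avg_pow_le (fun i => by positivity) p).trans (le_of_eq ?_)
  congr 1
  funext i
  rw [Real.norm_eq_abs, sq_abs, pow_mul]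

lemma Integrable.avg {Ω : Type*} [MeasurableSpace Ω] {P : Measure Ω} {F : Fin N → Ω → ℝ}
    (hF : ∀ i, Integrable (F i) P) : Integrable (fun ω => avg fun i => F i ω) P :=
  (integrable_finsetSum _ fun i _ => hF i).const_mul _

lemma integral_avg {Ω : Type*} [MeasurableSpace Ω] {P : Measure Ω} {F : Fin N → Ω → ℝ}
    (hF : ∀ i, Integrable (F i) P) : ∫ ω, avg (fun i => F i ω) ∂P = avg fun i => ∫ ω, F i ω ∂P := by
  simp only [avg]
  rw [integral_const_mul, integral_finsetSum _ fun i _ => hF i]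

/-- Pathwise comparison of the ensemble averages with the averages over the mean-field
particles. -/
lemma exists_abs_avg_sub_le (S : Matrix (Fin du) (Fin du) ℝ) (hS : S.PosDef)
    {Γ : Matrix (Fin dy) (Fin dy) ℝ} (hΓ : Γ.PosDef) (κy κΨ κh ℓh ℓΨ m₂ L : ℝ) (J : ℕ)
    (hκy : 0 ≤ κy) (hκΨ : 0 ≤ κΨ) (hκh : 0 ≤ κh) (hℓh : 0 ≤ ℓh) (hL : 0 ≤ L) :
    ∃ A : ℝ, 0 ≤ A ∧ ∃ p : ℕ, ∀ (N : ℕ) [NeZero N] (Ω : Type w) [MeasurableSpace Ω]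
      (P : Measure Ω) [IsProbabilityMeasure P] (μ₀ : Measure (Vec du)) (u₀ : Fin N → Ω → Vec du)
      (ξ : ℕ → Fin N → Ω → Vec du) (η : ℕ → Fin N → Ω → Vec dy) (y : ℕ → Vec dy)
      (h : Vec du →ᵃ[ℝ] Vec dy) (Ψ₀ : Vec du →ᵃ[ℝ] Vec du) (Ψ : Vec du → Vec du) (ε : ℝ),
      Setting P κy κΨ κh ℓh ℓΨ m₂ S Γ J μ₀ u₀ ξ η y h Ψ₀ Ψ ε →
      ∀ φ : Vec du → ℝ, (∀ u v, |φ u - φ v| ≤ L * ‖u - v‖ * (1 + ‖u‖ + ‖v‖)) →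
      ∀ (R : ℝ) (ω : Ω), 0 ≤ R →
      (∀ k < J, ‖covUH h (empirical fun i => (refPred Ψ₀ h S Γ y μ₀ u₀ ξ η k i ω,
        (0 : Vec dy))) - covUH h (filterPred Ψ₀ h S Γ y μ₀ k)‖ ≤
        R * rms fun i => particleSize J u₀ ξ η i ω) →
      (∀ k < J, ‖covHH h (empirical fun i => (refPred Ψ₀ h S Γ y μ₀ u₀ ξ η k i ω,
        (0 : Vec dy))) - covHH h (filterPred Ψ₀ h S Γ y μ₀ k)‖ ≤
        R * rms fun i => particleSize J u₀ ξ η i ω) →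
      |avg (fun i => φ (particles Ψ h Γ y (fun i => u₀ i ω) (fun j i => ξ j i ω)
        (fun j i => η j i ω) J i)) - avg fun i => φ (refState Ψ₀ h S Γ y μ₀ u₀ ξ η J i ω)| ≤
        A * (ε + R) * (rms fun i => particleSize J u₀ ξ η i ω) ^ p := by
  obtain ⟨κK, B, hκK, hB, hbd⟩ := exists_refState_le.{w} S hS hΓ κy κΨ κh ℓh ℓΨ m₂ J hκy hκΨ hκh
  obtain ⟨A₁, hA₁, p₁, h₁⟩ := exists_rms_particles_le (du := du) κy κΨ κh ℓh ℓΨ J hΓ hκy hκΨ hκh J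
  obtain ⟨A₂, hA₂, p₂, h₂⟩ := exists_rms_particles_sub_meanField_le (du := du) κy κΨ κh ℓh ℓΨ κK J
    hΓ hκy hκΨ hκh hℓh hκK J
  -- `M ^ p₂` comes from the distance and `M ^ (p₁ + 1)` from the size of the two clouds; the extra
  -- power also covers the linear bound on the mean-field particles when `p₁ = 0`.
  refine ⟨L * (A₂ * (1 + A₁ + B)), by positivity, p₂ + (p₁ + 1),
    fun N _ Ω _ P _ μ₀ u₀ ξ η y h Ψ₀ Ψ ε H φ hφ R ω hR hUH hHH => ?_⟩
  obtain ⟨hK, hst, -⟩ := hbd N Ω P μ₀ u₀ ξ η y h Ψ₀ Ψ ε H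
  have hM1 := one_le_rms_particleSize (J := J) u₀ ξ η ω
  have hW : ∀ i, ‖particleSize J u₀ ξ η i ω‖ = particleSize J u₀ ξ η i ω := fun i =>
    Real.norm_of_nonneg (zero_le_one.trans (one_le_inputSize _ _ _ _))
  have hlaw := fun k (hk : k < J) =>
    (H.input.meanField_law hS hΓ H.gaussian h Ψ₀ y 0 k hk.le).2.2 hk
  have hXm : ∀ k < J, Measurable (refPred Ψ₀ h S Γ y μ₀ u₀ ξ η k 0) := fun k hk =>
    (measurable_meanFieldPred (continuous_affine Ψ₀) (continuous_affine h)
      (filterGain Ψ₀ h S Γ y μ₀) y 0 hk).mono (H.input.sigmaOf_le _) le_rfl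
  have hpart := h₁ le_rfl N y h Ψ₀ Ψ ε H.bounds (fun i => u₀ i ω) (fun j i => ξ j i ω)
    (fun j i => η j i ω) _ hM1
    (rms_mono fun i => by rw [hW]; exact norm_init_le_inputSize J (u₀ i ω) _ _)
    (fun k hk => rms_mono fun i => by
      rw [hW]; exact norm_state_le_inputSize (u₀ i ω) (fun k => ξ k i ω) (fun k => η k i ω) hk)
    (fun k hk => rms_mono fun i => by
      rw [hW]; exact norm_obs_le_inputSize (u₀ i ω) (fun k => ξ k i ω) (fun k => η k i ω) hk)
  have hdiff := h₂ le_rfl N y h Ψ₀ Ψ ε H.bounds (fun k => covUH h (filterPred Ψ₀ h S Γ y μ₀ k))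
    (fun k => covHH h (filterPred Ψ₀ h S Γ y μ₀ k))
    (fun k hk => covHH_filterPred_posSemidef (hXm k hk) (hlaw k hk).1 (hlaw k hk).2) hK
    (fun i => u₀ i ω) (fun j i => ξ j i ω) (fun j i => η j i ω) _ R hR le_rfl hM1 hUH hHH
  have href : rms (fun i => refState Ψ₀ h S Γ y μ₀ u₀ ξ η J i ω) ≤
      B * rms fun i => particleSize J u₀ ξ η i ω :=
    rms_le_mul hB fun i => by
      rw [hW]
      exact hst J le_rfl i ω
  refine (avg_abs_sub_le hL hφ _ _).trans ?_
  generalize (rms fun i => particleSize J u₀ ξ η i ω) = M at *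
  have hM0 : 0 ≤ M := by linarith
  have hε := H.bounds.eps_nonneg
  have h3 : 1 + rms (particles Ψ h Γ y (fun i => u₀ i ω) (fun j i => ξ j i ω)
        (fun j i => η j i ω) J) + rms (fun i => refState Ψ₀ h S Γ y μ₀ u₀ ξ η J i ω) ≤
      (1 + A₁ + B) * M ^ (p₁ + 1) := by
    have h4 : 1 ≤ M ^ (p₁ + 1) := one_le_pow₀ hM1
    have h5 : A₁ * M ^ p₁ ≤ A₁ * M ^ (p₁ + 1) :=
      mul_le_mul_of_nonneg_left (pow_le_pow_right₀ hM1 (Nat.le_succ _)) hA₁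
    have h6 : B * M ≤ B * M ^ (p₁ + 1) :=
      mul_le_mul_of_nonneg_left (le_self_pow₀ hM1 (Nat.succ_ne_zero _)) hB
    linarith
  calc _ ≤ L * ((A₂ * (ε + R) * M ^ p₂) * ((1 + A₁ + B) * M ^ (p₁ + 1))) := by
        refine mul_le_mul_of_nonneg_left (mul_le_mul hdiff h3 ?_ (by positivity)) hL
        have := rms_nonneg (particles Ψ h Γ y (fun i => u₀ i ω) (fun j i => ξ j i ω)
          (fun j i => η j i ω) J)
        have := rms_nonneg (fun i => refState Ψ₀ h S Γ y μ₀ u₀ ξ η J i ω)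
        linarith
    _ = _ := by rw [pow_add M p₂]; ring

end ParticleError

end EnKF

namespace EnKF

/-! ### Mean square error relative to the reference filter -/

section MeanSquare

open scoped Matrix.Norms.L2Operator

universe w

variable {du dy N J : ℕ}

lemma measurable_rms {Ω : Type*} [MeasurableSpace Ω] {f : Fin N → Ω → ℝ}
    (hf : ∀ i, Measurable (f i)) : Measurable fun ω => rms fun i => f i ω := by
  unfold rms avg
  exact ((Finset.measurable_fun_sum _ fun i _ => (hf i).norm.pow_const 2).const_mul _).sqrt

/-- Young's inequality with weight `n` separates `R` from `X`, which are not independent. For `n =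
N` and a fourth moment of `R` of order `N⁻²`, both resulting terms have expectation of order `N⁻¹`.
-/
lemma sq_add_error_le {A ε R X Z n : ℝ} (hn : 0 < n) {p : ℕ} :
    (A * (ε + R) * X ^ p + |Z|) ^ 2 ≤
      4 * A ^ 2 * ε ^ 2 * X ^ (2 * p) +
        2 * A ^ 2 * (n * R ^ 4 + n⁻¹ * X ^ (2 * (2 * p))) + 2 * Z ^ 2 := by
  have h1 : (A * (ε + R) * X ^ p + |Z|) ^ 2 ≤ 2 * (A * (ε + R) * X ^ p) ^ 2 + 2 * Z ^ 2 := by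
    nlinarith [sq_nonneg (A * (ε + R) * X ^ p - |Z|), sq_abs Z]
  have h2 : (ε + R) ^ 2 ≤ 2 * ε ^ 2 + 2 * R ^ 2 := by nlinarith [sq_nonneg (ε - R)]
  have h3 : 2 * (R ^ 2 * X ^ (2 * p)) ≤ n * R ^ 4 + n⁻¹ * X ^ (2 * (2 * p)) := by
    have h4 : 0 ≤ n⁻¹ * (n * R ^ 2 - X ^ (2 * p)) ^ 2 := by positivity
    have h5 : n⁻¹ * (n * R ^ 2 - X ^ (2 * p)) ^ 2 =
        n * R ^ 4 + n⁻¹ * X ^ (2 * (2 * p)) - 2 * (R ^ 2 * X ^ (2 * p)) := by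
      rw [mul_comm 2 (2 * p), pow_mul X (2 * p) 2]
      field_simp
      ring
    linarith
  have h6 : (A * (ε + R) * X ^ p) ^ 2 = A ^ 2 * ((ε + R) ^ 2 * X ^ (2 * p)) := by ring
  have h7 : A ^ 2 * ((ε + R) ^ 2 * X ^ (2 * p)) ≤
      A ^ 2 * ((2 * ε ^ 2 + 2 * R ^ 2) * X ^ (2 * p)) := by
    have : 0 ≤ X ^ (2 * p) := by rw [pow_mul]; positivity
    gcongr
  have h8 := mul_le_mul_of_nonneg_left h3 (sq_nonneg A)
  rw [h6] at h1
  linarith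

/-- Mean square error of the ensemble averages, relative to the filter of the reference model. -/
lemma exists_ensemble_error (S : Matrix (Fin du) (Fin du) ℝ) (hS : S.PosDef)
    {Γ : Matrix (Fin dy) (Fin dy) ℝ} (hΓ : Γ.PosDef) (κy κΨ κh ℓh ℓΨ m₂ L : ℝ) (J : ℕ)
    (hκy : 0 ≤ κy) (hκΨ : 0 ≤ κΨ) (hκh : 0 ≤ κh) (hℓh : 0 ≤ ℓh) (hL : 0 ≤ L) :
    ∃ C : ℝ, 0 ≤ C ∧ ∀ (N : ℕ) [NeZero N] (Ω : Type w) [MeasurableSpace Ω]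
      (P : Measure Ω) [IsProbabilityMeasure P] (μ₀ : Measure (Vec du)) (u₀ : Fin N → Ω → Vec du)
      (ξ : ℕ → Fin N → Ω → Vec du) (η : ℕ → Fin N → Ω → Vec dy) (y : ℕ → Vec dy)
      (h : Vec du →ᵃ[ℝ] Vec dy) (Ψ₀ : Vec du →ᵃ[ℝ] Vec du) (Ψ : Vec du → Vec du) (ε : ℝ),
      Setting P κy κΨ κh ℓh ℓΨ m₂ S Γ J μ₀ u₀ ξ η y h Ψ₀ Ψ ε →
      ∀ φ : Vec du → ℝ, φ 0 = 0 →
      (∀ u v, |φ u - φ v| ≤ L * ‖u - v‖ * (1 + ‖u‖ + ‖v‖)) →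
      ∃ H : Ω → ℝ, Integrable H P ∧ ∫ ω, H ω ∂P ≤ C * (ε ^ 2 + (N : ℝ)⁻¹) ∧
      ∀ ω, (avg (fun i => φ (particles Ψ h Γ y (fun i => u₀ i ω) (fun j i => ξ j i ω)
        (fun j i => η j i ω) J i)) - ∫ u, φ u ∂(trueFilter Ψ₀ h S Γ y μ₀ J)) ^ 2 ≤ H ω := by
  obtain ⟨κK, B, hκK, hB, hbd⟩ := exists_refState_le.{w} S hS hΓ κy κΨ κh ℓh ℓΨ m₂ J hκy hκΨ hκh
  obtain ⟨A, hA, hcov⟩ := exists_covariance_error.{w} S hS hΓ κy κΨ κh ℓh ℓΨ m₂ J hκy hκΨ hκh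
  obtain ⟨A', hA', p, hpath⟩ := exists_abs_avg_sub_le.{w} S hS hΓ κy κΨ κh ℓh ℓΨ m₂ L J hκy hκΨ
    hκh hℓh hL
  obtain ⟨D, hD0, hD⟩ := exists_integral_inputSize_pow_le.{w} (du := du) (dy := dy) S Γ J m₂ 8
  obtain ⟨D₁, hD₁0, hD₁⟩ :=
    exists_integral_inputSize_pow_le.{w} (du := du) (dy := dy) S Γ J m₂ (2 * p)
  obtain ⟨D₂, hD₂0, hD₂⟩ :=
    exists_integral_inputSize_pow_le.{w} (du := du) (dy := dy) S Γ J m₂ (2 * (2 * p))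
  obtain ⟨a, ha⟩ : ∃ a : ℝ, a = L * (B * (1 + B)) := ⟨_, rfl⟩
  have ha0 : 0 ≤ a := by rw [ha]; positivity
  obtain ⟨b, hb⟩ : ∃ b : ℝ, b = a ^ 2 * (1 + D) ^ 3 := ⟨_, rfl⟩
  have hb0 : 0 ≤ b := by rw [hb]; positivity
  refine ⟨4 * A' ^ 2 * D₁ + 2 * A' ^ 2 * (A + D₂) + 2 * b, by positivity,
    fun N _ Ω _ P _ μ₀ u₀ ξ η y h Ψ₀ Ψ ε H φ hφ0 hφ => ?_⟩
  have hN : (0 : ℝ) < N := Nat.cast_pos.2 (NeZero.pos N)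
  obtain ⟨-, hst, -⟩ := hbd N Ω P μ₀ u₀ ξ η y h Ψ₀ Ψ ε H
  obtain ⟨R, hRm, hR0, hRi, hRA, hUH, hHH⟩ := hcov N Ω P μ₀ u₀ ξ η y h Ψ₀ Ψ ε H
  have hW1 : ∀ i ω, 1 ≤ particleSize J u₀ ξ η i ω := fun i ω => one_le_inputSize _ _ _ _
  have hWm := H.input.measurable_inputSize
  have hVs : ∀ i, Measurable[sigmaOf u₀ ξ η {s : InputIndex N J | s.particle = i}]
      (refState Ψ₀ h S Γ y μ₀ u₀ ξ η J i) := fun i =>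
    (measurable_meanField (continuous_affine Ψ₀) (continuous_affine h)
      (filterGain Ψ₀ h S Γ y μ₀) y i J le_rfl).mono (sigmaOf_mono fun k hk => hk.1) le_rfl
  have hφm : Measurable φ := (continuous_of_abs_sub_le hφ).measurable
  obtain ⟨hZi, hZb, -, -⟩ := H.input.integral_avg_sub_pow_le
    (F := fun i ω => φ (refState Ψ₀ h S Γ y μ₀ u₀ ξ η J i ω)) (fun i => hφm.comp (hVs i))
    (W := particleSize J u₀ ξ η) hWm hW1
    (fun i => (hD N Ω P μ₀ u₀ ξ η H.input H.gaussian H.moment i).1)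
    (fun i => (hD N Ω P μ₀ u₀ ξ η H.input H.gaussian H.moment i).2) ha0
    (fun i ω => by rw [ha]; exact abs_le_mul_sq hL hφ0 hφ (hW1 i ω) (hst J le_rfl i ω))
    (c := ∫ u, φ u ∂(trueFilter Ψ₀ h S Γ y μ₀ J)) (fun i => by
      rw [← (H.input.meanField_law hS hΓ H.gaussian h Ψ₀ y i J le_rfl).2.1,
        integral_map ((hVs i).mono (H.input.sigmaOf_le _) le_rfl).aemeasurable
          hφm.aestronglyMeasurable])
  rw [← hb] at hZb
  have hX : ∀ q D', (∀ i, Integrable (fun ω => particleSize J u₀ ξ η i ω ^ (2 * q)) P ∧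
      ∫ ω, particleSize J u₀ ξ η i ω ^ (2 * q) ∂P ≤ D') →
      Integrable (fun ω => (rms fun i => particleSize J u₀ ξ η i ω) ^ (2 * q)) P ∧
      ∫ ω, (rms fun i => particleSize J u₀ ξ η i ω) ^ (2 * q) ∂P ≤ D' := by
    intro q D' hq
    have hi := Integrable.avg fun i => (hq i).1
    have hint : Integrable (fun ω => (rms fun i => particleSize J u₀ ξ η i ω) ^ (2 * q)) P :=
      hi.mono' ((measurable_rms hWm).pow_const _).aestronglyMeasurable
        (ae_of_all _ fun ω => by
          rw [Real.norm_of_nonneg (pow_nonneg (rms_nonneg _) _)]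
          exact rms_pow_two_mul_le q)
    refine ⟨hint, (integral_mono hint hi fun ω => rms_pow_two_mul_le q).trans ?_⟩
    rw [integral_avg fun i => (hq i).1]
    exact (avg_mono fun i => (hq i).2).trans (le_of_eq (avg_const D'))
  obtain ⟨hX1i, hX1⟩ := hX p D₁ (hD₁ N Ω P μ₀ u₀ ξ η H.input H.gaussian H.moment)
  obtain ⟨hX2i, hX2⟩ := hX (2 * p) D₂ (hD₂ N Ω P μ₀ u₀ ξ η H.input H.gaussian H.moment)
  have i1 := hX1i.const_mul (4 * A' ^ 2 * ε ^ 2)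
  have i2 := ((hRi.const_mul (N : ℝ)).add (hX2i.const_mul (N : ℝ)⁻¹)).const_mul (2 * A' ^ 2)
  have i3 := hZi.const_mul 2
  refine ⟨_, (i1.add i2).add i3, ?_, fun ω => ?_⟩
  · rw [integral_add' (i1.add i2) i3, integral_add' i1 i2, integral_const_mul, integral_const_mul,
      integral_const_mul, integral_add' (hRi.const_mul (N : ℝ)) (hX2i.const_mul (N : ℝ)⁻¹),
      integral_const_mul, integral_const_mul]
    have e1 : (N : ℝ) * ∫ ω, R ω ^ 4 ∂P ≤ A * (N : ℝ)⁻¹ := by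
      refine (mul_le_mul_of_nonneg_left hRA hN.le).trans (le_of_eq ?_)
      field_simp
    have e2 := mul_le_mul_of_nonneg_left hX2 (inv_nonneg.2 hN.le)
    have e3 := mul_le_mul_of_nonneg_left hX1 (by positivity : 0 ≤ 4 * A' ^ 2 * ε ^ 2)
    have e4 := mul_le_mul_of_nonneg_left (add_le_add e1 e2) (by positivity : 0 ≤ 2 * A' ^ 2)
    rw [div_eq_mul_inv] at hZb
    have e5 : 0 ≤ 4 * A' ^ 2 * D₁ * (N : ℝ)⁻¹ := by positivity
    have e6 : 0 ≤ (2 * A' ^ 2 * (A + D₂) + 2 * b) * ε ^ 2 := by positivity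
    linarith
  · have h1 := hpath N Ω P μ₀ u₀ ξ η y h Ψ₀ Ψ ε H φ hφ (R ω) ω (hR0 ω)
      (fun k hk => hUH k hk ω) (fun k hk => hHH k hk ω)
    refine le_trans ?_ (sq_add_error_le hN)
    rw [← sq_abs]
    refine pow_le_pow_left₀ (abs_nonneg _) ?_ 2
    -- The average over the mean-field particles is the intermediate point: the pathwise bound on
    -- one side, the centered fluctuation on the other.
    refine (abs_sub_le _ (avg fun i => φ (refState Ψ₀ h S Γ y μ₀ u₀ ξ η J i ω)) _).trans ?_
    exact add_le_add h1 le_rfl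

end MeanSquare

end EnKF

namespace EnKF

/-! ### Measurability of the particles -/

section ParticleMeasurability

variable {du dy N J : ℕ} {Ω : Type*} [MeasurableSpace Ω]

/-- Inversion is not continuous, but it is the product of the adjugate, which is polynomial, with
the inverse of the determinant, which is measurable. The formula also holds for singular matrices,
where both sides vanish. -/
lemma measurable_matrix_inv {n : ℕ} {A : Ω → Matrix (Fin n) (Fin n) ℝ}
    (hA : ∀ a b, Measurable fun ω => A ω a b) (a b : Fin n) : Measurable fun ω => (A ω)⁻¹ a b := by
  have hA' : Measurable fun ω => (fun a b => A ω a b : Fin n → Fin n → ℝ) :=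
    measurable_pi_iff.2 fun a => measurable_pi_iff.2 fun b => hA a b
  have hid : Continuous fun B : Fin n → Fin n → ℝ => (Matrix.of B : Matrix (Fin n) (Fin n) ℝ) :=
    continuous_id
  have h1 : Continuous fun B : Fin n → Fin n → ℝ => (Matrix.of B).det := hid.matrix_det
  have h2 : Continuous fun B : Fin n → Fin n → ℝ => (Matrix.of B).adjugate a b :=
    hid.matrix_adjugate.matrix_elem a b
  have h3 : ∀ ω, (A ω)⁻¹ a b = ((Matrix.of fun a b => A ω a b).det)⁻¹ *
      (Matrix.of fun a b => A ω a b).adjugate a b := fun ω => by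
    rw [Matrix.inv_def, Ring.inverse_eq_inv', Matrix.smul_apply, smul_eq_mul]
    rfl
  simp only [h3]
  exact ((h1.measurable.comp hA').inv).mul (h2.measurable.comp hA')

lemma measurable_tupleCov {f g : Fin N → Ω → ℝ} (hf : ∀ i, Measurable (f i))
    (hg : ∀ i, Measurable (g i)) :
    Measurable fun ω => tupleCov (fun i => f i ω) (fun i => g i ω) := by
  have havg : ∀ {F : Fin N → Ω → ℝ}, (∀ i, Measurable (F i)) →
      Measurable fun ω => avg fun i => F i ω := fun hF =>
    (Finset.measurable_fun_sum _ fun i _ => hF i).const_mul _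
  exact (havg fun i => (hf i).mul (hg i)).sub ((havg hf).mul (havg hg))

lemma measurable_vec {n : ℕ} {X : Ω → Vec n} (hX : ∀ a, Measurable fun ω => X ω a) :
    Measurable X := by
  have h1 : Measurable fun ω => (fun a => X ω a : Fin n → ℝ) := measurable_pi_iff.2 hX
  exact (PiLp.continuous_toLp 2 (fun _ : Fin n => ℝ)).measurable.comp h1

lemma measurable_coord {n : ℕ} {X : Ω → Vec n} (hX : Measurable X) (a : Fin n) :
    Measurable fun ω => X ω a :=
  (EuclideanSpace.proj a : Vec n →L[ℝ] ℝ).continuous.measurable.comp hX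

lemma measurable_analysis [NeZero N] {h : Vec du → Vec dy} (hh : Measurable h)
    (Γ : Matrix (Fin dy) (Fin dy) ℝ) (y : Vec dy) {x : Fin N → Ω → Vec du}
    {z : Fin N → Ω → Vec dy} (hx : ∀ i, Measurable (x i)) (hz : ∀ i, Measurable (z i))
    (i : Fin N) :
    Measurable fun ω => analysis h Γ y (fun i => x i ω) (fun i => z i ω) i := by
  have hxa : ∀ a i, Measurable fun ω => x i ω a := fun a i => measurable_coord (hx i) a
  have hha : ∀ a i, Measurable fun ω => h (x i ω) a := fun a i =>
    measurable_coord (hh.comp (hx i)) a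
  have hUH : ∀ a b, Measurable fun ω => covUH h (empirical fun k => (x k ω, z k ω)) a b :=
    fun a b => by
      simp only [covUH_empirical]
      exact measurable_tupleCov (hxa a) (hha b)
  have hHH : ∀ a b, Measurable fun ω => (covHH h (empirical fun k => (x k ω, z k ω)) + Γ) a b :=
    fun a b => by
      simp only [Matrix.add_apply, covHH_empirical]
      exact (measurable_tupleCov (hha a) (hha b)).add_const _
  refine (hx i).add (measurable_vec fun a => ?_)
  simp only [gain, Matrix.mulVec, dotProduct, Matrix.mul_apply]
  refine Finset.measurable_fun_sum _ fun b _ => (Finset.measurable_fun_sum _ fun c _ => ?_).mul ?_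
  · exact (hUH a c).mul (measurable_matrix_inv hHH c b)
  · exact measurable_coord ((measurable_const (a := y)).sub (hz i)) b

lemma IsInput.measurable_particles [NeZero N] {P : Measure Ω} {μ₀ : Measure (Vec du)}
    {S : Matrix (Fin du) (Fin du) ℝ} {Γ : Matrix (Fin dy) (Fin dy) ℝ}
    {u₀ : Fin N → Ω → Vec du} {ξ : ℕ → Fin N → Ω → Vec du} {η : ℕ → Fin N → Ω → Vec dy}
    (hI : IsInput P μ₀ S Γ J u₀ ξ η) {Ψ : Vec du → Vec du} (hΨ : Measurable Ψ)
    {h : Vec du → Vec dy} (hh : Measurable h) (y : ℕ → Vec dy) {j : ℕ} (hj : j ≤ J) (i : Fin N) :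
    Measurable fun ω => particles Ψ h Γ y (fun i => u₀ i ω) (fun j i => ξ j i ω)
      (fun j i => η j i ω) j i := by
  induction j generalizing i with
  | zero => exact hI.measurable_init i
  | succ j ih =>
    have hjJ : j < J := hj
    have h1 : ∀ i, Measurable fun ω => Ψ (particles Ψ h Γ y (fun i => u₀ i ω)
        (fun j i => ξ j i ω) (fun j i => η j i ω) j i) + ξ j i ω := fun i =>
      (hΨ.comp (ih hjJ.le i)).add (hI.measurable_state j hjJ i)
    exact measurable_analysis hh Γ (y (j + 1)) h1
      (fun i => (hh.comp (h1 i)).add (hI.measurable_obs j hjJ i)) i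

end ParticleMeasurability

end EnKF

namespace EnKF

/-! ### Weighted paths of the signal -/

section Paths

open scoped Matrix.Norms.L2Operator

variable {du dy : ℕ} {κy κΨ κh ℓh ℓΨ ε : ℝ} {J : ℕ} {y : ℕ → Vec dy} {h : Vec du → Vec dy}
  {Ψ₀ Ψ : Vec du → Vec du} {Γ : Matrix (Fin dy) (Fin dy) ℝ}

/-- The path of the signal with the given initial state and noises. -/
def path (Ψ : Vec du → Vec du) (u₀ : Vec du) (ξ : ℕ → Vec du) : ℕ → Vec du
  | 0 => u₀
  | j + 1 => Ψ (path Ψ u₀ ξ j) + ξ j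

/-- The likelihood of the data along a path of the signal. -/
noncomputable def pathWeight (h : Vec du → Vec dy) (Γ : Matrix (Fin dy) (Fin dy) ℝ)
    (y : ℕ → Vec dy) (Ψ : Vec du → Vec du) (u₀ : Vec du) (ξ : ℕ → Vec du) (j : ℕ) : ℝ :=
  ∏ k ∈ Finset.range j, likelihood h Γ (y (k + 1)) (path Ψ u₀ ξ (k + 1))

/-- The maximum of the density of `N(0, Γ)`. -/
noncomputable def densityMax {n : ℕ} (Γ : Matrix (Fin n) (Fin n) ℝ) : ℝ :=
  1 / √((2 * Real.pi) ^ n * Γ.det)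

lemma densityMax_pos {n : ℕ} {Γ : Matrix (Fin n) (Fin n) ℝ} (hΓ : Γ.PosDef) :
    0 < densityMax Γ := by
  have := hΓ.det_pos
  unfold densityMax
  positivity

lemma weightedSq_le {n : ℕ} (Γ : Matrix (Fin n) (Fin n) ℝ) (z : Vec n) :
    weightedSq Γ z ≤ ‖Γ⁻¹‖ * ‖z‖ ^ 2 := by
  have h1 := (le_abs_self _).trans (abs_dotProduct_le z (WithLp.toLp 2 (Γ⁻¹.mulVec z.ofLp)))
  have h2 := mul_le_mul_of_nonneg_left (norm_toLp_mulVec_le Γ⁻¹ z) (norm_nonneg z)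
  calc weightedSq Γ z ≤ ‖z‖ * (‖Γ⁻¹‖ * ‖z‖) := h1.trans h2
    _ = _ := by ring

/-- The difference is split bilinearly, one argument at a time, so symmetry of `Γ` is not used. -/
lemma abs_weightedSq_sub_le {n : ℕ} (Γ : Matrix (Fin n) (Fin n) ℝ) (z z' : Vec n) :
    |weightedSq Γ z - weightedSq Γ z'| ≤ ‖Γ⁻¹‖ * (‖z - z'‖ * (‖z‖ + ‖z'‖)) := by
  have h0 : weightedSq Γ z - weightedSq Γ z' =
      dotProduct (z - z').ofLp (WithLp.toLp 2 (Γ⁻¹.mulVec z.ofLp)).ofLp +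
        dotProduct z'.ofLp (WithLp.toLp 2 (Γ⁻¹.mulVec (z - z').ofLp)).ofLp := by
    simp only [weightedSq, WithLp.ofLp_sub, sub_dotProduct, Matrix.mulVec_sub, dotProduct_sub]
    ring
  have h1 := abs_dotProduct_le (z - z') (WithLp.toLp 2 (Γ⁻¹.mulVec z.ofLp))
  have h2 := mul_le_mul_of_nonneg_left (norm_toLp_mulVec_le Γ⁻¹ z) (norm_nonneg (z - z'))
  have h3 := abs_dotProduct_le z' (WithLp.toLp 2 (Γ⁻¹.mulVec (z - z').ofLp))
  have h4 := mul_le_mul_of_nonneg_left (norm_toLp_mulVec_le Γ⁻¹ (z - z')) (norm_nonneg z')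
  rw [h0]
  refine (abs_add_le _ _).trans ((add_le_add (h1.trans h2) (h3.trans h4)).trans (le_of_eq ?_))
  ring

lemma abs_exp_neg_sub_exp_neg_le {s t : ℝ} (hs : 0 ≤ s) (ht : 0 ≤ t) :
    |Real.exp (-s) - Real.exp (-t)| ≤ |s - t| := by
  wlog hst : s ≤ t generalizing s t
  · rw [abs_sub_comm, abs_sub_comm s t]
    exact this ht hs (le_of_not_ge hst)
  have h1 : Real.exp (-t) ≤ Real.exp (-s) := Real.exp_le_exp.2 (by linarith)
  rw [abs_of_nonneg (by linarith), abs_sub_comm, abs_of_nonneg (by linarith)]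
  have h2 := Real.add_one_le_exp (s - t)
  have h3 : Real.exp (-t) = Real.exp (-s) * Real.exp (s - t) := by
    rw [← Real.exp_add]
    ring_nf
  have h4 : Real.exp (-s) ≤ 1 := Real.exp_le_one_iff.2 (by linarith)
  have h5 := Real.exp_pos (-s)
  nlinarith

/-- The exponential is 1-Lipschitz on the negative half line, so the increment of the density is
governed by that of the quadratic form. -/
lemma abs_gaussianDensity_sub_le {n : ℕ} {Γ : Matrix (Fin n) (Fin n) ℝ} (hΓ : Γ.PosDef)
    (z z' : Vec n) : |gaussianDensity Γ z - gaussianDensity Γ z'| ≤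
      densityMax Γ * (‖Γ⁻¹‖ * (‖z - z'‖ * (‖z‖ + ‖z'‖))) := by
  have h1 := abs_exp_neg_sub_exp_neg_le (s := 1 / 2 * weightedSq Γ z)
    (t := 1 / 2 * weightedSq Γ z') (mul_nonneg (by norm_num) (weightedSq_nonneg hΓ z))
    (mul_nonneg (by norm_num) (weightedSq_nonneg hΓ z'))
  have h2 := abs_weightedSq_sub_le Γ z z'
  have h3 := abs_nonneg (weightedSq Γ z - weightedSq Γ z')
  rw [← mul_sub, abs_mul, abs_of_nonneg (by norm_num : (0 : ℝ) ≤ 1 / 2)] at h1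
  simp only [gaussianDensity, neg_mul]
  rw [← mul_sub, abs_mul, abs_of_nonneg (by positivity)]
  exact mul_le_mul_of_nonneg_left (by linarith) (densityMax_pos hΓ).le

lemma le_gaussianDensity {n : ℕ} {Γ : Matrix (Fin n) (Fin n) ℝ} (hΓ : Γ.PosDef) (z : Vec n) :
    densityMax Γ * Real.exp (-(‖Γ⁻¹‖ * ‖z‖ ^ 2)) ≤ gaussianDensity Γ z := by
  refine mul_le_mul_of_nonneg_left (Real.exp_le_exp.2 ?_) (densityMax_pos hΓ).le
  have h1 := weightedSq_le Γ z
  have h2 : 0 ≤ ‖Γ⁻¹‖ * ‖z‖ ^ 2 := by positivity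
  linarith

lemma likelihood_nonneg (y₁ : Vec dy) (u : Vec du) : 0 ≤ likelihood h Γ y₁ u :=
  gaussianDensity_nonneg Γ _

lemma likelihood_le (hΓ : Γ.PosDef) (y₁ : Vec dy) (u : Vec du) :
    likelihood h Γ y₁ u ≤ densityMax Γ := gaussianDensity_le hΓ _

lemma pathWeight_succ (u₀ : Vec du) (ξ : ℕ → Vec du) (j : ℕ) :
    pathWeight h Γ y Ψ u₀ ξ (j + 1) =
      pathWeight h Γ y Ψ u₀ ξ j * likelihood h Γ (y (j + 1)) (path Ψ u₀ ξ (j + 1)) :=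
  Finset.prod_range_succ _ _

lemma pathWeight_nonneg (u₀ : Vec du) (ξ : ℕ → Vec du) (j : ℕ) :
    0 ≤ pathWeight h Γ y Ψ u₀ ξ j :=
  Finset.prod_nonneg fun _ _ => likelihood_nonneg _ _

lemma pathWeight_le (hΓ : Γ.PosDef) (u₀ : Vec du) (ξ : ℕ → Vec du) (j : ℕ) :
    pathWeight h Γ y Ψ u₀ ξ j ≤ densityMax Γ ^ j := by
  refine (Finset.prod_le_prod (fun _ _ => likelihood_nonneg _ _)
    fun _ _ => likelihood_le hΓ _ _).trans (le_of_eq ?_)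
  simp

lemma exists_path_le (κy : ℝ) {κΨ : ℝ} (κh ℓh ℓΨ : ℝ) (J : ℕ) (hκΨ : 0 ≤ κΨ) (n : ℕ) :
    ∃ A : ℝ, 0 ≤ A ∧ ∀ (y : ℕ → Vec dy) (h : Vec du → Vec dy) (Ψ₀ Ψ : Vec du → Vec du) (ε : ℝ),
      ModelBounds κy κΨ κh ℓh ℓΨ J y h Ψ₀ Ψ ε → ∀ (u₀ : Vec du) (ξ : ℕ → Vec du) (η : ℕ → Vec dy),
      ∀ k ≤ n, k ≤ J → ‖path Ψ u₀ ξ k‖ ≤ A * inputSize J u₀ ξ η := by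
  induction n with
  | zero =>
    refine ⟨1, zero_le_one, fun y h Ψ₀ Ψ ε H u₀ ξ η k hk _ => ?_⟩
    obtain rfl : k = 0 := by omega
    rw [one_mul]
    exact norm_init_le_inputSize J u₀ ξ η
  | succ n ih =>
    obtain ⟨A, hA, ih⟩ := ih
    refine ⟨A + (2 + κΨ * (1 + A)), by positivity, fun y h Ψ₀ Ψ ε H u₀ ξ η k hk hkJ => ?_⟩
    have hW1 := one_le_inputSize J u₀ ξ η
    rcases Nat.le_succ_iff.1 hk with hk | rfl
    · refine (ih y h Ψ₀ Ψ ε H u₀ ξ η k hk hkJ).trans (mul_le_mul_of_nonneg_right ?_ (by linarith))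
      exact le_add_of_nonneg_right (by positivity)
    · refine (norm_pred_le H hW1 (ih y h Ψ₀ Ψ ε H u₀ ξ η n le_rfl (by omega))
        (norm_state_le_inputSize u₀ ξ η hkJ)).trans (mul_le_mul_of_nonneg_right ?_ (by linarith))
      exact le_add_of_nonneg_left hA

/-- The noises are shared and cancel; each step adds at most `ε` and multiplies the distance by the
Lipschitz constant of `Ψ₀`. The resulting bound is deterministic. -/
lemma exists_path_sub_le (κy : ℝ) {κΨ : ℝ} (κh ℓh ℓΨ : ℝ) (J : ℕ) (hκΨ : 0 ≤ κΨ) (n : ℕ) :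
    ∃ A : ℝ, 0 ≤ A ∧ ∀ (y : ℕ → Vec dy) (h : Vec du → Vec dy) (Ψ₀ Ψ : Vec du → Vec du) (ε : ℝ),
      ModelBounds κy κΨ κh ℓh ℓΨ J y h Ψ₀ Ψ ε → ∀ (u₀ : Vec du) (ξ : ℕ → Vec du),
      ∀ k ≤ n, ‖path Ψ u₀ ξ k - path Ψ₀ u₀ ξ k‖ ≤ A * ε := by
  induction n with
  | zero =>
    refine ⟨0, le_rfl, fun y h Ψ₀ Ψ ε H u₀ ξ k hk => ?_⟩
    obtain rfl : k = 0 := by omega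
    simp [path]
  | succ n ih =>
    obtain ⟨A, hA, ih⟩ := ih
    refine ⟨A + (1 + 3 * κΨ * A), by positivity, fun y h Ψ₀ Ψ ε H u₀ ξ k hk => ?_⟩
    have hε := H.eps_nonneg
    rcases Nat.le_succ_iff.1 hk with hk | rfl
    · refine (ih y h Ψ₀ Ψ ε H u₀ ξ k hk).trans (mul_le_mul_of_nonneg_right ?_ hε)
      exact le_add_of_nonneg_right (by positivity)
    · have h1 := H.close (path Ψ u₀ ξ n)
      have h2 := H.ref_lip (path Ψ u₀ ξ n) (path Ψ₀ u₀ ξ n)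
      have h3 := mul_le_mul_of_nonneg_left (ih y h Ψ₀ Ψ ε H u₀ ξ n le_rfl)
        (by positivity : 0 ≤ 3 * κΨ)
      have h4 : path Ψ u₀ ξ (n + 1) - path Ψ₀ u₀ ξ (n + 1) =
          (Ψ (path Ψ u₀ ξ n) - Ψ₀ (path Ψ u₀ ξ n)) +
            (Ψ₀ (path Ψ u₀ ξ n) - Ψ₀ (path Ψ₀ u₀ ξ n)) := by
        simp only [path]
        abel
      rw [h4]
      have h5 := norm_add_le (Ψ (path Ψ u₀ ξ n) - Ψ₀ (path Ψ u₀ ξ n))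
        (Ψ₀ (path Ψ u₀ ξ n) - Ψ₀ (path Ψ₀ u₀ ξ n))
      have h6 : 0 ≤ A * ε := by positivity
      linarith

/-- Bounds for paths and weights, uniform over the models. -/
lemma exists_pathWeight_bounds (hΓ : Γ.PosDef) {κy κΨ κh ℓh : ℝ} (ℓΨ : ℝ) (J : ℕ)
    (hκy : 0 ≤ κy) (hκΨ : 0 ≤ κΨ) (hκh : 0 ≤ κh) (hℓh : 0 ≤ ℓh) :
    ∃ A : ℝ, 0 ≤ A ∧ ∀ (y : ℕ → Vec dy) (h : Vec du → Vec dy) (Ψ₀ Ψ : Vec du → Vec du) (ε : ℝ),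
      ModelBounds κy κΨ κh ℓh ℓΨ J y h Ψ₀ Ψ ε → ∀ (u₀ : Vec du) (ξ : ℕ → Vec du) (η : ℕ → Vec dy),
      ‖path Ψ u₀ ξ J‖ ≤ A * inputSize J u₀ ξ η ∧ ‖path Ψ₀ u₀ ξ J‖ ≤ A * inputSize J u₀ ξ η ∧
      ‖path Ψ u₀ ξ J - path Ψ₀ u₀ ξ J‖ ≤ A * ε ∧
      |pathWeight h Γ y Ψ u₀ ξ J - pathWeight h Γ y Ψ₀ u₀ ξ J| ≤ A * ε * inputSize J u₀ ξ η ∧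
      densityMax Γ ^ J * Real.exp (-(A * inputSize J u₀ ξ η ^ 2)) ≤ pathWeight h Γ y Ψ u₀ ξ J ∧
      densityMax Γ ^ J * Real.exp (-(A * inputSize J u₀ ξ η ^ 2)) ≤
        pathWeight h Γ y Ψ₀ u₀ ξ J := by
  obtain ⟨A₁, hA₁, h₁⟩ := exists_path_le (du := du) (dy := dy) κy κh ℓh ℓΨ J hκΨ J
  obtain ⟨A₂, hA₂, h₂⟩ := exists_path_le (du := du) (dy := dy) κy κh ℓh (3 * κΨ) J hκΨ J
  obtain ⟨A₃, hA₃, h₃⟩ := exists_path_sub_le (du := du) (dy := dy) κy κh ℓh ℓΨ J hκΨ J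
  have hG := densityMax_pos hΓ
  obtain ⟨B, hB⟩ : ∃ B : ℝ, B = κy + κh * (1 + (A₁ + A₂)) := ⟨_, rfl⟩
  have hB0 : 0 ≤ B := by rw [hB]; positivity
  obtain ⟨A₄, hA₄⟩ : ∃ x : ℝ, x = densityMax Γ * (‖Γ⁻¹‖ * (ℓh * A₃ * (2 * B))) := ⟨_, rfl⟩
  have hA₄0 : 0 ≤ A₄ := by rw [hA₄]; positivity
  obtain ⟨A₅, hA₅⟩ : ∃ x : ℝ, x = ‖Γ⁻¹‖ * B ^ 2 := ⟨_, rfl⟩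
  have hA₅0 : 0 ≤ A₅ := by rw [hA₅]; positivity
  -- A telescoped difference of products has `J` terms, each with one likelihood increment and `J -
  -- 1` factors bounded by the maximal density.
  obtain ⟨A₆, hA₆⟩ : ∃ x : ℝ, x = ∑ j ∈ Finset.range J,
    densityMax Γ ^ (J - 1) * A₄ := ⟨_, rfl⟩
  have hA₆0 : 0 ≤ A₆ := by rw [hA₆]; exact Finset.sum_nonneg fun _ _ => by positivity
  have hsum : ∀ x ∈ ({A₁, A₂, A₃, A₆, J * A₅} : Finset ℝ),
      x ≤ A₁ + A₂ + A₃ + A₆ + J * A₅ := by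
    have : 0 ≤ J * A₅ := by positivity
    intro x hx
    simp only [Finset.mem_insert, Finset.mem_singleton] at hx
    rcases hx with rfl | rfl | rfl | rfl | rfl <;> linarith
  obtain ⟨A, hA⟩ : ∃ x : ℝ, x = A₁ + A₂ + A₃ + A₆ + J * A₅ := ⟨_, rfl⟩
  rw [← hA] at hsum
  have hA0 : 0 ≤ A := by rw [hA]; positivity
  refine ⟨A, hA0, fun y h Ψ₀ Ψ ε H u₀ ξ η => ?_⟩
  have hW1 := one_le_inputSize J u₀ ξ η
  have hp1 : ∀ k ≤ J, ‖path Ψ u₀ ξ k‖ ≤ A₁ * inputSize J u₀ ξ η := fun k hk =>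
    h₁ y h Ψ₀ Ψ ε H u₀ ξ η k hk hk
  have hp2 : ∀ k ≤ J, ‖path Ψ₀ u₀ ξ k‖ ≤ A₂ * inputSize J u₀ ξ η := fun k hk =>
    h₂ y h Ψ₀ Ψ₀ 0 H.reference u₀ ξ η k hk hk
  have hp3 : ∀ k ≤ J, ‖path Ψ u₀ ξ k - path Ψ₀ u₀ ξ k‖ ≤ A₃ * ε := fun k hk =>
    h₃ y h Ψ₀ Ψ ε H u₀ ξ k hk
  have hε := H.eps_nonneg
  generalize inputSize J u₀ ξ η = W at *
  have hW0 : 0 ≤ W := by linarith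
  have hres : ∀ u : Vec du, ‖u‖ ≤ (A₁ + A₂) * W → ∀ k < J, ‖y (k + 1) - h u‖ ≤ B * W := by
    intro u hu k hk
    have e1 := norm_sub_le (y (k + 1)) (h u)
    have e2 := H.obs k hk
    have e3 := H.obs_growth u
    have e4 : κh * (1 + ‖u‖) ≤ κh * (W + (A₁ + A₂) * W) :=
      mul_le_mul_of_nonneg_left (by linarith) hκh
    have e5 : κy ≤ κy * W := le_mul_of_one_le_right hκy hW1
    rw [hB]
    linarith
  have hA₂W : 0 ≤ A₂ * W := by positivity
  have hA₁W : 0 ≤ A₁ * W := by positivity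
  have hq1 : ∀ k ≤ J, ‖path Ψ u₀ ξ k‖ ≤ (A₁ + A₂) * W := fun k hk => by
    linarith [hp1 k hk]
  have hq2 : ∀ k ≤ J, ‖path Ψ₀ u₀ ξ k‖ ≤ (A₁ + A₂) * W := fun k hk => by
    linarith [hp2 k hk]
  -- The residuals grow linearly in `W`, so each likelihood is at least Gaussian in `W`; the product
  -- over the times multiplies the exponent by `J`.
  have hlow : ∀ Φ : Vec du → Vec du, (∀ k ≤ J, ‖path Φ u₀ ξ k‖ ≤ (A₁ + A₂) * W) →
      densityMax Γ ^ J * Real.exp (-(A * W ^ 2)) ≤ pathWeight h Γ y Φ u₀ ξ J := by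
    intro Φ hΦ
    calc densityMax Γ ^ J * Real.exp (-(A * W ^ 2))
        ≤ densityMax Γ ^ J * Real.exp (-(J * (A₅ * W ^ 2))) := by
          refine mul_le_mul_of_nonneg_left (Real.exp_le_exp.2 ?_) (by positivity)
          have := mul_le_mul_of_nonneg_right (hsum (J * A₅) (by simp)) (sq_nonneg W)
          linarith
      _ = ∏ _k ∈ Finset.range J, densityMax Γ * Real.exp (-(A₅ * W ^ 2)) := by
          rw [Finset.prod_const, Finset.card_range, mul_pow, ← Real.exp_nat_mul]
          ring_nf
      _ ≤ _ := by
          refine Finset.prod_le_prod (fun _ _ => by positivity) fun k hk => ?_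
          have hk' := Finset.mem_range.1 hk
          refine le_trans ?_ (le_gaussianDensity hΓ _)
          refine mul_le_mul_of_nonneg_left (Real.exp_le_exp.2 ?_) hG.le
          have e1 := hres _ (hΦ (k + 1) hk') k hk'
          have e2 : ‖Γ⁻¹‖ * ‖y (k + 1) - h (path Φ u₀ ξ (k + 1))‖ ^ 2 ≤ ‖Γ⁻¹‖ * (B * W) ^ 2 := by
            gcongr
          rw [hA₅]
          linarith
  refine ⟨(hp1 J le_rfl).trans (mul_le_mul_of_nonneg_right (hsum A₁ (by simp)) hW0),
    (hp2 J le_rfl).trans (mul_le_mul_of_nonneg_right (hsum A₂ (by simp)) hW0),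
    (hp3 J le_rfl).trans (mul_le_mul_of_nonneg_right (hsum A₃ (by simp)) hε), ?_,
    hlow Ψ hq1, hlow Ψ₀ hq2⟩
  have hlik : ∀ k < J, |likelihood h Γ (y (k + 1)) (path Ψ u₀ ξ (k + 1)) -
      likelihood h Γ (y (k + 1)) (path Ψ₀ u₀ ξ (k + 1))| ≤ A₄ * (ε * W) := by
    intro k hk
    refine (abs_gaussianDensity_sub_le hΓ _ _).trans ?_
    have e1 := hres _ (hq1 (k + 1) hk) k hk
    have e2 := hres _ (hq2 (k + 1) hk) k hk
    have e3 : ‖(y (k + 1) - h (path Ψ u₀ ξ (k + 1))) - (y (k + 1) - h (path Ψ₀ u₀ ξ (k + 1)))‖ ≤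
        ℓh * (A₃ * ε) := by
      rw [sub_sub_sub_cancel_left, norm_sub_rev]
      exact (H.obs_lip _ _).trans (mul_le_mul_of_nonneg_left (hp3 (k + 1) hk) hℓh)
    calc _ ≤ densityMax Γ * (‖Γ⁻¹‖ * (ℓh * (A₃ * ε) * (B * W + B * W))) := by gcongr
      _ = _ := by rw [hA₄]; ring
  -- Multiplying by one more factor `densityMax Γ` avoids the exponent `n - 1` in the induction. The
  -- factor is cancelled at the end, where `J = 0` needs separate treatment.
  have hprod : ∀ n ≤ J, |pathWeight h Γ y Ψ u₀ ξ n - pathWeight h Γ y Ψ₀ u₀ ξ n| * densityMax Γ ≤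
      n * (densityMax Γ ^ n * (A₄ * (ε * W))) := by
    intro n hn
    induction n with
    | zero => simp [pathWeight]
    | succ n ih =>
      have i1 := ih (by omega)
      rw [pathWeight_succ, pathWeight_succ]
      have e0 : pathWeight h Γ y Ψ u₀ ξ n * likelihood h Γ (y (n + 1)) (path Ψ u₀ ξ (n + 1)) -
          pathWeight h Γ y Ψ₀ u₀ ξ n * likelihood h Γ (y (n + 1)) (path Ψ₀ u₀ ξ (n + 1)) =
          (pathWeight h Γ y Ψ u₀ ξ n - pathWeight h Γ y Ψ₀ u₀ ξ n) *
            likelihood h Γ (y (n + 1)) (path Ψ u₀ ξ (n + 1)) +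
          pathWeight h Γ y Ψ₀ u₀ ξ n * (likelihood h Γ (y (n + 1)) (path Ψ u₀ ξ (n + 1)) -
            likelihood h Γ (y (n + 1)) (path Ψ₀ u₀ ξ (n + 1))) := by ring
      rw [e0]
      have e1 : |(pathWeight h Γ y Ψ u₀ ξ n - pathWeight h Γ y Ψ₀ u₀ ξ n) *
            likelihood h Γ (y (n + 1)) (path Ψ u₀ ξ (n + 1))| ≤
          n * (densityMax Γ ^ n * (A₄ * (ε * W))) := by
        rw [abs_mul, abs_of_nonneg (likelihood_nonneg (h := h) (Γ := Γ) _ _)]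
        exact (mul_le_mul_of_nonneg_left (likelihood_le hΓ _ _) (abs_nonneg _)).trans i1
      have e2 : |pathWeight h Γ y Ψ₀ u₀ ξ n *
          (likelihood h Γ (y (n + 1)) (path Ψ u₀ ξ (n + 1)) -
            likelihood h Γ (y (n + 1)) (path Ψ₀ u₀ ξ (n + 1)))| ≤
          densityMax Γ ^ n * (A₄ * (ε * W)) := by
        rw [abs_mul, abs_of_nonneg (pathWeight_nonneg (h := h) (Γ := Γ) (y := y) _ _ _)]
        exact mul_le_mul (pathWeight_le hΓ _ _ _) (hlik n hn) (abs_nonneg _) (by positivity)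
      have e3 := mul_le_mul_of_nonneg_right ((abs_add_le _ _).trans (add_le_add e1 e2)) hG.le
      refine e3.trans (le_of_eq ?_)
      push_cast
      ring
  have hfin := hprod J le_rfl
  rcases Nat.eq_zero_or_pos J with hJ | hJ
  · rw [hJ]
    simp only [pathWeight, Finset.range_zero, Finset.prod_empty, sub_self, abs_zero]
    positivity
  · have hGJ : densityMax Γ ^ J = densityMax Γ ^ (J - 1) * densityMax Γ := by
      rw [← pow_succ, Nat.sub_add_cancel hJ]
    have h6 : |pathWeight h Γ y Ψ u₀ ξ J - pathWeight h Γ y Ψ₀ u₀ ξ J| ≤ A₆ * (ε * W) := by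
      refine le_of_mul_le_mul_right (hfin.trans (le_of_eq ?_)) hG
      rw [hA₆, Finset.sum_const, Finset.card_range, nsmul_eq_mul, hGJ]
      ring
    refine h6.trans ?_
    rw [mul_assoc]
    exact mul_le_mul_of_nonneg_right (hsum A₆ (by simp)) (by positivity)

end Paths

end EnKF

namespace EnKF

/-! ### The filter as a normalized weighted expectation over paths -/

section FilterRepresentation

universe w

variable {du dy N J : ℕ} {Ω : Type*} [mΩ : MeasurableSpace Ω] {P : Measure Ω}
  [IsProbabilityMeasure P] {μ₀ : Measure (Vec du)} {S : Matrix (Fin du) (Fin du) ℝ}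
  {Γ : Matrix (Fin dy) (Fin dy) ℝ} {u₀ : Fin N → Ω → Vec du} {ξ : ℕ → Fin N → Ω → Vec du}
  {η : ℕ → Fin N → Ω → Vec dy}

omit mΩ in
lemma measurable_path {Ψ : Vec du → Vec du} (hΨ : Measurable Ψ) (i : Fin N) {j : ℕ} (hj : j ≤ J) :
    Measurable[sigmaOf u₀ ξ η (pastOf J i j)] fun ω => path Ψ (u₀ i ω) (fun k => ξ k i ω) j := by
  induction j with
  | zero => exact measurable_sigmaOf_init ⟨rfl, le_rfl⟩
  | succ j ih =>
    have hjJ : j < J := hj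
    have h1 := Measurable.mono (ih hjJ.le) (sigmaOf_mono (u₀ := u₀) (ξ := ξ) (η := η)
      (s := pastOf J i j) (t := pastOf J i (j + 1)) fun k hk => ⟨hk.1, hk.2.trans (Nat.le_succ j)⟩)
      le_rfl
    have h2 : Measurable[sigmaOf u₀ ξ η (pastOf J i (j + 1))] (ξ j i) :=
      measurable_sigmaOf_state hjJ ⟨rfl, le_rfl⟩
    exact (hΨ.comp h1).add h2

omit mΩ in
lemma measurable_pathWeight {Ψ : Vec du → Vec du} (hΨ : Measurable Ψ) {h : Vec du → Vec dy}
    (hh : Measurable h) (Γ : Matrix (Fin dy) (Fin dy) ℝ) (y : ℕ → Vec dy) (i : Fin N) {j : ℕ}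
    (hj : j ≤ J) :
    Measurable[sigmaOf u₀ ξ η (pastOf J i j)]
      fun ω => pathWeight h Γ y Ψ (u₀ i ω) (fun k => ξ k i ω) j := by
  refine Finset.measurable_fun_prod _ fun k hk => ?_
  have hk' : k + 1 ≤ j := Finset.mem_range.1 hk
  exact (measurable_likelihood hh Γ (y (k + 1))).comp
    (Measurable.mono (measurable_path hΨ i (hk'.trans hj)) (sigmaOf_mono (u₀ := u₀) (ξ := ξ)
      (η := η) fun s hs => ⟨hs.1, hs.2.trans hk'⟩) le_rfl)

lemma lintegral_comp_of_indepFun {E F : Type*} [MeasurableSpace E] [MeasurableSpace F]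
    {X : Ω → E} {Z : Ω → F} (hX : Measurable X) (hZ : Measurable Z) (hXZ : IndepFun X Z P)
    {G : E → F → ENNReal} (hG : Measurable (Function.uncurry G)) :
    ∫⁻ ω, G (X ω) (Z ω) ∂P = ∫⁻ ω, ∫⁻ z, G (X ω) z ∂(P.map Z) ∂P := by
  have h1 := (indepFun_iff_map_prod_eq_prod_map_map hX.aemeasurable hZ.aemeasurable).1 hXZ
  have : IsProbabilityMeasure (P.map Z) := Measure.isProbabilityMeasure_map hZ.aemeasurable
  have h2 : ∫⁻ ω, G (X ω) (Z ω) ∂P =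
      ∫⁻ p, Function.uncurry G p ∂(P.map fun ω => (X ω, Z ω)) := by
    rw [lintegral_map hG (hX.prodMk hZ)]
    rfl
  rw [h2, h1, lintegral_prod _ hG.aemeasurable, lintegral_map hG.lintegral_prod_right' hX]
  rfl

/-- The filter is the normalized law of the signal, weighted with the likelihood of the data. -/
lemma IsInput.lintegral_trueFilter (hI : IsInput P μ₀ S Γ J u₀ ξ η) (hS : S.PosDef)
    (hΓ : Γ.PosDef) {Ψ : Vec du → Vec du} (hΨ : Measurable Ψ) {h : Vec du → Vec dy}
    (hh : Measurable h) (y : ℕ → Vec dy) (i : Fin N) {j : ℕ} (hj : j ≤ J)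
    {F : Vec du → ENNReal} (hF : Measurable F) :
    (∫⁻ ω, ENNReal.ofReal (pathWeight h Γ y Ψ (u₀ i ω) (fun k => ξ k i ω) j) ∂P) *
        ∫⁻ u, F u ∂(trueFilter Ψ h S Γ y μ₀ j) =
      ∫⁻ ω, ENNReal.ofReal (pathWeight h Γ y Ψ (u₀ i ω) (fun k => ξ k i ω) j) *
        F (path Ψ (u₀ i ω) (fun k => ξ k i ω) j) ∂P := by
  have hμ₀ : IsProbabilityMeasure μ₀ := by
    rw [← hI.law_init i]
    exact Measure.isProbabilityMeasure_map (hI.measurable_init i).aemeasurable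
  induction j generalizing F with
  | zero =>
    simp only [pathWeight, Finset.range_zero, Finset.prod_empty, ENNReal.ofReal_one, one_mul,
      lintegral_const, measure_univ, path, trueFilter]
    rw [← hI.law_init i, lintegral_map hF (hI.measurable_init i)]
  | succ j ih =>
    have hjJ : j < J := hj
    have hprob := isProbabilityMeasure_trueFilter hh hΨ hS hΓ y μ₀ j
    have hL := (measurable_likelihood hh Γ (y (j + 1))).ennreal_ofReal
    -- One step without normalization: the new noise is independent of the past weight and state, so
    -- it may be integrated out first, which is the prediction step.
    have hstep : ∀ {G : Vec du → ENNReal}, Measurable G →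
        (∫⁻ ω, ENNReal.ofReal (pathWeight h Γ y Ψ (u₀ i ω) (fun k => ξ k i ω) j) ∂P) *
          ∫⁻ u, ENNReal.ofReal (likelihood h Γ (y (j + 1)) u) * G u
            ∂(predLaw Ψ S (trueFilter Ψ h S Γ y μ₀ j)) =
        ∫⁻ ω, ENNReal.ofReal (pathWeight h Γ y Ψ (u₀ i ω) (fun k => ξ k i ω) (j + 1)) *
          G (path Ψ (u₀ i ω) (fun k => ξ k i ω) (j + 1)) ∂P := by
      intro G hG
      obtain ⟨K, hK⟩ : ∃ K : Vec du → ENNReal,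
          K = fun u => ENNReal.ofReal (likelihood h Γ (y (j + 1)) u) * G u := ⟨_, rfl⟩
      have hKm : Measurable K := by
        rw [hK]
        exact hL.mul hG
      have hm : Measurable fun p : Vec du × Vec du => K (Ψ p.1 + p.2) := by fun_prop
      have hU := measurable_path (u₀ := u₀) (ξ := ξ) (η := η) hΨ i hjJ.le
      have hw := measurable_pathWeight (u₀ := u₀) (ξ := ξ) (η := η) hΨ hh Γ y i hjJ.le
      have hind := hI.indepFun (disjoint_pastOf_state i hjJ) (hw.prodMk hU)
        (measurable_sigmaOf_state hjJ rfl)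
      have hmeas := (hw.prodMk hU).mono (hI.sigmaOf_le _) le_rfl
      have hmG : Measurable fun q : (ℝ × Vec du) × Vec du =>
          ENNReal.ofReal q.1.1 * K (Ψ q.1.2 + q.2) := by fun_prop
      have h1 := lintegral_comp_of_indepFun hmeas (hI.measurable_state j hjJ i) hind
        (G := fun (x : ℝ × Vec du) (z : Vec du) => ENNReal.ofReal x.1 * K (Ψ x.2 + z)) hmG
      rw [hI.law_state j hjJ i] at h1
      have h2 : ∀ ω, ENNReal.ofReal (pathWeight h Γ y Ψ (u₀ i ω) (fun k => ξ k i ω) (j + 1)) *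
          G (path Ψ (u₀ i ω) (fun k => ξ k i ω) (j + 1)) =
          ENNReal.ofReal (pathWeight h Γ y Ψ (u₀ i ω) (fun k => ξ k i ω) j) *
          K (Ψ (path Ψ (u₀ i ω) (fun k => ξ k i ω) j) + ξ j i ω) := fun ω => by
        rw [pathWeight_succ, ENNReal.ofReal_mul (pathWeight_nonneg _ _ _), mul_assoc, hK]
        rfl
      have h3 : ∫⁻ u, ENNReal.ofReal (likelihood h Γ (y (j + 1)) u) * G u
          ∂(predLaw Ψ S (trueFilter Ψ h S Γ y μ₀ j)) =
          ∫⁻ u, K u ∂(predLaw Ψ S (trueFilter Ψ h S Γ y μ₀ j)) := by rw [hK]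
      simp only [h2]
      rw [h3, lintegral_predLaw hΨ S _ hKm, ih hjJ.le hm.lintegral_prod_right']
      refine Eq.trans ?_ h1.symm
      refine lintegral_congr fun ω => ?_
      exact (lintegral_const_mul _ (by fun_prop)).symm
    have hprob2 := isProbabilityMeasure_predLaw hΨ S (trueFilter Ψ h S Γ y μ₀ j)
    have hc0 := lintegral_likelihood_ne_zero hh hΓ (y (j + 1))
      (predLaw Ψ S (trueFilter Ψ h S Γ y μ₀ j))
    have hct := lintegral_likelihood_ne_top (h := h) hΓ (y (j + 1))
      (predLaw Ψ S (trueFilter Ψ h S Γ y μ₀ j))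
    -- The constant test function shows how the total mass changes; this change is the normalizing
    -- constant of the filter, so the two cancel.
    have h1 := hstep (G := fun _ => 1) measurable_const
    simp only [mul_one] at h1
    rw [← h1, ← hstep hF, trueFilter_succ hh hΨ hS hΓ, lintegral_smul_measure,
      lintegral_withDensity_eq_lintegral_mul _ hL hF, smul_eq_mul]
    simp only [Pi.mul_apply]
    rw [mul_assoc, ← mul_assoc _ (_⁻¹), ENNReal.mul_inv_cancel hc0 hct, one_mul]

omit [IsProbabilityMeasure P] in
/-- A measure whose multiple is a weighted law has weighted expectations as integrals. -/
lemma integral_of_lintegral_mul_eq {E : Type*} [MeasurableSpace E] {μ : Measure E} {U : Ω → E}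
    (hU : Measurable U) {w : Ω → ℝ} (hw : Measurable w) (hw0 : ∀ ω, 0 ≤ w ω)
    (hwi : Integrable w P) (hZ : 0 < ∫ ω, w ω ∂P)
    (hid : ∀ F : E → ENNReal, Measurable F → (∫⁻ ω, ENNReal.ofReal (w ω) ∂P) * ∫⁻ u, F u ∂μ =
      ∫⁻ ω, ENNReal.ofReal (w ω) * F (U ω) ∂P) {φ : E → ℝ} (hφm : Measurable φ)
    (hφ : Integrable (fun ω => w ω * φ (U ω)) P) :
    Integrable φ μ ∧ (∫ ω, w ω ∂P) * ∫ u, φ u ∂μ = ∫ ω, w ω * φ (U ω) ∂P := by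
  have hz : ∫⁻ ω, ENNReal.ofReal (w ω) ∂P = ENNReal.ofReal (∫ ω, w ω ∂P) :=
    (ofReal_integral_eq_lintegral_ofReal hwi (ae_of_all _ hw0)).symm
  have hn : Measurable fun ω => (w ω).toNNReal := hw.real_toNNReal
  -- Identifying the measures themselves transfers integrability and signed integrals at once from
  -- the identity for nonnegative functions.
  have hmeas : ENNReal.ofReal (∫ ω, w ω ∂P) • μ =
      (P.withDensity fun ω => ((w ω).toNNReal : ENNReal)).map U := by
    refine Measure.ext fun s hs => ?_
    have h1 := hid (s.indicator 1) (measurable_one.indicator hs)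
    have hi : Measurable fun ω => s.indicator (1 : E → ENNReal) (U ω) :=
      (measurable_one.indicator hs).comp hU
    rw [lintegral_indicator_one hs, hz] at h1
    rw [Measure.smul_apply, smul_eq_mul, h1, ← lintegral_indicator_one hs,
      lintegral_map (measurable_one.indicator hs) hU,
      lintegral_withDensity_eq_lintegral_mul _ hn.coe_nnreal_ennreal hi]
    rfl
  have hsm : ∀ ω, (w ω).toNNReal • φ (U ω) = w ω * φ (U ω) := fun ω => by
    rw [NNReal.smul_def, Real.coe_toNNReal _ (hw0 ω), smul_eq_mul]
  have hz0 : ENNReal.ofReal (∫ ω, w ω ∂P) ≠ 0 := by simpa using hZ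
  constructor
  · rw [← integrable_smul_measure hz0 ENNReal.ofReal_ne_top, hmeas,
      integrable_map_measure hφm.aestronglyMeasurable hU.aemeasurable,
      integrable_withDensity_iff_integrable_smul hn]
    simpa only [Function.comp_apply, hsm] using hφ
  · have h2 : ∫ u, φ u ∂(ENNReal.ofReal (∫ ω, w ω ∂P) • μ) = ∫ ω, w ω * φ (U ω) ∂P := by
      rw [hmeas, integral_map hU.aemeasurable hφm.aestronglyMeasurable,
        integral_withDensity_eq_integral_smul hn]
      simp only [hsm]
    rwa [integral_smul_measure, ENNReal.toReal_ofReal hZ.le, smul_eq_mul] at h2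

/-- Integrals with respect to the filter, as weighted expectations. -/
lemma IsInput.integral_trueFilter (hI : IsInput P μ₀ S Γ J u₀ ξ η) (hS : S.PosDef)
    (hΓ : Γ.PosDef) {Ψ : Vec du → Vec du} (hΨ : Measurable Ψ) {h : Vec du → Vec dy}
    (hh : Measurable h) (y : ℕ → Vec dy) (i : Fin N) {φ : Vec du → ℝ} (hφm : Measurable φ)
    (hφ : Integrable (fun ω => pathWeight h Γ y Ψ (u₀ i ω) (fun k => ξ k i ω) J *
      φ (path Ψ (u₀ i ω) (fun k => ξ k i ω) J)) P)
    (hZ : 0 < ∫ ω, pathWeight h Γ y Ψ (u₀ i ω) (fun k => ξ k i ω) J ∂P) :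
    Integrable φ (trueFilter Ψ h S Γ y μ₀ J) ∧
    (∫ ω, pathWeight h Γ y Ψ (u₀ i ω) (fun k => ξ k i ω) J ∂P) *
        ∫ u, φ u ∂(trueFilter Ψ h S Γ y μ₀ J) =
      ∫ ω, pathWeight h Γ y Ψ (u₀ i ω) (fun k => ξ k i ω) J *
        φ (path Ψ (u₀ i ω) (fun k => ξ k i ω) J) ∂P := by
  have hw := (measurable_pathWeight (u₀ := u₀) (ξ := ξ) (η := η) hΨ hh Γ y i le_rfl).mono
    (hI.sigmaOf_le _) le_rfl
  refine integral_of_lintegral_mul_eq ((measurable_path (u₀ := u₀) (ξ := ξ) (η := η) hΨ i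
    le_rfl).mono (hI.sigmaOf_le _) le_rfl) hw (fun ω => pathWeight_nonneg _ _ _)
    (Integrable.of_bound hw.aestronglyMeasurable (densityMax Γ ^ J) (ae_of_all _ fun ω => ?_)) hZ
    (fun F hF => hI.lintegral_trueFilter hS hΓ hΨ hh y i le_rfl hF) hφm hφ
  rw [Real.norm_of_nonneg (pathWeight_nonneg _ _ _)]
  exact pathWeight_le hΓ _ _ _

end FilterRepresentation

end EnKF

namespace EnKF

/-! ### Stability of the filter under perturbations of the dynamics -/

section Stability

universe w

variable {du dy : ℕ}

/-- From `Z * (m - m₀) = (X - X₀) - (Z - Z₀) * m₀`. Both denominators only need the common lower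
bound `c`. -/
lemma abs_quotient_sub_le {c Z Z₀ m m₀ X X₀ α β γ ε : ℝ} (hc : 0 < c) (hZ : c ≤ Z)
    (hZ₀ : c ≤ Z₀) (hm : Z * m = X) (hm₀ : Z₀ * m₀ = X₀) (hX₀ : |X₀| ≤ α)
    (hXX : |X - X₀| ≤ β * ε) (hZZ : |Z - Z₀| ≤ γ * ε) :
    |m - m₀| ≤ (β + γ * (α / c)) / c * ε := by
  have hZp : 0 < Z := hc.trans_le hZ
  have hα : 0 ≤ α := (abs_nonneg _).trans hX₀
  have hm₀' : |m₀| ≤ α / c := by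
    rw [le_div_iff₀ hc]
    calc |m₀| * c ≤ |m₀| * Z₀ := mul_le_mul_of_nonneg_left hZ₀ (abs_nonneg _)
      _ = |X₀| := by rw [← hm₀, abs_mul, abs_of_pos (hc.trans_le hZ₀), mul_comm]
      _ ≤ α := hX₀
  have h1 : Z * (m - m₀) = (X - X₀) - (Z - Z₀) * m₀ := by rw [← hm, ← hm₀]; ring
  have h2 : |Z * (m - m₀)| ≤ β * ε + γ * ε * (α / c) := by
    rw [h1]
    refine (abs_sub _ _).trans (add_le_add hXX ?_)
    rw [abs_mul]
    exact mul_le_mul hZZ hm₀' (abs_nonneg _) ((abs_nonneg _).trans hZZ)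
  rw [abs_mul, abs_of_pos hZp] at h2
  have h3 : c * |m - m₀| ≤ β * ε + γ * ε * (α / c) :=
    (mul_le_mul_of_nonneg_right hZ (abs_nonneg _)).trans h2
  have h4 : |m - m₀| ≤ (β * ε + γ * ε * (α / c)) / c := by
    rw [le_div_iff₀ hc]
    linarith
  refine h4.trans (le_of_eq ?_)
  ring

/-- Jensen's inequality through the tangent of `t ↦ exp (-t)` at `m`, which also covers a mean
strictly below `m`. -/
lemma le_integral_exp_neg {Ω : Type*} [MeasurableSpace Ω] {P : Measure Ω}
    [IsProbabilityMeasure P] {f : Ω → ℝ} (hf : Integrable f P)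
    (hfe : Integrable (fun ω => Real.exp (-f ω)) P) {m : ℝ} (hm : ∫ ω, f ω ∂P ≤ m) :
    Real.exp (-m) ≤ ∫ ω, Real.exp (-f ω) ∂P := by
  have h1 : ∀ ω, Real.exp (-m) * (1 + m - f ω) ≤ Real.exp (-f ω) := fun ω => by
    have h2 := Real.add_one_le_exp (m - f ω)
    have h3 : Real.exp (-f ω) = Real.exp (-m) * Real.exp (m - f ω) := by
      rw [← Real.exp_add]
      ring_nf
    rw [h3]
    exact mul_le_mul_of_nonneg_left (by linarith) (Real.exp_pos _).le
  have hi : Integrable (fun ω => Real.exp (-m) * (1 + m - f ω)) P :=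
    ((integrable_const _).sub hf).const_mul _
  refine le_trans ?_ (integral_mono hi hfe h1)
  rw [integral_const_mul, integral_sub (integrable_const _) hf]
  simp only [integral_const, probReal_univ, one_smul]
  have := Real.exp_pos (-m)
  nlinarith

/-- Perturbation of a normalized weighted expectation. -/
lemma weighted_expectation_sub_le {Ω : Type*} [MeasurableSpace Ω] {P : Measure Ω}
    [IsProbabilityMeasure P] {W w w₀ : Ω → ℝ} {U U₀ : Ω → Vec du} (hWm : Measurable W)
    (hwm : Measurable w) (hw₀m : Measurable w₀) (hUm : Measurable U) (hU₀m : Measurable U₀)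
    {A D L g ε : ℝ} (hA : 0 ≤ A) (hL : 0 ≤ L) (hg0 : 0 < g) (hε : 0 ≤ ε) (hW1 : ∀ ω, 1 ≤ W ω)
    (hW3i : Integrable (fun ω => W ω ^ 3) P) (hW3 : ∫ ω, W ω ^ 3 ∂P ≤ D)
    (hw0 : ∀ ω, 0 ≤ w ω) (hw₀0 : ∀ ω, 0 ≤ w₀ ω) (hwg : ∀ ω, w ω ≤ g) (hw₀g : ∀ ω, w₀ ω ≤ g)
    (hbd : ∀ ω, ‖U ω‖ ≤ A * W ω ∧ ‖U₀ ω‖ ≤ A * W ω ∧ ‖U ω - U₀ ω‖ ≤ A * ε ∧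
      |w ω - w₀ ω| ≤ A * ε * W ω ∧ g * Real.exp (-(A * W ω ^ 2)) ≤ w ω ∧
      g * Real.exp (-(A * W ω ^ 2)) ≤ w₀ ω)
    {φ : Vec du → ℝ} (hφ0 : φ 0 = 0)
    (hφ : ∀ u v, |φ u - φ v| ≤ L * ‖u - v‖ * (1 + ‖u‖ + ‖v‖)) {Q Q₀ : Prop} {m m₀ : ℝ}
    (hrep : Integrable (fun ω => w ω * φ (U ω)) P → 0 < ∫ ω, w ω ∂P →
      Q ∧ (∫ ω, w ω ∂P) * m = ∫ ω, w ω * φ (U ω) ∂P)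
    (hrep₀ : Integrable (fun ω => w₀ ω * φ (U₀ ω)) P → 0 < ∫ ω, w₀ ω ∂P →
      Q₀ ∧ (∫ ω, w₀ ω ∂P) * m₀ = ∫ ω, w₀ ω * φ (U₀ ω) ∂P) :
    Q ∧ |m - m₀| ≤ ((g * (L * A * (1 + 2 * A)) + A * (L * (A * (1 + A)))) * D +
      A * D * (g * (L * (A * (1 + A))) * D / (g * Real.exp (-(A * D))))) /
      (g * Real.exp (-(A * D))) * ε := by
  have hφm : Measurable φ := (continuous_of_abs_sub_le hφ).measurable
  obtain ⟨a, ha⟩ : ∃ a : ℝ, a = L * (A * (1 + A)) := ⟨_, rfl⟩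
  have ha0 : 0 ≤ a := by rw [ha]; positivity
  obtain ⟨b, hb⟩ : ∃ b : ℝ, b = g * (L * A * (1 + 2 * A)) + A * a := ⟨_, rfl⟩
  have hb0 : 0 ≤ b := by rw [hb]; positivity
  rw [← ha, ← hb]
  have hW0 : ∀ ω, 0 ≤ W ω := fun ω => zero_le_one.trans (hW1 ω)
  have hWk : ∀ {k : ℕ}, k ≤ 3 → Integrable (fun ω => W ω ^ k) P ∧ ∫ ω, W ω ^ k ∂P ≤ D := by
    intro k hk
    have hle : ∀ ω, W ω ^ k ≤ W ω ^ 3 := fun ω => pow_le_pow_right₀ (hW1 ω) hk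
    have hint : Integrable (fun ω => W ω ^ k) P :=
      hW3i.mono' (hWm.pow_const k).aestronglyMeasurable (ae_of_all _ fun ω => by
        rw [Real.norm_of_nonneg (pow_nonneg (hW0 ω) _)]
        exact hle ω)
    exact ⟨hint, (integral_mono hint hW3i hle).trans hW3⟩
  have hφU : ∀ ω, |φ (U ω)| ≤ a * W ω ^ 2 := fun ω => by
    rw [ha]; exact abs_le_mul_sq hL hφ0 hφ (hW1 ω) (hbd ω).1
  have hφU₀ : ∀ ω, |φ (U₀ ω)| ≤ a * W ω ^ 2 := fun ω => by
    rw [ha]; exact abs_le_mul_sq hL hφ0 hφ (hW1 ω) (hbd ω).2.1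
  have hprod : ∀ {v : Ω → ℝ} {V : Ω → Vec du}, Measurable v → Measurable V → (∀ ω, 0 ≤ v ω) →
      (∀ ω, v ω ≤ g) → (∀ ω, |φ (V ω)| ≤ a * W ω ^ 2) →
      Integrable (fun ω => v ω * φ (V ω)) P ∧ |∫ ω, v ω * φ (V ω) ∂P| ≤ g * a * D := by
    intro v V hv hV hv0 hvg hφV
    have hle : ∀ ω, |v ω * φ (V ω)| ≤ g * a * W ω ^ 2 := fun ω => by
      rw [abs_mul, abs_of_nonneg (hv0 ω), mul_assoc]
      exact mul_le_mul (hvg ω) (hφV ω) (abs_nonneg _) hg0.le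
    have hint : Integrable (fun ω => v ω * φ (V ω)) P :=
      ((hWk (k := 2) (by norm_num)).1.const_mul (g * a)).mono'
        (hv.mul (hφm.comp hV)).aestronglyMeasurable (ae_of_all _ hle)
    refine ⟨hint, abs_integral_le_integral_abs.trans ((integral_mono hint.abs
      ((hWk (k := 2) (by norm_num)).1.const_mul (g * a)) hle).trans ?_)⟩
    rw [integral_const_mul]
    exact mul_le_mul_of_nonneg_left (hWk (by norm_num)).2 (by positivity)
  -- The normalizing constants are bounded below by a second moment of the input size alone,
  -- uniformly over the models and the data.
  have hmass : ∀ {v : Ω → ℝ}, Measurable v → (∀ ω, 0 ≤ v ω) → (∀ ω, v ω ≤ g) →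
      (∀ ω, g * Real.exp (-(A * W ω ^ 2)) ≤ v ω) →
      Integrable v P ∧ g * Real.exp (-(A * D)) ≤ ∫ ω, v ω ∂P := by
    intro v hv hv0 hvg hvl
    have hvi : Integrable v P := Integrable.of_bound hv.aestronglyMeasurable g
      (ae_of_all _ fun ω => by rw [Real.norm_of_nonneg (hv0 ω)]; exact hvg ω)
    have hei : Integrable (fun ω => Real.exp (-(A * W ω ^ 2))) P :=
      Integrable.of_bound (Real.measurable_exp.comp
        ((hWm.pow_const 2).const_mul A).neg).aestronglyMeasurable 1 (ae_of_all _ fun ω => by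
          rw [Real.norm_of_nonneg (Real.exp_pos _).le]
          have := mul_nonneg hA (sq_nonneg (W ω))
          exact Real.exp_le_one_iff.2 (by linarith))
    refine ⟨hvi, le_trans ?_ (integral_mono (hei.const_mul g) hvi hvl)⟩
    rw [integral_const_mul]
    refine mul_le_mul_of_nonneg_left (le_integral_exp_neg
      ((hWk (k := 2) (by norm_num)).1.const_mul A) hei ?_) hg0.le
    rw [integral_const_mul]
    exact mul_le_mul_of_nonneg_left (hWk (by norm_num)).2 hA
  have hc0 : 0 < g * Real.exp (-(A * D)) := by positivity
  obtain ⟨hwi, hwc⟩ := hmass hwm hw0 hwg fun ω => (hbd ω).2.2.2.2.1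
  obtain ⟨hw₀i, hw₀c⟩ := hmass hw₀m hw₀0 hw₀g fun ω => (hbd ω).2.2.2.2.2
  obtain ⟨hXi, -⟩ := hprod hwm hUm hw0 hwg hφU
  obtain ⟨hX₀i, hX₀⟩ := hprod hw₀m hU₀m hw₀0 hw₀g hφU₀
  obtain ⟨hQ, hm⟩ := hrep hXi (hc0.trans_le hwc)
  obtain ⟨-, hm₀⟩ := hrep₀ hX₀i (hc0.trans_le hw₀c)
  refine ⟨hQ, abs_quotient_sub_le hc0 hwc hw₀c hm hm₀ hX₀ ?_ ?_⟩
  · rw [← integral_sub hXi hX₀i]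
    -- The cube arises where the weights differ, by `ε * W`, against a test function of size `W ^
    -- 2`; hence the third moment in the hypotheses.
    have hle : ∀ ω, |w ω * φ (U ω) - w₀ ω * φ (U₀ ω)| ≤ b * ε * W ω ^ 3 := fun ω => by
      obtain ⟨h1, h2, h3, h4, -, -⟩ := hbd ω
      have h5 : |φ (U ω) - φ (U₀ ω)| ≤ L * (A * ε) * ((1 + 2 * A) * W ω) := by
        refine (hφ _ _).trans (mul_le_mul (mul_le_mul_of_nonneg_left h3 hL) ?_ (by positivity)
          (by positivity))
        linarith [hW1 ω]
      have h6 : w ω * φ (U ω) - w₀ ω * φ (U₀ ω) =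
          w ω * (φ (U ω) - φ (U₀ ω)) + (w ω - w₀ ω) * φ (U₀ ω) := by ring
      rw [h6]
      refine (abs_add_le _ _).trans ?_
      rw [abs_mul, abs_mul, abs_of_nonneg (hw0 ω)]
      have h7 := mul_le_mul (hwg ω) h5 (abs_nonneg _) hg0.le
      have h8 := mul_le_mul h4 (hφU₀ ω) (abs_nonneg _) ((abs_nonneg _).trans h4)
      have h9 : W ω ≤ W ω ^ 3 := le_self_pow₀ (hW1 ω) (by norm_num)
      have h10 := mul_le_mul_of_nonneg_left h9
        (by positivity : 0 ≤ g * (L * A * (1 + 2 * A)) * ε)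
      rw [hb]
      calc _ ≤ g * (L * (A * ε) * ((1 + 2 * A) * W ω)) + A * ε * W ω * (a * W ω ^ 2) :=
            add_le_add h7 h8
        _ = g * (L * A * (1 + 2 * A)) * ε * W ω + A * a * ε * W ω ^ 3 := by ring
        _ ≤ g * (L * A * (1 + 2 * A)) * ε * W ω ^ 3 + A * a * ε * W ω ^ 3 :=
            add_le_add h10 le_rfl
        _ = _ := by ring
    refine abs_integral_le_integral_abs.trans ((integral_mono (hXi.sub hX₀i).abs
      (hW3i.const_mul (b * ε)) hle).trans ?_)
    rw [integral_const_mul]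
    exact (mul_le_mul_of_nonneg_left hW3 (by positivity)).trans (le_of_eq (by ring))
  · rw [← integral_sub hwi hw₀i]
    have hle : ∀ ω, |w ω - w₀ ω| ≤ A * ε * W ω ^ 1 := fun ω => by
      rw [pow_one]
      exact (hbd ω).2.2.2.1
    refine abs_integral_le_integral_abs.trans ((integral_mono (hwi.sub hw₀i).abs
      ((hWk (k := 1) (by norm_num)).1.const_mul (A * ε)) hle).trans ?_)
    rw [integral_const_mul]
    exact (mul_le_mul_of_nonneg_left (hWk (by norm_num)).2 (by positivity)).trans
      (le_of_eq (by ring))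

/-- The filter depends Lipschitz continuously on the dynamics. -/
lemma exists_trueFilter_sub_le (S : Matrix (Fin du) (Fin du) ℝ) (hS : S.PosDef)
    {Γ : Matrix (Fin dy) (Fin dy) ℝ} (hΓ : Γ.PosDef) (κy κΨ κh ℓh ℓΨ m₂ L : ℝ) (J : ℕ)
    (hκy : 0 ≤ κy) (hκΨ : 0 ≤ κΨ) (hκh : 0 ≤ κh) (hℓh : 0 ≤ ℓh) (hL : 0 ≤ L) :
    ∃ C : ℝ, 0 ≤ C ∧ ∀ (N : ℕ) [NeZero N] (Ω : Type w) [MeasurableSpace Ω]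
      (P : Measure Ω) [IsProbabilityMeasure P] (μ₀ : Measure (Vec du)) (u₀ : Fin N → Ω → Vec du)
      (ξ : ℕ → Fin N → Ω → Vec du) (η : ℕ → Fin N → Ω → Vec dy) (y : ℕ → Vec dy)
      (h : Vec du →ᵃ[ℝ] Vec dy) (Ψ₀ : Vec du →ᵃ[ℝ] Vec du) (Ψ : Vec du → Vec du) (ε : ℝ),
      Setting P κy κΨ κh ℓh ℓΨ m₂ S Γ J μ₀ u₀ ξ η y h Ψ₀ Ψ ε →
      ∀ φ : Vec du → ℝ, φ 0 = 0 →
      (∀ u v, |φ u - φ v| ≤ L * ‖u - v‖ * (1 + ‖u‖ + ‖v‖)) →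
      Integrable φ (trueFilter Ψ h S Γ y μ₀ J) ∧
      |∫ u, φ u ∂(trueFilter Ψ h S Γ y μ₀ J) - ∫ u, φ u ∂(trueFilter Ψ₀ h S Γ y μ₀ J)| ≤
        C * ε := by
  obtain ⟨A, hA, hAb⟩ := exists_pathWeight_bounds (du := du) hΓ ℓΨ J hκy hκΨ hκh hℓh
  obtain ⟨D, hD0, hD⟩ := exists_integral_inputSize_pow_le.{w} (du := du) (dy := dy) S Γ J m₂ 3
  have hG := densityMax_pos hΓ
  have hG0 : 0 < densityMax Γ ^ J := by positivity
  refine ⟨((densityMax Γ ^ J * (L * A * (1 + 2 * A)) + A * (L * (A * (1 + A)))) * D +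
      A * D * (densityMax Γ ^ J * (L * (A * (1 + A))) * D /
        (densityMax Γ ^ J * Real.exp (-(A * D))))) /
      (densityMax Γ ^ J * Real.exp (-(A * D))), by positivity,
    fun N _ Ω _ P _ μ₀ u₀ ξ η y h Ψ₀ Ψ ε H φ hφ0 hφ => ?_⟩
  -- The inputs of particle `0` serve as signal noise for both filters, so the coupling lives on the
  -- given probability space.
  obtain ⟨hW3i, hW3⟩ := hD N Ω P μ₀ u₀ ξ η H.input H.gaussian H.moment 0
  have hφm : Measurable φ := (continuous_of_abs_sub_le hφ).measurable
  have hhm := (continuous_affine h).measurable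
  have hΨm := H.bounds.continuous_dyn.measurable
  have hΨ₀m := (continuous_affine Ψ₀).measurable
  have hle := H.input.sigmaOf_le (pastOf J 0 J)
  exact weighted_expectation_sub_le (H.input.measurable_inputSize 0)
    ((measurable_pathWeight hΨm hhm Γ y 0 le_rfl).mono hle le_rfl)
    ((measurable_pathWeight hΨ₀m hhm Γ y 0 le_rfl).mono hle le_rfl)
    ((measurable_path hΨm 0 le_rfl).mono hle le_rfl)
    ((measurable_path hΨ₀m 0 le_rfl).mono hle le_rfl) hA hL hG0 H.bounds.eps_nonneg
    (fun ω => one_le_inputSize _ _ _ _) hW3i hW3 (fun ω => pathWeight_nonneg _ _ _)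
    (fun ω => pathWeight_nonneg _ _ _) (fun ω => pathWeight_le hΓ _ _ _)
    (fun ω => pathWeight_le hΓ _ _ _)
    (fun ω => hAb y h Ψ₀ Ψ ε H.bounds (u₀ 0 ω) (fun k => ξ k 0 ω) (fun k => η k 0 ω)) hφ0 hφ
    (H.input.integral_trueFilter hS hΓ hΨm hhm y 0 hφm)
    (H.input.integral_trueFilter hS hΓ hΨ₀m hhm y 0 hφm)

end Stability

end EnKF

namespace EnKF

/-! ### Comparison with the true filter -/

section Conclusion

universe w

variable {du dy : ℕ}

/-- On a unit vector `e` the linear part is `f e - f 0`, of norm at most `2 * κ + κ`. Linear growth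
therefore already gives a Lipschitz constant for affine maps. -/
lemma norm_affine_sub_le {n k : ℕ} (f : Vec n →ᵃ[ℝ] Vec k) {κ : ℝ}
    (hf : ∀ u, ‖f u‖ ≤ κ * (1 + ‖u‖)) (u v : Vec n) : ‖f u - f v‖ ≤ 3 * κ * ‖u - v‖ := by
  have h0 : f u - f v = f.linear (u - v) := by
    rw [← vsub_eq_sub, ← f.linearMap_vsub, vsub_eq_sub]
  rw [h0]
  generalize u - v = x
  rcases eq_or_ne x 0 with rfl | hx
  · simp
  have hx' : 0 < ‖x‖ := norm_pos_iff.2 hx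
  have h1 : f (‖x‖⁻¹ • x) - f 0 = ‖x‖⁻¹ • f.linear x := by
    rw [← vsub_eq_sub, ← f.linearMap_vsub, vsub_eq_sub, sub_zero, map_smul]
  have h2 := norm_sub_le (f (‖x‖⁻¹ • x)) (f 0)
  have h3 := hf (‖x‖⁻¹ • x)
  have h4 := hf 0
  have h5 : ‖‖x‖⁻¹ • x‖ = 1 := by
    rw [norm_smul, norm_inv, norm_norm, inv_mul_cancel₀ hx'.ne']
  rw [h5] at h3
  rw [norm_zero] at h4
  rw [h1, norm_smul, norm_inv, norm_norm] at h2
  have h6 : ‖x‖⁻¹ * ‖f.linear x‖ ≤ 3 * κ := by linarith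
  rwa [inv_mul_le_iff₀ hx', mul_comm] at h6

/-- Only the second moment of the initial law is ever needed; the moment of order `q` enters through
`t ^ 2 ≤ 1 + t ^ q`. -/
lemma integral_norm_sq_le {μ : Measure (Vec du)} (hμ : IsGaussian μ) {q : ℕ} (hq : 2 ≤ q) {m : ℝ}
    (hm : ∫ u, ‖u‖ ^ q ∂μ ≤ m) : ∫ u, ‖u‖ ^ 2 ∂μ ≤ 1 + m := by
  have h1 := IsGaussian.integrable_norm_pow μ 2
  have h2 := IsGaussian.integrable_norm_pow μ q
  calc ∫ u, ‖u‖ ^ 2 ∂μ ≤ ∫ u, (1 + ‖u‖ ^ q) ∂μ := by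
        refine integral_mono h1 ((integrable_const 1).add h2) fun u => ?_
        have hu := norm_nonneg u
        rcases le_total ‖u‖ 1 with h | h
        · have := pow_le_one₀ hu h (n := 2)
          have : 0 ≤ ‖u‖ ^ q := by positivity
          change ‖u‖ ^ 2 ≤ 1 + ‖u‖ ^ q
          linarith
        · have := pow_le_pow_right₀ h hq
          change ‖u‖ ^ 2 ≤ 1 + ‖u‖ ^ q
          linarith
    _ = 1 + ∫ u, ‖u‖ ^ q ∂μ := by
        rw [integral_add (integrable_const 1) h2]
        simp
    _ ≤ 1 + m := by linarith

/-- Mean square error of the ensemble Kalman filter. -/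
lemma exists_filter_error (S : Matrix (Fin du) (Fin du) ℝ) (hS : S.PosDef)
    {Γ : Matrix (Fin dy) (Fin dy) ℝ} (hΓ : Γ.PosDef) (κy κΨ κh ℓh ℓΨ m₂ L : ℝ) (J : ℕ)
    (hκy : 0 ≤ κy) (hκΨ : 0 ≤ κΨ) (hκh : 0 ≤ κh) (hℓh : 0 ≤ ℓh) (hL : 0 ≤ L) :
    ∃ C : ℝ, 0 ≤ C ∧ ∀ (N : ℕ) [NeZero N] (Ω : Type w) [MeasurableSpace Ω]
      (P : Measure Ω) [IsProbabilityMeasure P] (μ₀ : Measure (Vec du)) (u₀ : Fin N → Ω → Vec du)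
      (ξ : ℕ → Fin N → Ω → Vec du) (η : ℕ → Fin N → Ω → Vec dy) (y : ℕ → Vec dy)
      (h : Vec du →ᵃ[ℝ] Vec dy) (Ψ₀ : Vec du →ᵃ[ℝ] Vec du) (Ψ : Vec du → Vec du) (ε : ℝ),
      Setting P κy κΨ κh ℓh ℓΨ m₂ S Γ J μ₀ u₀ ξ η y h Ψ₀ Ψ ε →
      ∀ φ : Vec du → ℝ, (∀ u v, |φ u - φ v| ≤ L * ‖u - v‖ * (1 + ‖u‖ + ‖v‖)) →
      Integrable φ (trueFilter Ψ h S Γ y μ₀ J) ∧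
      MemLp (fun ω => ∫ u, φ u ∂(ensembleMeasure Ψ h Γ y (fun i => u₀ i ω)
          (fun j i => ξ j i ω) (fun j i => η j i ω) J) -
        ∫ u, φ u ∂(trueFilter Ψ h S Γ y μ₀ J)) 2 P ∧
      ∫ ω, |∫ u, φ u ∂(ensembleMeasure Ψ h Γ y (fun i => u₀ i ω)
          (fun j i => ξ j i ω) (fun j i => η j i ω) J) -
        ∫ u, φ u ∂(trueFilter Ψ h S Γ y μ₀ J)| ^ 2 ∂P ≤ C * (ε ^ 2 + (N : ℝ)⁻¹) := by
  obtain ⟨C₁, hC₁, h₁⟩ := exists_ensemble_error.{w} S hS hΓ κy κΨ κh ℓh ℓΨ m₂ L J hκy hκΨ hκh hℓh hL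
  obtain ⟨C₂, hC₂, h₂⟩ :=
    exists_trueFilter_sub_le.{w} S hS hΓ κy κΨ κh ℓh ℓΨ m₂ L J hκy hκΨ hκh hℓh hL
  refine ⟨2 * C₁ + 2 * C₂ ^ 2, by positivity,
    fun N _ Ω _ P _ μ₀ u₀ ξ η y h Ψ₀ Ψ ε H φ hφ => ?_⟩
  -- Subtracting `φ 0` leaves the error unchanged and is necessary for the absolute bounds on the
  -- test function, as the constant must not depend on `φ 0`.
  have hφ' : ∀ u v, |(φ u - φ 0) - (φ v - φ 0)| ≤ L * ‖u - v‖ * (1 + ‖u‖ + ‖v‖) := fun u v => by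
    rw [sub_sub_sub_cancel_right]
    exact hφ u v
  obtain ⟨F, hFi, hFb, hF⟩ := h₁ N Ω P μ₀ u₀ ξ η y h Ψ₀ Ψ ε H (fun u => φ u - φ 0) (sub_self _) hφ'
  obtain ⟨hint, hdiff⟩ := h₂ N Ω P μ₀ u₀ ξ η y h Ψ₀ Ψ ε H (fun u => φ u - φ 0) (sub_self _) hφ'
  have hhm := (continuous_affine h).measurable
  have hΨm := H.bounds.continuous_dyn.measurable
  have hφm : Measurable φ := (continuous_of_abs_sub_le hφ).measurable
  have hμ₀ : IsProbabilityMeasure μ₀ := H.gaussian.toIsProbabilityMeasure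
  have hprob := isProbabilityMeasure_trueFilter hhm hΨm hS hΓ y μ₀ J
  have hφi : Integrable φ (trueFilter Ψ h S Γ y μ₀ J) := by
    have := hint.add (integrable_const (φ 0))
    refine this.congr (ae_of_all _ fun u => ?_)
    simp
  have hshift : ∫ u, (φ u - φ 0) ∂(trueFilter Ψ h S Γ y μ₀ J) =
      ∫ u, φ u ∂(trueFilter Ψ h S Γ y μ₀ J) - φ 0 := by
    rw [integral_sub hφi (integrable_const _)]
    simp
  simp only [ensembleMeasure, integral_empirical]
  have hN : (0 : ℝ) ≤ (N : ℝ)⁻¹ := by positivity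
  have hle : ∀ ω, (avg (fun i => φ (particles Ψ h Γ y (fun i => u₀ i ω) (fun j i => ξ j i ω)
      (fun j i => η j i ω) J i)) - ∫ u, φ u ∂(trueFilter Ψ h S Γ y μ₀ J)) ^ 2 ≤
      2 * F ω + 2 * (C₂ * ε) ^ 2 := by
    intro ω
    have e1 := hF ω
    rw [avg_sub, avg_const] at e1
    rw [hshift] at hdiff
    have e2 := pow_le_pow_left₀ (abs_nonneg _) hdiff 2
    rw [sq_abs] at e2
    generalize ∫ u, (φ u - φ 0) ∂(trueFilter Ψ₀ h S Γ y μ₀ J) = c at *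
    generalize avg (fun i => φ (particles Ψ h Γ y (fun i => u₀ i ω) (fun j i => ξ j i ω)
      (fun j i => η j i ω) J i)) = x at *
    generalize ∫ u, φ u ∂(trueFilter Ψ h S Γ y μ₀ J) = z at *
    -- The square of a difference is at most twice the sum of the squares, with the reference
    -- filter's integral `c` in the middle.
    nlinarith [sq_nonneg ((x - φ 0 - c) + (z - φ 0 - c))]
  have hdom : Integrable (fun ω => 2 * F ω + 2 * (C₂ * ε) ^ 2) P :=
    (hFi.const_mul 2).add (integrable_const _)
  have hmeas : Measurable fun ω => avg (fun i => φ (particles Ψ h Γ y (fun i => u₀ i ω)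
      (fun j i => ξ j i ω) (fun j i => η j i ω) J i)) - ∫ u, φ u ∂(trueFilter Ψ h S Γ y μ₀ J) :=
    ((Finset.measurable_fun_sum _ fun i _ =>
      hφm.comp (H.input.measurable_particles hΨm hhm y le_rfl i)).const_mul _).sub_const _
  have hsq := hdom.mono' (hmeas.pow_const 2).aestronglyMeasurable (ae_of_all _ fun ω => by
    rw [Real.norm_of_nonneg (sq_nonneg _)]
    exact hle ω)
  refine ⟨hφi, (memLp_two_iff_integrable_sq hmeas.aestronglyMeasurable).2 hsq, ?_⟩
  simp only [sq_abs]
  refine (integral_mono hsq hdom hle).trans ?_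
  rw [integral_add (hFi.const_mul 2) (integrable_const _), integral_const_mul]
  simp only [integral_const, probReal_univ, one_smul]
  have e3 : 0 ≤ C₂ ^ 2 * (N : ℝ)⁻¹ := by positivity
  linarith

end Conclusion

end EnKF

theorem mainTheorem4 (du dy J : ℕ)
    (S : Matrix (Fin du) (Fin du) ℝ) (hS : S.PosDef)
    (Γ : Matrix (Fin dy) (Fin dy) ℝ) (hΓ : Γ.PosDef)
    (κy κΨ κh Lφ m : ℝ) (ℓh ℓΨ : NNReal)
    (hκy : 0 < κy) (hκΨ : 0 < κΨ) (hκh : 0 < κh) (hLφ : 0 < Lφ) (hℓh : 0 < ℓh) (hℓΨ : 0 < ℓΨ) :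
    ∃ C : ℝ, 0 < C ∧
      ∀ (y : ℕ → EnKF.Vec dy), (∀ j, 1 ≤ j → j ≤ J → ‖y j‖ ≤ κy) →
      ∀ (h : EnKF.Vec du →ᵃ[ℝ] EnKF.Vec dy), (∀ u, ‖h u‖ ≤ κh * (1 + ‖u‖)) → LipschitzWith ℓh h →
      ∀ (Ψ₀ : EnKF.Vec du →ᵃ[ℝ] EnKF.Vec du), (∀ u, ‖Ψ₀ u‖ ≤ κΨ * (1 + ‖u‖)) →
      ∀ (μ₀ : Measure (EnKF.Vec du)), IsGaussian μ₀ →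
        ∫ u, ‖u‖ ^ (2 * max (max (3 + du) (4 + dy)) (2 * 4 ^ J)) ∂μ₀ ≤ m →
      ∀ (ε : ℝ), 0 ≤ ε → ε ≤ 1 →
      ∀ (Ψ : EnKF.Vec du → EnKF.Vec du), (∀ u, ‖Ψ u - Ψ₀ u‖ ≤ ε) → LipschitzWith ℓΨ Ψ →
      ∀ (φ : EnKF.Vec du → ℝ), (∀ u v, |φ u - φ v| ≤ Lφ * ‖u - v‖ * (1 + ‖u‖ + ‖v‖)) →
      ∀ (N : ℕ), 1 ≤ N →
      ∀ (Ω : Type*) [MeasurableSpace Ω] (P : Measure Ω) [IsProbabilityMeasure P]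
        (u₀ : Fin N → Ω → EnKF.Vec du) (ξ : ℕ → Fin N → Ω → EnKF.Vec du)
        (η : ℕ → Fin N → Ω → EnKF.Vec dy), EnKF.IsInput P μ₀ S Γ J u₀ ξ η →
      Integrable φ (EnKF.trueFilter Ψ h S Γ y μ₀ J) ∧
      MemLp (fun ω => ∫ u, φ u ∂(EnKF.ensembleMeasure Ψ h Γ y (fun i => u₀ i ω)
          (fun j i => ξ j i ω) (fun j i => η j i ω) J) -
        ∫ u, φ u ∂(EnKF.trueFilter Ψ h S Γ y μ₀ J)) 2 P ∧
      √(∫ ω, |∫ u, φ u ∂(EnKF.ensembleMeasure Ψ h Γ y (fun i => u₀ i ω)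
          (fun j i => ξ j i ω) (fun j i => η j i ω) J) -
        ∫ u, φ u ∂(EnKF.trueFilter Ψ h S Γ y μ₀ J)| ^ 2 ∂P) ≤ C * (1 / √(N : ℝ) + ε) := by
  obtain ⟨C, hC, hCb⟩ := EnKF.exists_filter_error S hS hΓ κy κΨ κh (ℓh : ℝ) (ℓΨ : ℝ) (1 + m) Lφ J
    hκy.le hκΨ.le hκh.le ℓh.2 hLφ.le
  -- The constant `C` is only known to be nonnegative; adding one makes the final constant positive.
  refine ⟨√C + 1, by positivity, fun y hy h hgrowth hlip Ψ₀ hΨ₀ μ₀ hμ₀ hm ε hε0 hε1 Ψ hclose hΨ φ hφ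
    N hN Ω _ P _ u₀ ξ η hI => ?_⟩
  have hNz : NeZero N := ⟨by omega⟩
  have hq : 2 ≤ 2 * max (max (3 + du) (4 + dy)) (2 * 4 ^ J) := by
    have : 3 + du ≤ max (max (3 + du) (4 + dy)) (2 * 4 ^ J) :=
      (le_max_left _ _).trans (le_max_left _ _)
    omega
  have hlip' : ∀ u v, ‖h u - h v‖ ≤ ℓh * ‖u - v‖ := fun u v => by
    simpa only [dist_eq_norm] using hlip.dist_le_mul u v
  have hΨ' : ∀ u v, ‖Ψ u - Ψ v‖ ≤ ℓΨ * ‖u - v‖ := fun u v => by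
    simpa only [dist_eq_norm] using hΨ.dist_le_mul u v
  obtain ⟨h1, h2, h3⟩ := hCb N Ω P μ₀ u₀ ξ η y h Ψ₀ Ψ ε
    { input := hI
      gaussian := hμ₀
      moment := EnKF.integral_norm_sq_le hμ₀ hq hm
      bounds :=
        { obs := fun j hj => hy (j + 1) (by omega) hj
          obs_growth := hgrowth
          obs_lip := hlip'
          ref_growth := hΨ₀
          ref_lip := EnKF.norm_affine_sub_le Ψ₀ hΨ₀
          dyn_lip := hΨ'
          close := hclose
          eps_nonneg := hε0
          eps_le_one := hε1
          κy_nonneg := hκy.le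
          κΨ_nonneg := hκΨ.le
          κh_nonneg := hκh.le
          ℓh_nonneg := ℓh.2
          ℓΨ_nonneg := ℓΨ.2 } } φ hφ
  refine ⟨h1, h2, (Real.sqrt_le_sqrt h3).trans ?_⟩
  have hs : 0 ≤ 1 / √(N : ℝ) := by positivity
  -- The sum of squares is at most the square of the sum, the cross term being nonnegative, so the
  -- square root can be taken exactly.
  have h4 : C * (ε ^ 2 + (N : ℝ)⁻¹) ≤ C * (1 / √(N : ℝ) + ε) ^ 2 := by
    refine mul_le_mul_of_nonneg_left ?_ hC
    have h5 : (1 / √(N : ℝ)) ^ 2 = (N : ℝ)⁻¹ := by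
      rw [div_pow, one_pow, Real.sq_sqrt (Nat.cast_nonneg N), one_div]
    have h6 := mul_nonneg hs hε0
    rw [add_sq, h5]
    linarith
  calc √(C * (ε ^ 2 + (N : ℝ)⁻¹)) ≤ √(C * (1 / √(N : ℝ) + ε) ^ 2) := Real.sqrt_le_sqrt h4
    _ = √C * (1 / √(N : ℝ) + ε) := by
        rw [Real.sqrt_mul hC, Real.sqrt_sq (by positivity)]
    _ ≤ (√C + 1) * (1 / √(N : ℝ) + ε) := by
        have : 0 ≤ 1 / √(N : ℝ) + ε := by positivity
        linarith
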